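/- All logarithms are to base $2$. **Setting.** There are infinitely many arms. The initial mean reward $\mu_0(a)\in[0,1]$ of each newly sampled arm is drawn independently of the past from a reservoir distribution which is regular with exponent $\beta>0$ and constants $\kappa_1,\kappa_2>0$: $\kappa_1x^\beta\le\mathbb P(\mu_0(a)>1-x)\le\kappa_2x^\beta$ for all $x\in[0,1]$. In round $t=1,\dots,T$ an arm $a_t$ is played and a reward $Y_t\in[0,1]$ is observed whose conditional mean, given everything that happened before (and the choice of $a_t$), is $\mu_t(a_t)\in[0,1]$. After round $t$ an adaptive adversary may change the mean of $a_t$, and only of $a_t$, to any $\mu_{t+1}(a_t)\in[0,1]$, depending on everything that happened so far. Put $$R_T=\sum_{t=1}^T(1-\mu_t(a_t)),\quad L=\sum_{t=2}^{T}\mathbf 1\{\mu_t(a_{t-1})\ne\mu_{t-1}(a_{t-1})\},\quad V=\sum_{t=2}^{T}|\mu_t(a_{t-1})-\mu_{t-1}(a_{t-1})| .$$ **Base algorithm.** A (possibly randomised) finite-armed bandit algorithm Base is given, with instances $\mathrm{Base}(n,K)$ for $n$ rounds and $K$ arms. A $K$-armed environment with (adaptively chosen) means $\mu_s(k)\in[0,1]$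 is $\alpha$-mildly corrupt with reference profile $\mu:\{1,\dots,K\}\to[0,1]$ if almost surely $|\mu_s(k)-\mu(k)|\le\alpha$ in all rounds $s$ for all $k$. Base is assumed to satisfy, with a constant $C_0>0$: for all $1\le K\le n\le 2T$, $r\le\min\{n,T\}$, $\alpha>0$ and every environment that is $\alpha$-mildly corrupt over $r$ rounds with reference profile $\mu$, with probability at least $1-T^{-3}$, $$\max_{k}\sum_{s=1}^{r}\bigl(\mu_s(k)-\mu_s(a_s)\bigr)\le C_0\Bigl(\sum_{k=1}^K\frac{\log T}{\Delta_k}\mathbf 1\{\Delta_k/4\ge\alpha\}+r\alpha\Bigr),\qquad \Delta_k=\max_j\mu(j)-\mu(k).$$ **Blackbox algorithm** (with parameter $C_1$). An episode consists of blocks $m=1,2,\dots$. At the start of block $m$ a set $\mathcal A_m$ of $|\mathcal A_m|=\lceil 2^{m\gamma}\rceil\wedge2^m$ fresh arms is sampled from the reservoir, where $\gamma=\beta/(\beta+1)$ if $\beta\ge1$ and $\gamma=\beta/2$ if $\beta<1$, and a new instance $\mathrm{Base}(2^m,|\mathcal A_m|)$ is run on $\mathcal A_m$ for $2^m$ rounds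 (or until round $T$). If after some round $t$ of the block, which started in round $t_0$, $\sum_{s=t_0}^t(1-Y_s)\ge C_1(|\mathcal A_m|\vee2^{m/2})\log^3T$, then a new episode starts in round $t+1$ with block $1$. **Theorem.** For all $\beta>0$ and $C_0>0$ there is a threshold $C_1^*=C_1^*(\beta,C_0)>0$ such that for all $C_1\ge C_1^*$ and $\kappa_1,\kappa_2>0$ there is a constant $C=C(\beta,C_0,C_1,\kappa_1,\kappa_2)$ such that for every $T\ge2$, every reservoir and every Base as above, and every adaptive adversary, with probability at least $1-4/T$, $$R_T\le C\log^3T\cdot\min\Bigl\{(L+1)^{\frac1{\beta+1}}T^{\frac{\beta}{\beta+1}},\ V^{\frac1{\beta+2}}T^{\frac{\beta+1}{\beta+2}}+T^{\frac{\beta}{\beta+1}}\Bigr\}\qquad\text{if }\beta\ge1,$$ $$R_T\le C\log^{p}T\cdot\min\Bigl\{\sqrt{(L+1)T},\ V^{1/3}T^{2/3}+\sqrt T\Bigr\}\qquad\text{if }\beta<1,$$ where $p=3$ if $1/3<\beta<1$ and $p=4$ if $\beta\le1/3$. -/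

import Mathlib

open MeasureTheory ProbabilityTheory Set

universe u

/-- The initial mean reward `μ₀` of a fresh arm has law `ν` on `[0, 1]`, and
`κ₁ x ^ β ≤ ℙ(μ₀ > 1 - x) ≤ κ₂ x ^ β` for every `x ∈ [0, 1]`. -/
structure IsRegularReservoir (ν : Measure ℝ) (β κ₁ κ₂ : ℝ) : Prop where
  isProb : IsProbabilityMeasure ν
  support : ν (Icc 0 1) = 1
  lower : ∀ x ∈ Icc (0 : ℝ) 1, κ₁ * x ^ β ≤ ν.real (Ioi (1 - x))
  upper : ∀ x ∈ Icc (0 : ℝ) 1, ν.real (Ioi (1 - x)) ≤ κ₂ * x ^ β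

/-- A randomised algorithm for finite-armed bandits. `act n K s h u` is the arm (a number `< K`)
played in round `s` (rounds are counted from `0`) by the instance with `n` rounds and `K` arms,
when `h` lists the arms played and the rewards seen in rounds `0, …, s - 1` and `u ∈ [0, 1]` is
the fresh random seed of round `s`. -/
structure BaseAlgorithm where
  act : (n K s : ℕ) → (Fin s → ℕ × ℝ) → ℝ → ℕ
  act_lt : ∀ n K s h u, 0 < K → act n K s h u < K
  measurable_act : ∀ n K s,
    Measurable fun p : (Fin s → ℕ × ℝ) × ℝ => act n K s p.1 p.2

/-- `r` rounds of the instance `(n, K)` of a base algorithm against an adaptive adversary. `info s`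
is everything that happened before the arm of round `s` is chosen; it contains the means
`mean s k` that the adversary has chosen for round `s`. -/
structure FiniteBanditRun {Ω : Type u} [mΩ : MeasurableSpace Ω] (P : Measure Ω)
    (base : BaseAlgorithm) (n K r : ℕ) where
  info : ℕ → MeasurableSpace Ω
  mean : ℕ → ℕ → Ω → ℝ
  seed : ℕ → Ω → ℝ
  pick : ℕ → Ω → ℕ
  reward : ℕ → Ω → ℝ
  info_le : ∀ s, info s ≤ mΩ
  info_mono : Monotone info
  mean_mem : ∀ s < r, ∀ k < K, ∀ ω, mean s k ω ∈ Icc (0 : ℝ) 1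
  mean_meas : ∀ s < r, ∀ k < K, Measurable[info s] (mean s k)
  seed_meas : ∀ s < r, Measurable[info (s + 1)] (seed s)
  seed_law : ∀ s < r, P.map (seed s) = volume.restrict (Icc 0 1)
  seed_indep : ∀ s < r, Indep (MeasurableSpace.comap (seed s) inferInstance) (info s) P
  pick_eq : ∀ s < r, ∀ ω,
    pick s ω = base.act n K s (fun i => (pick i ω, reward i ω)) (seed s ω)
  reward_mem : ∀ s < r, ∀ ω, reward s ω ∈ Icc (0 : ℝ) 1
  reward_meas : ∀ s < r, Measurable[info (s + 1)] (reward s)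
  reward_mean : ∀ s < r,
    P[reward s | info s ⊔ MeasurableSpace.comap (seed s) inferInstance]
      =ᵐ[P] fun ω => mean s (pick s ω) ω

/-- The environment is `α`-mildly corrupt with reference profile `ref`: throughout the `r` rounds
every mean is within `α` of its reference value. -/
def FiniteBanditRun.MildlyCorrupt {Ω : Type u} [MeasurableSpace Ω] {P : Measure Ω}
    {base : BaseAlgorithm} {n K r : ℕ} (run : FiniteBanditRun P base n K r)
    (ref : ℕ → ℝ) (α : ℝ) : Prop :=
  ∀ᵐ ω ∂P, ∀ s < r, ∀ k < K, |run.mean s k ω - ref k| ≤ α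

/-- The gap of arm `k` among the arms `0, …, K - 1` in the reference profile. -/
noncomputable def refGap (K : ℕ) (ref : ℕ → ℝ) (k : ℕ) : ℝ := (⨆ j : Fin K, ref j) - ref k

open Classical in
/-- `C₀ (∑_k (log T / Δ_k) 1{Δ_k / 4 ≥ α} + r α)`, with the logarithm to base `2`. A best reference
arm has `Δ = 0` and does not contribute, since `α > 0` wherever this is used. -/
noncomputable def baseBound (C₀ : ℝ) (T K r : ℕ) (ref : ℕ → ℝ) (α : ℝ) : ℝ :=
  C₀ * ((∑ k ∈ Finset.range K,
      if α ≤ refGap K ref k / 4 then Real.logb 2 T / refGap K ref k else 0) + r * α)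

/-- The base algorithm tolerates mild corruption (overall horizon `T`): in every `α`-mildly corrupt
environment, its static regret over `r` rounds obeys `baseBound` with probability at least
`1 - T⁻³`. -/
def BaseAlgorithm.ToleratesMildCorruption (base : BaseAlgorithm) (C₀ : ℝ) (T : ℕ) : Prop :=
  ∀ (Ω : Type u) [MeasurableSpace Ω] (P : Measure Ω) [IsProbabilityMeasure P]
    (n K r : ℕ), n ≤ 2 * T → 0 < K → K ≤ n → r ≤ n → r ≤ T →
  ∀ (run : FiniteBanditRun P base n K r) (ref : ℕ → ℝ) (α : ℝ),
    (∀ k < K, ref k ∈ Icc (0 : ℝ) 1) → 0 < α → run.MildlyCorrupt ref α →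
    1 - 1 / (T : ℝ) ^ 3 ≤ P.real {ω | ∀ k < K,
      ∑ s ∈ Finset.range r, (run.mean s k ω - run.mean s (run.pick s ω) ω)
        ≤ baseBound C₀ T K r ref α}

open Classical in
/-- Exponent of the subsampling rate. -/
noncomputable def subsamplingExponent (β : ℝ) : ℝ := if 1 ≤ β then β / (β + 1) else β / 2

/-- Number `|𝒜_m|` of arms subsampled at the start of an `m`-th block. -/
noncomputable def numArms (β : ℝ) (m : ℕ) : ℕ :=
  min ⌈(2 : ℝ) ^ ((m : ℝ) * subsamplingExponent β)⌉₊ (2 ^ m)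

/-- Threshold `C₁ (|𝒜_m| ∨ 2^{m/2}) log³ T` of the changepoint test. -/
noncomputable def testThreshold (β C₁ : ℝ) (T m : ℕ) : ℝ :=
  C₁ * max (numArms β m : ℝ) ((2 : ℝ) ^ ((m : ℝ) / 2)) * Real.logb 2 T ^ 3

/-- The current block: its index `index` in the episode, its first round `first`, and the number
`offset` of arms sampled in all earlier blocks. Arms are numbered in the order of sampling, so this
block plays the arms `offset, …, offset + |𝒜_m| - 1`. -/
@[ext] structure BlockState where
  index : ℕ
  first : ℕ
  offset : ℕ

open Classical in
/-- The block of round `t + 1`, given the block of round `t` and the rewards up to round `t`: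
a new episode if the changepoint test fires, otherwise the next block if all `2 ^ m` rounds of the
block have been played, otherwise the same block. -/
noncomputable def nextBlock (β C₁ : ℝ) (T : ℕ) (y : ℕ → ℝ) (t : ℕ) (b : BlockState) : BlockState :=
  if testThreshold β C₁ T b.index ≤ ∑ s ∈ Finset.Icc b.first t, (1 - y s) then
    ⟨1, t + 1, b.offset + numArms β b.index⟩
  else if t + 1 = b.first + 2 ^ b.index then
    ⟨b.index + 1, t + 1, b.offset + numArms β b.index⟩
  else b

/-- The block of round `t` when the rewards are `y`; rounds are counted from `0` and block indices
from `1`. -/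
noncomputable def blockAt (β C₁ : ℝ) (T : ℕ) (y : ℕ → ℝ) : ℕ → BlockState
  | 0 => ⟨1, 0, 0⟩
  | t + 1 => nextBlock β C₁ T y t (blockAt β C₁ T y t)

/-- A run of the blackbox algorithm over the rounds `0, …, T - 1` against an adaptive adversary.
`past t` is everything that happened before round `t`, including the adversary's move after round
`t - 1`; `info t` adds the arms that are sampled at the beginning of round `t`, if a block starts
there. `mean t i` is the mean reward of the `i`-th arm in round `t`, and `mean 0 i` its initial
mean. The `pick t`-th arm of the current block is played in round `t`. -/
structure BlackboxRun {Ω : Type u} [mΩ : MeasurableSpace Ω] (P : Measure Ω)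
    (ν : Measure ℝ) (base : BaseAlgorithm) (β C₁ : ℝ) (T : ℕ) where
  past : ℕ → MeasurableSpace Ω
  info : ℕ → MeasurableSpace Ω
  mean : ℕ → ℕ → Ω → ℝ
  seed : ℕ → Ω → ℝ
  pick : ℕ → Ω → ℕ
  reward : ℕ → Ω → ℝ
  info_le : ∀ t, info t ≤ mΩ
  past_le_info : ∀ t, past t ≤ info t
  info_le_past_succ : ∀ t, info t ≤ past (t + 1)
  mean_mem : ∀ t < T, ∀ i ω, mean t i ω ∈ Icc (0 : ℝ) 1
  /-- Given the past, the arms sampled at the start of a block have i.i.d. initial means of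
  law `ν`. -/
  sampling : ∀ t < T, ∀ b : BlockState, b.first = t →
    ∀ A : Set Ω, MeasurableSet[past t] A →
      (∀ ω ∈ A, blockAt β C₁ T (fun s => reward s ω) t = b) →
    ∀ B : ℕ → Set ℝ, (∀ i, MeasurableSet (B i)) →
      P (A ∩ {ω | ∀ i < numArms β b.index, mean 0 (b.offset + i) ω ∈ B i})
        = P A * ∏ i ∈ Finset.range (numArms β b.index), ν (B i)
  /-- The current means of the arms sampled so far are part of `info t`. -/
  mean_meas : ∀ t < T, ∀ i, Measurable[info t]
    ({ω | i < (blockAt β C₁ T (fun s => reward s ω) t).offset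
        + numArms β (blockAt β C₁ T (fun s => reward s ω) t).index}.indicator (mean t i))
  /-- The adversary moves before new arms are sampled. -/
  mean_succ_meas : ∀ t, t + 1 < T → ∀ i, Measurable[past (t + 1)]
    ({ω | i < (blockAt β C₁ T (fun s => reward s ω) t).offset
        + numArms β (blockAt β C₁ T (fun s => reward s ω) t).index}.indicator (mean (t + 1) i))
  /-- The adversary can only change the mean of the arm that was just played. -/
  mean_succ_eq : ∀ t, t + 1 < T → ∀ i ω,
    i ≠ (blockAt β C₁ T (fun s => reward s ω) t).offset + pick t ω →
      mean (t + 1) i ω = mean t i ω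
  seed_meas : ∀ t < T, Measurable[past (t + 1)] (seed t)
  seed_law : ∀ t < T, P.map (seed t) = volume.restrict (Icc 0 1)
  seed_indep : ∀ t < T, Indep (MeasurableSpace.comap (seed t) inferInstance) (info t) P
  /-- In each block the arm is chosen by a new instance of the base algorithm, with `2 ^ m` rounds
  and `|𝒜_m|` arms, which sees the history of this block. -/
  pick_eq : ∀ t < T, ∀ ω,
    pick t ω = base.act (2 ^ (blockAt β C₁ T (fun s => reward s ω) t).index)
      (numArms β (blockAt β C₁ T (fun s => reward s ω) t).index)
      (t - (blockAt β C₁ T (fun s => reward s ω) t).first)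
      (fun i => (pick ((blockAt β C₁ T (fun s => reward s ω) t).first + i) ω,
        reward ((blockAt β C₁ T (fun s => reward s ω) t).first + i) ω))
      (seed t ω)
  reward_mem : ∀ t < T, ∀ ω, reward t ω ∈ Icc (0 : ℝ) 1
  reward_meas : ∀ t < T, Measurable[past (t + 1)] (reward t)
  reward_mean : ∀ t < T,
    P[reward t | info t ⊔ MeasurableSpace.comap (seed t) inferInstance]
      =ᵐ[P] fun ω => mean t ((blockAt β C₁ T (fun s => reward s ω) t).offset + pick t ω) ω

namespace BlackboxRun

variable {Ω : Type u} [MeasurableSpace Ω] {P : Measure Ω} {ν : Measure ℝ}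
  {base : BaseAlgorithm} {β C₁ : ℝ} {T : ℕ}

/-- The arm played in round `t`. -/
noncomputable def arm (run : BlackboxRun P ν base β C₁ T) (t : ℕ) (ω : Ω) : ℕ :=
  (blockAt β C₁ T (fun s => run.reward s ω) t).offset + run.pick t ω

/-- Dynamic regret `∑ (1 - μ_t(a_t))`. -/
noncomputable def regret (run : BlackboxRun P ν base β C₁ T) (ω : Ω) : ℝ :=
  ∑ t ∈ Finset.range T, (1 - run.mean t (run.arm t ω) ω)

open Classical in
/-- Number `L` of rounds after which the mean of the played arm changes. -/
noncomputable def numChanges (run : BlackboxRun P ν base β C₁ T) (ω : Ω) : ℕ :=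
  ((Finset.range (T - 1)).filter fun t =>
    run.mean (t + 1) (run.arm t ω) ω ≠ run.mean t (run.arm t ω) ω).card

/-- Total variation `V` of the means of the played arms. -/
noncomputable def totalVariation (run : BlackboxRun P ν base β C₁ T) (ω : Ω) : ℝ :=
  ∑ t ∈ Finset.range (T - 1),
    |run.mean (t + 1) (run.arm t ω) ω - run.mean t (run.arm t ω) ω|

end BlackboxRun

/-! Write `a` for `decayExponent β`, `δ = 2 ^ (-m a)` for the resolution and `h = 2 ^ m δ` for the
scale of block `m`. The test threshold is of order `h log³ T`, because `h` agrees with the maximum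
of the number of arms and `2 ^ (m / 2)` up to a factor two.

A fresh sample is good if it contains an arm within the tolerance `δ log³ T` of mean one and if its
inverse gaps, truncated at `δ`, sum to at most `gapBudget`, which is below `h log² T` for large `T`.
As the subsampling exponent is `a β`, the first condition fails with probability at most `exp (-κ₁
log^(3β) T)`; dyadic summation of the tail and a Chernoff bound make the second fail with
probability at most `T⁻⁴` (`measure_pi_badVectors_le`).

The crux is `tolerance_lt_sum_jump`. If the sample is good and the means move by at most the
tolerance during the block, then the environment is mildly corrupt, the base algorithm has regret of
order `h log³ T`, and the test stays silent. So each firing is paid for either by a bad sample or by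
a movement larger than the tolerance. Conversely, as long as the test is silent the loss is itself
of order `h log³ T` (`sum_loss_le`). Block scales grow geometrically, so for every `r > 0` the
regret is of order `log³ T (r ^ (-a) T + r ^ (1 - a) (F + 1))`, where `F` counts the firings
(`sum_le_of_block_regret`). Apart from bad samples, `F` is at most `L`, and also at most `r ^ a V +
2 T / r` (`fireCount_le`); optimising `r` gives both bounds.

If `β > 1/3`, a union bound excludes all bad samples. Otherwise they are only rare: their number
concentrates around a small fraction of the blocks, there are `O(log T)` blocks per episode, and the
resulting multiple of `F` is absorbed at the price of one more logarithm.

The base guarantee speaks of almost surely corrupt environments with a deterministic profile. A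
block is brought into this form by freezing the environment once it leaves the tolerated range, and
by conditioning on the means at the start of the block, rounded to a countable grid. -/

/-! ### Exponents and scales of the blocks. -/

open Classical in
/-- The exponent `a` for which a block of index `m` has regret of order `2 ^ (m (1 - a))`. -/
noncomputable def decayExponent (β : ℝ) : ℝ := if 1 ≤ β then 1 / (β + 1) else 1 / 2

/-- The order `2 ^ (m (1 - a))` of `max |𝒜_m| 2^(m/2)`. -/
noncomputable def blockScale (β : ℝ) (m : ℕ) : ℝ := (2 : ℝ) ^ ((m : ℝ) * (1 - decayExponent β))

/-- The resolution `2 ^ (- m a)` of a block of index `m`. -/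
noncomputable def blockResolution (β : ℝ) (m : ℕ) : ℝ := (2 : ℝ) ^ (-((m : ℝ) * decayExponent β))

lemma decayExponent_pos {β : ℝ} (hβ : 0 < β) : 0 < decayExponent β := by
  unfold decayExponent; split_ifs <;> positivity

lemma decayExponent_le_half (β : ℝ) : decayExponent β ≤ 1 / 2 := by
  unfold decayExponent
  split_ifs with h
  · exact one_div_le_one_div_of_le (by norm_num) (by linarith)
  · exact le_rfl

/-- This relation ties the sample size to the resolution: a sample of `2 ^ (m a β)` arms has about
one arm within `2 ^ (-m a)` of the optimum. -/
lemma subsamplingExponent_eq (β : ℝ) : subsamplingExponent β = decayExponent β * β := by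
  unfold subsamplingExponent decayExponent
  split_ifs <;> ring

lemma subsamplingExponent_le {β : ℝ} (hβ : 0 < β) :
    subsamplingExponent β ≤ 1 - decayExponent β := by
  unfold subsamplingExponent decayExponent
  split_ifs with h
  · have : β / (β + 1) = 1 - 1 / (β + 1) := by field_simp; ring
    exact this.le
  · push Not at h; linarith

lemma blockScale_pos (β : ℝ) (m : ℕ) : 0 < blockScale β m := by
  unfold blockScale; positivity

lemma blockResolution_pos (β : ℝ) (m : ℕ) : 0 < blockResolution β m := by
  unfold blockResolution; positivity

lemma one_le_blockScale (β : ℝ) (m : ℕ) : 1 ≤ blockScale β m := by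
  unfold blockScale
  apply Real.one_le_rpow (by norm_num)
  have := decayExponent_le_half β
  apply mul_nonneg (by positivity); linarith

lemma two_pow_mul_blockResolution (β : ℝ) (m : ℕ) :
    (2 : ℝ) ^ m * blockResolution β m = blockScale β m := by
  unfold blockResolution blockScale
  rw [← Real.rpow_natCast, ← Real.rpow_add (by norm_num)]
  congr 1; ring

lemma inv_blockResolution_le (β : ℝ) (m : ℕ) :
    (blockResolution β m)⁻¹ ≤ blockScale β m := by
  unfold blockResolution blockScale
  rw [← Real.rpow_neg (by norm_num)]
  apply Real.rpow_le_rpow_of_exponent_le (by norm_num)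
  rw [neg_neg]
  have := decayExponent_le_half β
  apply mul_le_mul_of_nonneg_left _ (by positivity); linarith

lemma numArms_le_two_pow (β : ℝ) (m : ℕ) : numArms β m ≤ 2 ^ m := min_le_right _ _

lemma numArms_pos (β : ℝ) (m : ℕ) : 0 < numArms β m := by
  unfold numArms
  apply lt_min
  · rw [Nat.ceil_pos]; positivity
  · positivity

lemma two_rpow_le_numArms {β : ℝ} (hβ : 0 < β) (m : ℕ) :
    (2 : ℝ) ^ ((m : ℝ) * subsamplingExponent β) ≤ numArms β m := by
  unfold numArms
  rw [Nat.cast_min]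
  apply le_min
  · exact Nat.le_ceil _
  · push_cast
    rw [← Real.rpow_natCast]
    apply Real.rpow_le_rpow_of_exponent_le (by norm_num)
    have := subsamplingExponent_le hβ
    have := decayExponent_pos hβ
    exact mul_le_of_le_one_right (by positivity) (by linarith)

lemma numArms_le {β : ℝ} (hβ : 0 < β) (m : ℕ) :
    (numArms β m : ℝ) ≤ 2 * (2 : ℝ) ^ ((m : ℝ) * subsamplingExponent β) := by
  have h1 : (numArms β m : ℝ) ≤ (⌈(2 : ℝ) ^ ((m : ℝ) * subsamplingExponent β)⌉₊ : ℝ) := by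
    exact_mod_cast min_le_left _ _
  have h2 := Nat.ceil_lt_add_one
    (show 0 ≤ (2 : ℝ) ^ ((m : ℝ) * subsamplingExponent β) by positivity)
  have h3 : 1 ≤ (2 : ℝ) ^ ((m : ℝ) * subsamplingExponent β) := by
    apply Real.one_le_rpow (by norm_num)
    rw [subsamplingExponent_eq]
    have := decayExponent_pos hβ
    positivity
  linarith

lemma numArms_le_blockScale {β : ℝ} (hβ : 0 < β) (m : ℕ) :
    (numArms β m : ℝ) ≤ 2 * blockScale β m := by
  refine (numArms_le hβ m).trans ?_
  unfold blockScale
  have := subsamplingExponent_le hβ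
  gcongr
  norm_num

lemma max_le_blockScale {β : ℝ} (hβ : 0 < β) (m : ℕ) :
    max (numArms β m : ℝ) ((2 : ℝ) ^ ((m : ℝ) / 2)) ≤ 2 * blockScale β m := by
  apply max_le (numArms_le_blockScale hβ m)
  have h1 : (2 : ℝ) ^ ((m : ℝ) / 2) ≤ blockScale β m := by
    unfold blockScale
    apply Real.rpow_le_rpow_of_exponent_le (by norm_num)
    have := decayExponent_le_half β
    have : (m : ℝ) * (1 / 2) ≤ (m : ℝ) * (1 - decayExponent β) := by
      apply mul_le_mul_of_nonneg_left _ (by positivity); linarith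
    linarith
  have := blockScale_pos β m
  linarith

/-- For `β ≥ 1` the number of arms dominates, for `β < 1` the term `2 ^ (m / 2)`; the dominating
term is where `decayExponent` comes from. -/
lemma blockScale_le_max {β : ℝ} (hβ : 0 < β) (m : ℕ) :
    blockScale β m ≤ max (numArms β m : ℝ) ((2 : ℝ) ^ ((m : ℝ) / 2)) := by
  by_cases h : 1 ≤ β
  · apply le_max_of_le_left
    have h2 := two_rpow_le_numArms hβ m
    have : subsamplingExponent β = 1 - decayExponent β := by
      unfold subsamplingExponent decayExponent
      rw [if_pos h, if_pos h]; field_simp; ring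
    rwa [this] at h2
  · apply le_max_of_le_right
    unfold blockScale decayExponent
    rw [if_neg h]
    apply le_of_eq; congr 1; ring

lemma one_le_logb_two {T : ℕ} (hT : 2 ≤ T) : 1 ≤ Real.logb 2 T := by
  have h2 : (2 : ℝ) ≤ T := by exact_mod_cast hT
  calc (1 : ℝ) = Real.logb 2 2 := by simp
    _ ≤ _ := Real.logb_le_logb_of_le (by norm_num) (by norm_num) h2

lemma testThreshold_le {β C₁ : ℝ} (hβ : 0 < β) (hC₁ : 0 ≤ C₁) {T : ℕ} (hT : 2 ≤ T) (m : ℕ) :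
    testThreshold β C₁ T m ≤ 2 * C₁ * Real.logb 2 T ^ 3 * blockScale β m := by
  unfold testThreshold
  have h1 := max_le_blockScale hβ m
  have h2 : 0 ≤ Real.logb 2 T ^ 3 := by have := one_le_logb_two hT; positivity
  calc _ ≤ C₁ * (2 * blockScale β m) * Real.logb 2 T ^ 3 := by gcongr
    _ = _ := by ring

lemma le_testThreshold {β C₁ : ℝ} (hβ : 0 < β) (hC₁ : 0 ≤ C₁) {T : ℕ} (hT : 2 ≤ T) (m : ℕ) :
    C₁ * blockScale β m * Real.logb 2 T ^ 3 ≤ testThreshold β C₁ T m := by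
  unfold testThreshold
  have h1 := blockScale_le_max hβ m
  have h2 : 0 ≤ Real.logb 2 T ^ 3 := by have := one_le_logb_two hT; positivity
  gcongr

/-! ### Dynamics of the blocks -/

section Dynamics

variable (β C₁ : ℝ) (T : ℕ) (y : ℕ → ℝ)

/-- The changepoint test fires after round `t`. -/
def Fires (t : ℕ) : Prop :=
  testThreshold β C₁ T (blockAt β C₁ T y t).index
    ≤ ∑ s ∈ Finset.Icc (blockAt β C₁ T y t).first t, (1 - y s)

/-- A block starts in round `t`. -/
def Starts (t : ℕ) : Prop := (blockAt β C₁ T y t).first = t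

open Classical in
/-- Number of rounds before `t` after which the test fires. -/
noncomputable def fireCount (t : ℕ) : ℕ := ((Finset.range t).filter (Fires β C₁ T y)).card

lemma blockAt_succ_of_fires {t : ℕ} (h : Fires β C₁ T y t) :
    blockAt β C₁ T y (t + 1) = ⟨1, t + 1, (blockAt β C₁ T y t).offset
      + numArms β (blockAt β C₁ T y t).index⟩ := by
  unfold Fires at h
  rw [blockAt, nextBlock, if_pos h]

lemma blockAt_succ_of_complete {t : ℕ} (h : ¬ Fires β C₁ T y t)
    (h' : t + 1 = (blockAt β C₁ T y t).first + 2 ^ (blockAt β C₁ T y t).index) :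
    blockAt β C₁ T y (t + 1) = ⟨(blockAt β C₁ T y t).index + 1, t + 1,
      (blockAt β C₁ T y t).offset + numArms β (blockAt β C₁ T y t).index⟩ := by
  unfold Fires at h
  rw [blockAt, nextBlock, if_neg h, if_pos h']

lemma blockAt_succ_of_not {t : ℕ} (h : ¬ Fires β C₁ T y t)
    (h' : ¬ t + 1 = (blockAt β C₁ T y t).first + 2 ^ (blockAt β C₁ T y t).index) :
    blockAt β C₁ T y (t + 1) = blockAt β C₁ T y t := by
  unfold Fires at h
  rw [blockAt, nextBlock, if_neg h, if_neg h']

/-- A property of the rounds and their blocks that survives the three kinds of transitions. -/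
lemma blockAt_induction {motive : ℕ → BlockState → Prop} (zero : motive 0 ⟨1, 0, 0⟩) (N : ℕ)
    (fire : ∀ t < N, Fires β C₁ T y t → motive t (blockAt β C₁ T y t) →
      motive (t + 1) ⟨1, t + 1, (blockAt β C₁ T y t).offset
        + numArms β (blockAt β C₁ T y t).index⟩)
    (complete : ∀ t < N, ¬ Fires β C₁ T y t →
      t + 1 = (blockAt β C₁ T y t).first + 2 ^ (blockAt β C₁ T y t).index →
      motive t (blockAt β C₁ T y t) →
      motive (t + 1) ⟨(blockAt β C₁ T y t).index + 1, t + 1, (blockAt β C₁ T y t).offset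
        + numArms β (blockAt β C₁ T y t).index⟩)
    (stay : ∀ t < N, ¬ Fires β C₁ T y t →
      ¬ t + 1 = (blockAt β C₁ T y t).first + 2 ^ (blockAt β C₁ T y t).index →
      motive t (blockAt β C₁ T y t) → motive (t + 1) (blockAt β C₁ T y t)) :
    ∀ t ≤ N, motive t (blockAt β C₁ T y t) := by
  intro t
  induction t with
  | zero => intro _; exact zero
  | succ t ih =>
    intro ht
    have iht := ih (by omega)
    by_cases h : Fires β C₁ T y t
    · rw [blockAt_succ_of_fires _ _ _ _ h]; exact fire t ht h iht
    · by_cases h' : t + 1 = (blockAt β C₁ T y t).first + 2 ^ (blockAt β C₁ T y t).index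
      · rw [blockAt_succ_of_complete _ _ _ _ h h']; exact complete t ht h h' iht
      · rw [blockAt_succ_of_not _ _ _ _ h h']; exact stay t ht h h' iht

/-- The last bound holds because the completed blocks `1, …, m - 1` of the current episode fill
exactly `2 ^ m - 2` rounds. -/
lemma blockAt_bounds (t : ℕ) :
    1 ≤ (blockAt β C₁ T y t).index ∧ (blockAt β C₁ T y t).first ≤ t ∧
      t < (blockAt β C₁ T y t).first + 2 ^ (blockAt β C₁ T y t).index ∧
      2 ^ (blockAt β C₁ T y t).index ≤ (blockAt β C₁ T y t).first + 2 := by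
  refine blockAt_induction β C₁ T y (motive := fun t b => 1 ≤ b.index ∧ b.first ≤ t ∧
    t < b.first + 2 ^ b.index ∧ 2 ^ b.index ≤ b.first + 2) ?_ t ?_ ?_ ?_ t le_rfl
  · simp
  · intro t _ _ _; simp
  · intro t _ _ h ih
    simp only [pow_succ]
    have : 0 < 2 ^ (blockAt β C₁ T y t).index := by positivity
    omega
  · intro t _ _ h ih
    omega

lemma first_le (t : ℕ) : (blockAt β C₁ T y t).first ≤ t := (blockAt_bounds β C₁ T y t).2.1

lemma two_pow_index_le (t : ℕ) :
    2 ^ (blockAt β C₁ T y t).index ≤ (blockAt β C₁ T y t).first + 2 :=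
  (blockAt_bounds β C₁ T y t).2.2.2

/-- The state is constant during a block. -/
lemma blockAt_eq_of_mem {t s : ℕ} (h1 : (blockAt β C₁ T y t).first ≤ s) (h2 : s ≤ t) :
    blockAt β C₁ T y s = blockAt β C₁ T y t := by
  have key := blockAt_induction β C₁ T y
    (motive := fun t b => ∀ s, b.first ≤ s → s ≤ t → blockAt β C₁ T y s = b) ?_ t ?_ ?_ ?_ t le_rfl
  · exact key s h1 h2
  · intro s _ h; obtain rfl : s = 0 := by omega
    rfl
  · intro t _ h _ s h3 h4
    obtain rfl : s = t + 1 := by simp at h3; omega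
    exact blockAt_succ_of_fires _ _ _ _ h
  · intro t _ h h' _ s h3 h4
    obtain rfl : s = t + 1 := by simp at h3; omega
    exact blockAt_succ_of_complete _ _ _ _ h h'
  · intro t _ h h' ih s h3 h4
    rcases Nat.lt_or_ge t s with h5 | h5
    · obtain rfl : s = t + 1 := by omega
      exact blockAt_succ_of_not _ _ _ _ h h'
    · exact ih s h3 h5

/-- No test fires strictly inside a block. -/
lemma sum_lt_testThreshold (hpos : ∀ m, 0 < testThreshold β C₁ T m) (t : ℕ) :
    ∑ s ∈ Finset.Ico (blockAt β C₁ T y t).first t, (1 - y s)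
      < testThreshold β C₁ T (blockAt β C₁ T y t).index := by
  refine blockAt_induction β C₁ T y (motive := fun t b =>
    ∑ s ∈ Finset.Ico b.first t, (1 - y s) < testThreshold β C₁ T b.index) ?_ t ?_ ?_ ?_ t le_rfl
  · simpa using hpos 1
  · intro t _ _ _; simpa using hpos 1
  · intro t _ _ _ _; simpa using hpos _
  · intro t _ h _ _
    unfold Fires at h
    push Not at h
    simpa [← Finset.Ico_succ_right_eq_Icc] using h


lemma fireCount_succ_of_fires {t : ℕ} (h : Fires β C₁ T y t) :
    fireCount β C₁ T y (t + 1) = fireCount β C₁ T y t + 1 := by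
  unfold fireCount
  rw [Finset.range_add_one, Finset.filter_insert, if_pos h, Finset.card_insert_of_notMem (by simp)]

lemma fireCount_succ_of_not_fires {t : ℕ} (h : ¬ Fires β C₁ T y t) :
    fireCount β C₁ T y (t + 1) = fireCount β C₁ T y t := by
  unfold fireCount
  rw [Finset.range_add_one, Finset.filter_insert, if_neg h]

end Dynamics

/-! ### Counting episodes and summing the regret of blocks. -/

lemma rpow_one_sub_le {x r a : ℝ} (hx : 0 < x) (hr : 0 < r) (ha : 0 ≤ a) (ha' : a ≤ 1) :
    x ^ (1 - a) ≤ r ^ (-a) * x + r ^ (1 - a) := by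
  rcases le_total x r with h | h
  · have h1 : x ^ (1 - a) ≤ r ^ (1 - a) := Real.rpow_le_rpow hx.le h (by linarith)
    have : 0 ≤ r ^ (-a) * x := by positivity
    linarith
  · have h1 : x ^ (1 - a) = x ^ (-a) * x := by
      rw [show 1 - a = -a + 1 by ring, Real.rpow_add hx, Real.rpow_one]
    have h2 : x ^ (-a) ≤ r ^ (-a) := Real.rpow_le_rpow_of_nonpos hr h (by linarith)
    have h3 : x ^ (-a) * x ≤ r ^ (-a) * x := by gcongr
    have : 0 ≤ r ^ (1 - a) := by positivity
    linarith

/-- A firing in a block of length `x` forces a movement of at least `x ^ (-a)`. This movement pays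
for it if `x ≤ r`, and the length of the block pays if `x ≥ r`. -/
lemma one_le_rpow_add {x r a : ℝ} (hx : 0 < x) (hr : 0 < r) (ha : 0 ≤ a) :
    1 ≤ r ^ a * x ^ (-a) + r⁻¹ * x := by
  have h0 : 0 ≤ r ^ a * x ^ (-a) := by positivity
  have h0' : 0 ≤ r⁻¹ * x := by positivity
  rcases le_total x r with h | h
  · have h2 : r ^ (-a) ≤ x ^ (-a) := Real.rpow_le_rpow_of_nonpos hx h (by linarith)
    have : 1 = r ^ a * r ^ (-a) := by rw [← Real.rpow_add hr]; simp
    have : r ^ a * r ^ (-a) ≤ r ^ a * x ^ (-a) := by gcongr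
    linarith
  · have : 1 ≤ r⁻¹ * x := by rw [inv_mul_eq_div, one_le_div hr]; exact h
    linarith

lemma blockScale_eq (β : ℝ) (m : ℕ) :
    blockScale β m = ((2 : ℝ) ^ m) ^ (1 - decayExponent β) := by
  unfold blockScale
  rw [Real.rpow_mul (by norm_num), Real.rpow_natCast]

lemma blockResolution_eq (β : ℝ) (m : ℕ) :
    blockResolution β m = ((2 : ℝ) ^ m) ^ (-decayExponent β) := by
  unfold blockResolution
  rw [← mul_neg, Real.rpow_mul (by norm_num), Real.rpow_natCast]

/-- The ratio is `2 ^ (1 - a) ≥ √2 ≥ 5/4`. Hence `4` times the scale of the current block covers the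
scales of all earlier blocks of the episode. -/
lemma five_mul_blockScale_le (β : ℝ) (m : ℕ) :
    5 * blockScale β m ≤ 4 * blockScale β (m + 1) := by
  have h : blockScale β (m + 1) = blockScale β m * 2 ^ (1 - decayExponent β) := by
    unfold blockScale
    rw [← Real.rpow_add (by norm_num)]
    congr 1; push_cast; ring
  have h2 : (5 / 4 : ℝ) ≤ 2 ^ (1 - decayExponent β) := by
    calc (5 / 4 : ℝ) ≤ √2 := Real.le_sqrt_of_sq_le (by norm_num)
      _ = 2 ^ (1 / 2 : ℝ) := Real.sqrt_eq_rpow 2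
      _ ≤ _ := by
        apply Real.rpow_le_rpow_of_exponent_le (by norm_num)
        have := decayExponent_le_half β; linarith
  rw [h]
  have := blockScale_pos β m
  nlinarith

section Counting

variable {β C₁ : ℝ} {T : ℕ} {y : ℕ → ℝ}

/-- If each block has regret at most `c` times its scale, then the regret is controlled by the
number of episodes. The parameter `r` stands for a typical length of an episode. -/
lemma sum_le_of_block_regret (hβ : 0 < β) {p : ℕ → ℝ} {c r : ℝ} (hc : 0 ≤ c) (hr : 0 < r) {N : ℕ}
    (hblock : ∀ t < N, ∑ s ∈ Finset.Icc (blockAt β C₁ T y t).first t, p s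
      ≤ c * blockScale β (blockAt β C₁ T y t).index) :
    ∑ s ∈ Finset.range N, p s ≤ 10 * c * (r ^ (-decayExponent β) * (2 * N)
      + r ^ (1 - decayExponent β) * (fireCount β C₁ T y N + 1)) := by
  have ha := decayExponent_pos hβ
  have ha' := decayExponent_le_half β
  set a := decayExponent β with hadef
  have hsplit : ∀ n k : ℕ, n ≤ k → ∑ s ∈ Finset.range (k + 1), p s
      = ∑ s ∈ Finset.range n, p s + ∑ s ∈ Finset.Icc n k, p s := by
    intro n k h
    rw [← Finset.Ico_succ_right_eq_Icc, Nat.succ_eq_succ, Finset.sum_range_add_sum_Ico _ (by omega)]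
  rcases Nat.eq_zero_or_pos N with rfl | hNpos
  · simp only [Finset.range_zero, Finset.sum_empty]; positivity
  have hA : 0 < r ^ (-a) := by positivity
  have hB : 0 < r ^ (1 - a) := by positivity
  have hscale : ∀ m : ℕ, blockScale β m ≤ r ^ (-a) * 2 ^ m + r ^ (1 - a) := by
    intro m
    rw [blockScale_eq]
    exact rpow_one_sub_le (by positivity) hr ha.le (by linarith)
  -- `b.first + 2 - 2 ^ b.index` is the first round of the current episode: finished episodes are
  -- charged by their length and number, finished blocks of the current one by `4 c` times the
  -- current scale.
  have key := blockAt_induction β C₁ T y (motive := fun t b =>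
    ∑ s ∈ Finset.range b.first, p s ≤ 10 * c * (r ^ (-a) * (b.first + 2 - 2 ^ b.index)
      + r ^ (1 - a) * fireCount β C₁ T y t) + 4 * c * blockScale β b.index) ?_ N ?_ ?_ ?_ N le_rfl
  · have hb := blockAt_bounds β C₁ T y N
    rcases Nat.lt_or_ge (blockAt β C₁ T y N).first N with hlt | hge
    · obtain ⟨M, rfl⟩ : ∃ M, N = M + 1 := ⟨N - 1, by omega⟩
      have hM := blockAt_eq_of_mem β C₁ T y (s := M) (t := M + 1) (by omega) (by omega)
      have h1 := hblock M (by omega)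
      rw [hM] at h1
      rw [hsplit (blockAt β C₁ T y (M + 1)).first M (by omega)]
      generalize blockAt β C₁ T y (M + 1) = b at *
      have h2 := hscale b.index
      have h3 : (b.first : ℝ) + 1 ≤ (M + 1 : ℕ) := by exact_mod_cast hlt
      have h4 : (2 : ℝ) ^ b.index ≤ b.first + 2 := by exact_mod_cast hb.2.2.2
      have h5 := mul_le_mul_of_nonneg_left h2 hc
      have h6 : r ^ (-a) * (b.first + 1) ≤ r ^ (-a) * (M + 1 : ℕ) := by gcongr
      have h7 : r ^ (-a) * 2 ^ b.index ≤ r ^ (-a) * (b.first + 2) := by gcongr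
      have h8 : c * (r ^ (-a) * (b.first + 1)) ≤ c * (r ^ (-a) * (M + 1 : ℕ)) := by gcongr
      have h9 : 0 ≤ c * r ^ (-a) * (M + 1 : ℕ) := by positivity
      have h9' : 0 ≤ c * r ^ (-a) * (b.first) := by positivity
      have h10 : 0 ≤ c * r ^ (1 - a) := by positivity
      have h11 : 0 ≤ c * r ^ (-a) * (2:ℝ) ^ b.index := by positivity
      have h12 : (2 : ℝ) ≤ 2 ^ b.index := by
        calc (2 : ℝ) = 2 ^ 1 := by norm_num
          _ ≤ _ := pow_le_pow_right₀ (by norm_num) hb.1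
      have h13 : c * r ^ (-a) * 2 ≤ c * r ^ (-a) * (2:ℝ) ^ b.index := by gcongr
      nlinarith
    · have hN : (blockAt β C₁ T y N).first = N := le_antisymm hb.2.1 hge
      generalize blockAt β C₁ T y N = b at *
      rw [hN] at key hb
      have h2 := hscale b.index
      have h5 := mul_le_mul_of_nonneg_left h2 hc
      have h4 : (2 : ℝ) ^ b.index ≤ N + 2 := by exact_mod_cast hb.2.2.2
      have h10 : 0 ≤ c * r ^ (1 - a) := by positivity
      have h12 : (2 : ℝ) ≤ 2 ^ b.index := by
        calc (2 : ℝ) = 2 ^ 1 := by norm_num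
          _ ≤ _ := pow_le_pow_right₀ (by norm_num) hb.1
      have h13 : c * r ^ (-a) * 2 ≤ c * r ^ (-a) * (2:ℝ) ^ b.index := by gcongr
      have h14 : c * r ^ (-a) * 1 ≤ c * r ^ (-a) * N := by gcongr; exact_mod_cast hNpos
      nlinarith
  · simp [fireCount]
    have := blockScale_pos β 1
    positivity
  · intro t ht h ih
    have hb := blockAt_bounds β C₁ T y t
    have h1 := hblock t ht
    rw [fireCount_succ_of_fires _ _ _ _ h, hsplit _ t hb.2.1]
    generalize blockAt β C₁ T y t = b at *
    have h2 := hscale b.index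
    have h5 := mul_le_mul_of_nonneg_left h2 hc
    have h3 : (b.first : ℝ) ≤ t := by exact_mod_cast hb.2.1
    have h6 : c * r ^ (-a) * b.first ≤ c * r ^ (-a) * t := by gcongr
    have h7 : 0 ≤ c * blockScale β 1 := by have := blockScale_pos β 1; positivity
    have h12 : (2 : ℝ) ≤ 2 ^ b.index := by
      calc (2 : ℝ) = 2 ^ 1 := by norm_num
        _ ≤ _ := pow_le_pow_right₀ (by norm_num) hb.1
    have h13 : c * r ^ (-a) * 2 ≤ c * r ^ (-a) * (2:ℝ) ^ b.index := by gcongr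
    have h10 : 0 ≤ c * r ^ (1 - a) := by positivity
    push_cast
    nlinarith
  · intro t ht h h' ih
    have hb := blockAt_bounds β C₁ T y t
    have h1 := hblock t ht
    rw [fireCount_succ_of_not_fires _ _ _ _ h, hsplit _ t hb.2.1]
    generalize blockAt β C₁ T y t = b at *
    have h2 := five_mul_blockScale_le β b.index
    have h3 : ((t + 1 : ℕ) : ℝ) = b.first + 2 ^ b.index := by exact_mod_cast h'
    have h4 : c * (5 * blockScale β b.index) ≤ c * (4 * blockScale β (b.index + 1)) := by gcongr
    dsimp only
    rw [h3, show (b.first : ℝ) + 2 ^ b.index + 2 - 2 ^ (b.index + 1) = b.first + 2 - 2 ^ b.index by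
      ring]
    nlinarith
  · intro t ht h h' ih
    rw [fireCount_succ_of_not_fires _ _ _ _ h]
    exact ih

open Classical in
/-- If each firing of the test in a block that does not start badly is paid for by the weights of
the rounds of this block and its length, then the number of firings is bounded. -/
lemma fireCount_le (bad : ℕ → Prop) {w : ℕ → ℝ} (hw : ∀ s, 0 ≤ w s) {η : ℝ} (hη : 0 ≤ η) {N : ℕ}
    (hpay : ∀ t < N, Fires β C₁ T y t → ¬ bad (blockAt β C₁ T y t).first →
      1 ≤ ∑ s ∈ Finset.Ico (blockAt β C₁ T y t).first t, w s
        + η * 2 ^ (blockAt β C₁ T y t).index) :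
    (fireCount β C₁ T y N : ℝ) ≤
      (((Finset.range N).filter fun s => Starts β C₁ T y s ∧ bad s).card : ℝ)
      + ∑ s ∈ Finset.range (N - 1), w s + 2 * η * N := by
  -- The sum stops before round `b.first - 1`, as the change after it falls between two blocks and
  -- is never charged. On a firing the start of the episode advances by at least `2 ^ index - 1 ≥ 2
  -- ^ index / 2`, hence the factor `2 η`.
  have key := blockAt_induction β C₁ T y (motive := fun t b =>
    (fireCount β C₁ T y t : ℝ) ≤
      (((Finset.range b.first).filter fun s => Starts β C₁ T y s ∧ bad s).card : ℝ)
      + ∑ s ∈ Finset.range (b.first - 1), w s + 2 * η * (b.first + 2 - 2 ^ b.index))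
    ?_ N ?_ ?_ ?_ N le_rfl
  · have hb := blockAt_bounds β C₁ T y N
    generalize blockAt β C₁ T y N = b at *
    have h1 : (((Finset.range b.first).filter fun s => Starts β C₁ T y s ∧ bad s).card : ℝ)
        ≤ (((Finset.range N).filter fun s => Starts β C₁ T y s ∧ bad s).card : ℝ) := by
      have := hb.2.1
      norm_cast
      apply Finset.card_le_card
      gcongr
    have h2 : ∑ s ∈ Finset.range (b.first - 1), w s ≤ ∑ s ∈ Finset.range (N - 1), w s := by
      apply Finset.sum_le_sum_of_subset_of_nonneg
      · have := hb.2.1; gcongr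
      · intro i _ _; exact hw i
    have h12 : (2 : ℝ) ≤ 2 ^ b.index := by
      calc (2 : ℝ) = 2 ^ 1 := by norm_num
        _ ≤ _ := pow_le_pow_right₀ (by norm_num) hb.1
    have h3 : (b.first : ℝ) ≤ N := by exact_mod_cast hb.2.1
    have h4 : 2 * η * (b.first + 2 - 2 ^ b.index) ≤ 2 * η * N := by
      gcongr; linarith
    linarith
  · simp [fireCount]
  · intro t ht h ih
    have hb := blockAt_bounds β C₁ T y t
    have hpay' := hpay t ht h
    have hst : Starts β C₁ T y (blockAt β C₁ T y t).first := by
      unfold Starts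
      rw [blockAt_eq_of_mem β C₁ T y le_rfl hb.2.1]
    rw [fireCount_succ_of_fires _ _ _ _ h]
    generalize blockAt β C₁ T y t = b at *
    have h12 : (2 : ℝ) ≤ 2 ^ b.index := by
      calc (2 : ℝ) = 2 ^ 1 := by norm_num
        _ ≤ _ := pow_le_pow_right₀ (by norm_num) hb.1
    have h3 : (b.first : ℝ) ≤ t := by exact_mod_cast hb.2.1
    have h2 : ∑ s ∈ Finset.range (b.first - 1), w s + ∑ s ∈ Finset.Ico b.first t, w s
        ≤ ∑ s ∈ Finset.range t, w s := by
      rw [← Finset.sum_range_add_sum_Ico w hb.2.1]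
      gcongr ?_ + _
      apply Finset.sum_le_sum_of_subset_of_nonneg
      · gcongr; omega
      · intro i _ _; exact hw i
    simp only [Nat.add_sub_cancel]
    push_cast
    by_cases hbad : bad b.first
    · have h1 : (((Finset.range b.first).filter fun s => Starts β C₁ T y s ∧ bad s).card : ℝ) + 1
          ≤ (((Finset.range (t + 1)).filter fun s => Starts β C₁ T y s ∧ bad s).card : ℝ) := by
        norm_cast
        rw [← Finset.card_insert_of_notMem (a := b.first) (by simp)]
        apply Finset.card_le_card
        intro x hx
        simp only [Finset.mem_insert, Finset.mem_filter, Finset.mem_range] at hx ⊢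
        rcases hx with rfl | ⟨hx, hx'⟩
        · exact ⟨by omega, hst, hbad⟩
        · exact ⟨by omega, hx'⟩
      have h0 : 0 ≤ ∑ s ∈ Finset.Ico b.first t, w s := Finset.sum_nonneg fun i _ => hw i
      have h4 : 2 * η * (b.first + 2 - 2 ^ b.index) ≤ 2 * η * (t + 1 + 2 - 2 ^ 1) := by
        gcongr 2 * η * ?_; linarith
      linarith
    · have h1 : (((Finset.range b.first).filter fun s => Starts β C₁ T y s ∧ bad s).card : ℝ)
          ≤ (((Finset.range (t + 1)).filter fun s => Starts β C₁ T y s ∧ bad s).card : ℝ) := by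
        norm_cast
        apply Finset.card_le_card
        gcongr; omega
      have h0 := hpay' hbad
      have h5 : 2 * η * (b.first + 2 - 2 ^ b.index) + η * 2 ^ b.index
          ≤ 2 * η * (t + 1 + 2 - 2 ^ 1) := by
        have : η * b.first ≤ η * t := by gcongr
        have : η * 2 ≤ η * 2 ^ b.index := by gcongr
        linarith
      linarith
  · intro t ht h h' ih
    rw [fireCount_succ_of_not_fires _ _ _ _ h]
    have hb := blockAt_bounds β C₁ T y t
    generalize blockAt β C₁ T y t = b at *
    refine ih.trans ?_
    have h1 : (((Finset.range b.first).filter fun s => Starts β C₁ T y s ∧ bad s).card : ℝ)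
        ≤ (((Finset.range (t + 1)).filter fun s => Starts β C₁ T y s ∧ bad s).card : ℝ) := by
      norm_cast
      apply Finset.card_le_card
      gcongr; omega
    have h2 : ∑ s ∈ Finset.range (b.first - 1), w s ≤ ∑ s ∈ Finset.range (t + 1 - 1), w s := by
      apply Finset.sum_le_sum_of_subset_of_nonneg
      · gcongr; omega
      · intro i _ _; exact hw i
    have h3 : ((t + 1 : ℕ) : ℝ) = b.first + 2 ^ b.index := by exact_mod_cast h'
    dsimp only
    rw [h3, show (b.first : ℝ) + 2 ^ b.index + 2 - 2 ^ (b.index + 1) = b.first + 2 - 2 ^ b.index by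
      ring]
    linarith
  · intro t ht h h' ih
    rw [fireCount_succ_of_not_fires _ _ _ _ h]
    exact ih

open Classical in
/-- The number of blocks, in terms of the number of episodes and a bound on the block indices. -/
lemma card_starts_le {M N : ℕ} (hM : ∀ t < N, (blockAt β C₁ T y t).index ≤ M) (hN : 0 < N) :
    ((Finset.range N).filter (Starts β C₁ T y)).card ≤ (fireCount β C₁ T y N + 1) * M := by
  have key := blockAt_induction β C₁ T y (motive := fun t b =>
    ((Finset.range (t + 1)).filter (Starts β C₁ T y)).card
      ≤ fireCount β C₁ T y t * M + b.index) ?_ (N - 1) ?_ ?_ ?_ (N - 1) le_rfl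
  · rw [show N - 1 + 1 = N by omega] at key
    refine key.trans ?_
    have h1 : fireCount β C₁ T y (N - 1) ≤ fireCount β C₁ T y N := by
      unfold fireCount
      apply Finset.card_le_card
      gcongr; omega
    have h2 := hM (N - 1) (by omega)
    nlinarith
  · simp only [fireCount, zero_add]
    refine (Finset.card_filter_le _ _).trans ?_
    simp
  · intro t ht h ih
    rw [fireCount_succ_of_fires _ _ _ _ h, Finset.range_add_one, Finset.filter_insert]
    have h2 := hM t (by omega)
    have h3 : (if Starts β C₁ T y (t + 1) then insert (t + 1)
        ((Finset.range (t + 1)).filter (Starts β C₁ T y)) else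
        ((Finset.range (t + 1)).filter (Starts β C₁ T y))).card
        ≤ ((Finset.range (t + 1)).filter (Starts β C₁ T y)).card + 1 := by
      split_ifs
      · exact Finset.card_insert_le _ _
      · omega
    dsimp only
    nlinarith
  · intro t ht h h' ih
    rw [fireCount_succ_of_not_fires _ _ _ _ h, Finset.range_add_one, Finset.filter_insert]
    have h3 : (if Starts β C₁ T y (t + 1) then insert (t + 1)
        ((Finset.range (t + 1)).filter (Starts β C₁ T y)) else
        ((Finset.range (t + 1)).filter (Starts β C₁ T y))).card
        ≤ ((Finset.range (t + 1)).filter (Starts β C₁ T y)).card + 1 := by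
      split_ifs
      · exact Finset.card_insert_le _ _
      · omega
    dsimp only
    omega
  · intro t ht h h' ih
    rw [fireCount_succ_of_not_fires _ _ _ _ h, Finset.range_add_one, Finset.filter_insert]
    have : ¬ Starts β C₁ T y (t + 1) := by
      unfold Starts
      rw [blockAt_succ_of_not _ _ _ _ h h']
      have := first_le β C₁ T y t
      omega
    rw [if_neg this]
    exact ih

end Counting

/-! ### Choice of the typical episode length -/

/-- With about `L + 1` episodes the typical length is `τ / (L + 1)`, and this choice of `r` balances
the two terms. -/
lemma regret_le_of_numChanges {a R D w N L τ : ℝ} (hD : 0 ≤ D) (hw : 1 ≤ w) (hτ : 0 < τ)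
    (hL : 0 ≤ L) (hR : ∀ r : ℝ, 0 < r → R ≤ D * (r ^ (-a) * (2 * τ) + r ^ (1 - a) * N))
    (hN : N ≤ w * (1 + L)) :
    R ≤ 12 * D * w * ((L + 1) ^ a * τ ^ (1 - a)) := by
  have hL1 : 0 < L + 1 := by linarith
  have h := hR (τ / (L + 1)) (by positivity)
  have h1 : (τ / (L + 1)) ^ (-a) * τ = (L + 1) ^ a * τ ^ (1 - a) := by
    rw [Real.div_rpow hτ.le hL1.le, Real.rpow_neg hL1.le, show 1 - a = -a + 1 by ring,
      Real.rpow_add hτ, Real.rpow_one]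
    field_simp
  have h2 : (τ / (L + 1)) ^ (1 - a) * (L + 1) = (L + 1) ^ a * τ ^ (1 - a) := by
    rw [Real.div_rpow hτ.le hL1.le, Real.rpow_sub hL1, Real.rpow_one]
    field_simp
  have h3 : (τ / (L + 1)) ^ (1 - a) * N ≤ w * ((L + 1) ^ a * τ ^ (1 - a)) := by
    rw [← h2]
    calc _ ≤ (τ / (L + 1)) ^ (1 - a) * (w * (1 + L)) := by gcongr
      _ = _ := by ring
  set Q := (L + 1) ^ a * τ ^ (1 - a) with hQ
  have hQ0 : 0 ≤ Q := by positivity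
  have h4 : (τ / (L + 1)) ^ (-a) * (2 * τ) ≤ 2 * (w * Q) := by nlinarith
  have h5 : 0 ≤ D * (w * Q) := by positivity
  have h6 := mul_le_mul_of_nonneg_left (add_le_add h4 h3) hD
  linarith

/-- After inserting the bound on `N`, the terms to balance are `r ^ (-a) τ` and `r V`. -/
lemma regret_le_of_totalVariation {a R D w N V τ : ℝ} (ha : 0 < a) (ha' : a ≤ 1) (hD : 0 ≤ D)
    (hw : 1 ≤ w) (hτ : 0 < τ) (hV : 0 ≤ V)
    (hR : ∀ r : ℝ, 0 < r → R ≤ D * (r ^ (-a) * (2 * τ) + r ^ (1 - a) * N))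
    (hN : ∀ r : ℝ, 0 < r → N ≤ w * (1 + r ^ a * V + 2 * r⁻¹ * τ)) :
    R ≤ 12 * D * w * (V ^ (a / (1 + a)) * τ ^ (1 / (1 + a)) + τ ^ (1 - a)) := by
  have key : ∀ r : ℝ, 0 < r →
      R ≤ D * w * (4 * (r ^ (-a) * τ) + r ^ (1 - a) + r * V) := by
    intro r hr
    have e1 : r ^ (1 - a) * r ^ a = r := by rw [← Real.rpow_add hr]; simp
    have e2 : r ^ (1 - a) * r⁻¹ = r ^ (-a) := by
      rw [← Real.rpow_neg_one, ← Real.rpow_add hr]; congr 1; ring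
    have h1 : r ^ (1 - a) * N ≤ w * (r ^ (1 - a) + r * V + 2 * (r ^ (-a) * τ)) := by
      calc _ ≤ r ^ (1 - a) * (w * (1 + r ^ a * V + 2 * r⁻¹ * τ)) := by
            have := hN r hr; gcongr
        _ = w * (r ^ (1 - a) + (r ^ (1 - a) * r ^ a) * V + 2 * ((r ^ (1 - a) * r⁻¹) * τ)) := by
            ring
        _ = _ := by rw [e1, e2]
    have h2 : r ^ (-a) * (2 * τ) ≤ w * (2 * (r ^ (-a) * τ)) := by
      have : 0 ≤ r ^ (-a) * τ := by positivity
      nlinarith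
    calc R ≤ _ := hR r hr
      _ ≤ D * (w * (2 * (r ^ (-a) * τ)) + w * (r ^ (1 - a) + r * V + 2 * (r ^ (-a) * τ))) := by
          gcongr
      _ = _ := by ring
  have hX : 0 ≤ V ^ (a / (1 + a)) * τ ^ (1 / (1 + a)) := by positivity
  have hY : 0 ≤ τ ^ (1 - a) := by positivity
  have hDw : 0 ≤ D * w := by positivity
  -- If the variation is this small, one episode of length `τ` suffices. Otherwise the balancing
  -- value `(τ / V) ^ (1 / (1 + a))` is at most `τ`, so the leftover `r ^ (1 - a)` is harmless.
  by_cases hc : τ * V ≤ τ ^ (1 - a)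
  · refine (key τ hτ).trans ?_
    have e : τ ^ (-a) * τ = τ ^ (1 - a) := by
      rw [show 1 - a = -a + 1 by ring, Real.rpow_add hτ, Real.rpow_one]
    rw [e, show 12 * D * w * (V ^ (a / (1 + a)) * τ ^ (1 / (1 + a)) + τ ^ (1 - a))
      = D * w * (12 * (V ^ (a / (1 + a)) * τ ^ (1 / (1 + a)) + τ ^ (1 - a))) by ring]
    gcongr
    linarith
  · push Not at hc
    have hVpos : 0 < V := by
      rcases hV.lt_or_eq with h | h
      · exact h
      · rw [← h] at hc; linarith
    have ha1 : 0 < 1 + a := by linarith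
    set s := (τ / V) ^ (1 / (1 + a)) with hs
    have hs0 : 0 < s := by positivity
    have e1 : s ^ (-a) * τ = V ^ (a / (1 + a)) * τ ^ (1 / (1 + a)) := by
      rw [hs, ← Real.rpow_mul (by positivity), Real.div_rpow hτ.le hV,
        show 1 / (1 + a) * -a = -(a / (1 + a)) by ring, Real.rpow_neg hV,
        show (1 : ℝ) / (1 + a) = -(a / (1 + a)) + 1 by field_simp; ring,
        Real.rpow_add hτ, Real.rpow_one]
      field_simp
    have e2 : s * V = s ^ (-a) * τ := by
      have h1 : s ^ (1 + a) = τ / V := by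
        rw [hs, ← Real.rpow_mul (by positivity), one_div_mul_cancel ha1.ne', Real.rpow_one]
      have h2 : s ^ (1 + a) * s ^ (-a) = s := by rw [← Real.rpow_add hs0]; simp
      calc s * V = (s ^ (1 + a) * s ^ (-a)) * V := by rw [h2]
        _ = τ / V * s ^ (-a) * V := by rw [h1]
        _ = s ^ (-a) * τ := by rw [mul_right_comm, div_mul_cancel₀ _ hVpos.ne', mul_comm]
    have e3 : s ≤ τ := by
      have h1 : τ / V ≤ τ ^ (1 + a) := by
        rw [div_le_iff₀ hVpos, show 1 + a = a + 1 by ring, Real.rpow_add hτ, Real.rpow_one]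
        have h2 : τ ^ a * τ ^ (1 - a) = τ := by rw [← Real.rpow_add hτ]; simp
        have h3 : 0 < τ ^ a := by positivity
        nlinarith
      calc s ≤ (τ ^ (1 + a)) ^ (1 / (1 + a)) := by rw [hs]; gcongr
        _ = τ := by rw [← Real.rpow_mul hτ.le]; field_simp; simp
    have e4 : s ^ (1 - a) ≤ τ ^ (1 - a) := Real.rpow_le_rpow hs0.le e3 (by linarith)
    refine (key s hs0).trans ?_
    rw [e2, e1, show 12 * D * w * (V ^ (a / (1 + a)) * τ ^ (1 / (1 + a)) + τ ^ (1 - a))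
      = D * w * (12 * (V ^ (a / (1 + a)) * τ ^ (1 / (1 + a)) + τ ^ (1 - a))) by ring]
    gcongr
    linarith

/-! ### Exponential supermartingales -/

/-- By convexity `exp` lies below its chord over `[0, 1]`, whose slope is `e - 1 ≤ 2`. Such linear
bounds give deviations that are multiplicative in the mean, without a square-root error. -/
lemma exp_le_one_add_two_mul {x : ℝ} (hx : x ∈ Icc (0 : ℝ) 1) : Real.exp (1 * x) ≤ 1 + 2 * x := by
  have h := convexOn_exp.2 (mem_univ 0) (mem_univ 1) (sub_nonneg.2 hx.2) hx.1 (by ring)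
  simp only [smul_eq_mul, mul_zero, mul_one, zero_add, Real.exp_zero] at h
  have := Real.exp_one_lt_d9
  rw [one_mul]
  nlinarith [hx.1, hx.2]

lemma exp_neg_le_one_sub_half {x : ℝ} (hx : x ∈ Icc (0 : ℝ) 1) :
    Real.exp (-1 * x) ≤ 1 + (-1 / 2) * x := by
  have h := convexOn_exp.2 (mem_univ 0) (mem_univ (-1)) (sub_nonneg.2 hx.2) hx.1 (by ring)
  simp only [smul_eq_mul, mul_zero, zero_add, Real.exp_zero] at h
  have h2 : Real.exp (-1) ≤ 1 / 2 := by
    rw [Real.exp_neg, one_div]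
    apply inv_anti₀ (by norm_num)
    have := Real.add_one_le_exp (1 : ℝ); linarith
  rw [show -1 * x = x * -1 by ring]
  nlinarith [hx.1, hx.2]

section Supermartingale

variable {Ω : Type u} {mΩ : MeasurableSpace Ω} {P : Measure Ω} [IsProbabilityMeasure P]

lemma integral_mul_condExp {m : MeasurableSpace Ω} (hm : m ≤ mΩ) {M X : Ω → ℝ}
    (hM : StronglyMeasurable[m] M) (hX : Integrable X P) (hMX : Integrable (M * X) P) :
    ∫ ω, M ω * (P[X | m]) ω ∂P = ∫ ω, M ω * X ω ∂P := by
  have h := condExp_mul_of_stronglyMeasurable_left hM hMX hX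
  rw [← integral_condExp hm (f := fun ω => M ω * X ω)]
  exact (integral_congr_ae h).symm

variable {G : ℕ → MeasurableSpace Ω} {N : ℕ} {X d : ℕ → Ω → ℝ} {θ κ : ℝ}

/-- Given `G t`, the factor `exp (θ X - d)` has mean at most `(1 + κ E[X | G t]) exp (-d) ≤ 1`,
since `1 + x ≤ exp x`. The same statement serves for rewards (both signs of `θ`) and for the count
of bad samples. -/
lemma integral_exp_sum_le_one (hG : ∀ t, G t ≤ mΩ) (hmono : Monotone G)
    (hX : ∀ t < N, ∀ ω, X t ω ∈ Icc (0 : ℝ) 1) (hXm : ∀ t < N, Measurable[G (t + 1)] (X t))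
    {B : ℝ} (hd : ∀ t < N, ∀ ω, |d t ω| ≤ B) (hdm : ∀ t < N, Measurable[G t] (d t))
    (hexp : ∀ x ∈ Icc (0 : ℝ) 1, Real.exp (θ * x) ≤ 1 + κ * x)
    (hcond : ∀ t < N, ∀ᵐ ω ∂P, κ * (P[X t | G t]) ω ≤ d t ω) {s e : ℕ} (hse : s ≤ e) (he : e ≤ N) :
    Measurable[G e] (fun ω => Real.exp (∑ t ∈ Finset.Ico s e, (θ * X t ω - d t ω))) ∧
    Integrable (fun ω => Real.exp (∑ t ∈ Finset.Ico s e, (θ * X t ω - d t ω))) P ∧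
    ∫ ω, Real.exp (∑ t ∈ Finset.Ico s e, (θ * X t ω - d t ω)) ∂P ≤ 1 := by
  have hmeas : ∀ e ≤ N, Measurable[G e]
      (fun ω => ∑ t ∈ Finset.Ico s e, (θ * X t ω - d t ω)) := by
    intro e he
    apply Finset.measurable_fun_sum
    intro t ht
    rw [Finset.mem_Ico] at ht
    have h1 : Measurable[G e] (X t) := (hXm t (by omega)).mono (hmono (by omega)) le_rfl
    have h2 : Measurable[G e] (d t) := (hdm t (by omega)).mono (hmono (by omega)) le_rfl
    exact (h1.const_mul θ).sub h2
  have hbdd : ∀ e ≤ N, ∀ ω, |∑ t ∈ Finset.Ico s e, (θ * X t ω - d t ω)| ≤ N * (|θ| + |B|) := by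
    intro e he ω
    calc _ ≤ ∑ t ∈ Finset.Ico s e, |θ * X t ω - d t ω| := Finset.abs_sum_le_sum_abs _ _
      _ ≤ ∑ t ∈ Finset.Ico s e, (|θ| + |B|) := by
          apply Finset.sum_le_sum
          intro t ht
          rw [Finset.mem_Ico] at ht
          have h1 := hX t (by omega) ω
          have h2 := hd t (by omega) ω
          calc _ ≤ |θ * X t ω| + |d t ω| := abs_sub _ _
            _ ≤ _ := by
              refine add_le_add ?_ ?_
              · rw [abs_mul]
                exact mul_le_of_le_one_right (abs_nonneg _) (abs_le.2 ⟨by linarith [h1.1], h1.2⟩)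
              · exact h2.trans (le_abs_self B)
      _ ≤ _ := by
          rw [Finset.sum_const, nsmul_eq_mul]
          gcongr
          simp; omega
  have hmeas' : ∀ e ≤ N, Measurable[G e]
      (fun ω => Real.exp (∑ t ∈ Finset.Ico s e, (θ * X t ω - d t ω))) := fun e he =>
    Real.measurable_exp.comp (hmeas e he)
  have hint : ∀ e ≤ N, Integrable
      (fun ω => Real.exp (∑ t ∈ Finset.Ico s e, (θ * X t ω - d t ω))) P := by
    intro e he
    refine Integrable.of_bound ((hmeas' e he).mono (hG e) le_rfl).aestronglyMeasurable
      (Real.exp (N * (|θ| + |B|))) (ae_of_all _ fun ω => ?_)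
    rw [Real.norm_eq_abs, Real.abs_exp]
    exact Real.exp_le_exp.2 ((le_abs_self _).trans (hbdd e he ω))
  refine ⟨hmeas' e he, hint e he, ?_⟩
  induction e, hse using Nat.le_induction with
  | base => simp
  | succ e hse ih =>
    have heN : e < N := he
    have ih := ih heN.le
    have hXint : Integrable (X e) P := by
      refine Integrable.of_bound ((hXm e heN).mono (hG _) le_rfl).aestronglyMeasurable
        1 (ae_of_all _ fun ω => ?_)
      rw [Real.norm_eq_abs, abs_le]
      have := hX e heN ω
      exact ⟨by linarith [this.1], this.2⟩
    -- The compensator `d e` is known before `X e`, so it joins the past factor that is pulled out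
    -- of the conditional expectation.
    set M : Ω → ℝ := fun ω =>
      Real.exp (∑ t ∈ Finset.Ico s e, (θ * X t ω - d t ω)) * Real.exp (- d e ω) with hM
    have hMm : Measurable[G e] M := (hmeas' e heN.le).mul (Real.measurable_exp.comp (hdm e heN).neg)
    have hMb : ∀ ω, |M ω| ≤ Real.exp (N * (|θ| + |B|)) * Real.exp |B| := by
      intro ω
      rw [abs_mul, Real.abs_exp, Real.abs_exp]
      gcongr
      · exact (le_abs_self _).trans (hbdd e heN.le ω)
      · exact (neg_le_abs _).trans ((hd e heN ω).trans (le_abs_self B))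
    have hMint : Integrable M P := Integrable.of_bound
      (hMm.mono (hG e) le_rfl).aestronglyMeasurable _ (ae_of_all _ hMb)
    have hMX : Integrable (fun ω => M ω * X e ω) P :=
      hXint.bdd_mul (hMm.mono (hG e) le_rfl).aestronglyMeasurable (ae_of_all _ hMb)
    have hMC : Integrable (fun ω => M ω * (P[X e | G e]) ω) P :=
      integrable_condExp.bdd_mul (hMm.mono (hG e) le_rfl).aestronglyMeasurable (ae_of_all _ hMb)
    have hM0 : ∀ ω, 0 ≤ M ω := fun ω => by positivity
    calc ∫ ω, Real.exp (∑ t ∈ Finset.Ico s (e + 1), (θ * X t ω - d t ω)) ∂P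
        ≤ ∫ ω, (M ω + κ * (M ω * X e ω)) ∂P := by
          apply integral_mono (hint (e + 1) he) (hMint.add (hMX.const_mul κ))
          intro ω
          simp only [Finset.sum_Ico_succ_top hse]
          rw [Real.exp_add, sub_eq_neg_add (θ * X e ω), Real.exp_add, ← mul_assoc]
          have := mul_le_mul_of_nonneg_left (hexp _ (hX e heN ω)) (hM0 ω)
          calc _ ≤ _ := this
            _ = M ω + κ * (M ω * X e ω) := by ring
      _ = ∫ ω, M ω + κ * (M ω * (P[X e | G e]) ω) ∂P := by
          rw [integral_add hMint (hMX.const_mul κ), integral_add hMint (hMC.const_mul κ),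
            integral_const_mul, integral_const_mul,
            integral_mul_condExp (hG e) hMm.stronglyMeasurable hXint hMX]
      _ ≤ ∫ ω, Real.exp (∑ t ∈ Finset.Ico s e, (θ * X t ω - d t ω)) ∂P := by
          apply integral_mono_ae (hMint.add (hMC.const_mul κ)) (hint e heN.le)
          filter_upwards [hcond e heN] with ω hω
          have h1 : 1 + κ * (P[X e | G e]) ω ≤ Real.exp (d e ω) := by
            have := Real.add_one_le_exp (d e ω); linarith
          calc M ω + κ * (M ω * (P[X e | G e]) ω) = M ω * (1 + κ * (P[X e | G e]) ω) := by ring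
            _ ≤ M ω * Real.exp (d e ω) := mul_le_mul_of_nonneg_left h1 (hM0 ω)
            _ = _ := by rw [hM]; dsimp only; rw [mul_assoc, ← Real.exp_add]; simp
      _ ≤ 1 := ih

lemma measureReal_exp_sum_le (hG : ∀ t, G t ≤ mΩ) (hmono : Monotone G)
    (hX : ∀ t < N, ∀ ω, X t ω ∈ Icc (0 : ℝ) 1) (hXm : ∀ t < N, Measurable[G (t + 1)] (X t))
    {B : ℝ} (hd : ∀ t < N, ∀ ω, |d t ω| ≤ B) (hdm : ∀ t < N, Measurable[G t] (d t))
    (hexp : ∀ x ∈ Icc (0 : ℝ) 1, Real.exp (θ * x) ≤ 1 + κ * x)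
    (hcond : ∀ t < N, ∀ᵐ ω ∂P, κ * (P[X t | G t]) ω ≤ d t ω) {s e : ℕ} (hse : s ≤ e) (he : e ≤ N)
    (x : ℝ) :
    P.real {ω | x ≤ ∑ t ∈ Finset.Ico s e, (θ * X t ω - d t ω)} ≤ Real.exp (-x) := by
  obtain ⟨-, h2, h3⟩ := integral_exp_sum_le_one hG hmono hX hXm hd hdm hexp hcond hse he
  have h4 := mul_meas_ge_le_integral_of_nonneg (ae_of_all _ fun ω => (Real.exp_pos _).le) h2
    (Real.exp x)
  simp only [Real.exp_le_exp] at h4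
  rw [Real.exp_neg, ← one_div, le_div_iff₀ (Real.exp_pos x), mul_comm]
  exact h4.trans h3

end Supermartingale

/-! ### Measurability of the run -/

instance : MeasurableSpace BlockState := ⊤

instance : DiscreteMeasurableSpace BlockState := ⟨fun _ => trivial⟩

instance : Countable BlockState :=
  Function.Injective.countable (f := fun b : BlockState => (b.index, b.first, b.offset))
    fun b b' h => by
      simp only [Prod.mk.injEq] at h
      exact BlockState.ext h.1 h.2.1 h.2.2

/-- Blocks and arms are random but take countably many values, so quantities evaluated at them need
only be measurable for each fixed value. -/
lemma Measurable.comp_countable {Ω ι γ : Type*} {m : MeasurableSpace Ω} [Countable ι]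
    [MeasurableSpace ι] [MeasurableSingletonClass ι] [MeasurableSpace γ] {F : ι → Ω → γ}
    {g : Ω → ι} (hF : ∀ i, Measurable (F i)) (hg : Measurable g) :
    Measurable fun ω => F (g ω) ω :=
  (measurable_from_prod_countable_right (f := fun p : ι × Ω => F p.1 p.2) hF).comp
    (hg.prodMk measurable_id)

namespace BlackboxRun

variable {Ω : Type u} [mΩ : MeasurableSpace Ω] {P : Measure Ω} {ν : Measure ℝ}
  {base : BaseAlgorithm} {β C₁ : ℝ} {T : ℕ} (run : BlackboxRun P ν base β C₁ T)

/-- The block of round `t`. -/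
noncomputable abbrev state (t : ℕ) (ω : Ω) : BlockState :=
  blockAt β C₁ T (fun s => run.reward s ω) t

/-- Everything that happened before the reward of round `t` is drawn. -/
@[reducible] def preReward (t : ℕ) : MeasurableSpace Ω :=
  if t < T then run.info t ⊔ MeasurableSpace.comap (run.seed t) inferInstance else run.info t

/-- The expected loss of round `t`. -/
noncomputable def loss (t : ℕ) (ω : Ω) : ℝ := 1 - run.mean t (run.arm t ω) ω

lemma past_mono : Monotone run.past :=
  monotone_nat_of_le_succ fun t => (run.past_le_info t).trans (run.info_le_past_succ t)

lemma info_mono : Monotone run.info :=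
  monotone_nat_of_le_succ fun t => (run.info_le_past_succ t).trans (run.past_le_info _)

lemma past_le (t : ℕ) : run.past t ≤ mΩ := (run.past_le_info t).trans (run.info_le t)

lemma info_le_preReward (t : ℕ) : run.info t ≤ run.preReward t := by
  unfold preReward
  split_ifs
  · exact le_sup_left
  · exact le_rfl

lemma preReward_le_past_succ (t : ℕ) : run.preReward t ≤ run.past (t + 1) := by
  unfold preReward
  split_ifs with h
  · exact sup_le (run.info_le_past_succ t) (run.seed_meas t h).comap_le
  · exact run.info_le_past_succ t

lemma preReward_le (t : ℕ) : run.preReward t ≤ mΩ :=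
  (run.preReward_le_past_succ t).trans (run.past_le _)

lemma preReward_mono : Monotone run.preReward :=
  monotone_nat_of_le_succ fun t => (run.preReward_le_past_succ t).trans
    ((run.past_le_info _).trans (run.info_le_preReward _))

lemma past_succ_le_preReward (t : ℕ) : run.past (t + 1) ≤ run.preReward (t + 1) :=
  (run.past_le_info _).trans (run.info_le_preReward _)

lemma measurable_reward {s t : ℕ} (hst : s < t) (ht : t ≤ T) :
    Measurable[run.past t] (run.reward s) :=
  (run.reward_meas s (by omega)).mono (run.past_mono hst) le_rfl

lemma measurable_state {t : ℕ} (ht : t ≤ T) : Measurable[run.past t] (run.state t) := by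
  induction t with
  | zero => exact measurable_const
  | succ t ih =>
    have ih' : Measurable[run.past (t + 1)] (run.state t) :=
      (ih (by omega)).mono (run.past_mono (by omega)) le_rfl
    have key : ∀ b : BlockState, Measurable[run.past (t + 1)]
        (fun ω => nextBlock β C₁ T (fun s => run.reward s ω) t b) := by
      intro b
      unfold nextBlock
      refine Measurable.ite ?_ measurable_const measurable_const
      apply measurableSet_le measurable_const
      apply Finset.measurable_fun_sum
      intro s hs
      rw [Finset.mem_Icc] at hs
      exact measurable_const.sub (run.measurable_reward (by omega) ht)
    exact Measurable.comp_countable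
      (F := fun b ω => nextBlock β C₁ T (fun s => run.reward s ω) t b) key ih'

lemma measurableSet_state {t : ℕ} (ht : t ≤ T) (b : BlockState) :
    MeasurableSet[run.past t] {ω | run.state t ω = b} :=
  run.measurable_state ht (measurableSet_singleton b)

lemma pick_lt {t : ℕ} (ht : t < T) (ω : Ω) :
    run.pick t ω < numArms β (run.state t ω).index := by
  rw [run.pick_eq t ht ω]
  exact base.act_lt _ _ _ _ _ (numArms_pos _ _)

lemma measurable_seed_preReward {t : ℕ} (ht : t < T) :
    Measurable[run.preReward t] (run.seed t) := by
  rw [measurable_iff_comap_le]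
  unfold preReward
  rw [if_pos ht]
  exact le_sup_right

/-- Strong induction is needed, because the base algorithm sees all its earlier choices in the
block. -/
lemma measurable_pick {t : ℕ} (ht : t < T) : Measurable[run.preReward t] (run.pick t) := by
  induction t using Nat.strong_induction_on with
  | _ t ih =>
  have hprev : ∀ s < t, Measurable[run.preReward t] (run.pick s) ∧
      Measurable[run.preReward t] (run.reward s) := by
    intro s hs
    refine ⟨(ih s hs (by omega)).mono (run.preReward_mono hs.le) le_rfl, ?_⟩
    exact (run.measurable_reward hs ht.le).mono
      ((run.past_le_info t).trans (run.info_le_preReward t)) le_rfl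
  have hst : Measurable[run.preReward t] (run.state t) :=
    (run.measurable_state ht.le).mono
      ((run.past_le_info t).trans (run.info_le_preReward t)) le_rfl
  have key : ∀ b : BlockState, Measurable[run.preReward t] (fun ω =>
      base.act (2 ^ b.index) (numArms β b.index) (t - b.first)
      (fun i => (run.pick (b.first + i) ω, run.reward (b.first + i) ω)) (run.seed t ω)) := by
    intro b
    refine (base.measurable_act (2 ^ b.index) (numArms β b.index) (t - b.first)).comp
      (Measurable.prodMk ?_ (run.measurable_seed_preReward ht))
    refine @measurable_pi_lambda Ω (Fin (t - b.first)) (fun _ => ℕ × ℝ) (run.preReward t) _ _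
      fun i => ?_
    have := i.2
    exact (hprev _ (by omega)).1.prodMk (hprev _ (by omega)).2
  have := Measurable.comp_countable (F := fun (b : BlockState) ω =>
      base.act (2 ^ b.index) (numArms β b.index) (t - b.first)
      (fun i => (run.pick (b.first + i) ω, run.reward (b.first + i) ω)) (run.seed t ω)) key hst
  convert this using 2 with ω
  exact run.pick_eq t ht ω

lemma arm_lt {t : ℕ} (ht : t < T) (ω : Ω) :
    run.arm t ω < (run.state t ω).offset + numArms β (run.state t ω).index := by
  exact Nat.add_lt_add_left (run.pick_lt ht ω) _

lemma measurable_loss {t : ℕ} (ht : t < T) : Measurable[run.preReward t] (run.loss t) := by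
  have hst : Measurable[run.preReward t] (run.state t) :=
    (run.measurable_state ht.le).mono
      ((run.past_le_info t).trans (run.info_le_preReward t)) le_rfl
  have harm : Measurable[run.preReward t] (run.arm t) := by
    have : Measurable[run.preReward t] fun ω => (run.state t ω).offset :=
      (measurable_of_countable (fun b : BlockState => b.offset)).comp hst
    exact this.add (run.measurable_pick ht)
  have := Measurable.comp_countable
    (fun i => (run.mean_meas t ht i).mono (run.info_le_preReward t) le_rfl) harm
  have h2 := measurable_const (a := (1 : ℝ)).sub this
  convert h2 using 1
  funext ω
  simp only [loss, Pi.sub_apply]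
  rw [indicator_of_mem]
  exact run.arm_lt ht ω

lemma loss_mem {t : ℕ} (ht : t < T) (ω : Ω) : run.loss t ω ∈ Icc (0 : ℝ) 1 := by
  have := run.mean_mem t ht (run.arm t ω) ω
  unfold loss
  exact ⟨by linarith [this.2], by linarith [this.1]⟩

lemma regret_eq (ω : Ω) : run.regret ω = ∑ t ∈ Finset.range T, run.loss t ω := rfl

/-! ### Concentration of the rewards -/

variable [IsProbabilityMeasure P]

lemma condExp_one_sub_reward {t : ℕ} (ht : t < T) :
    P[fun ω => 1 - run.reward t ω | run.preReward t] =ᵐ[P] run.loss t := by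
  have hint : Integrable (run.reward t) P := by
    refine Integrable.of_bound ((run.reward_meas t ht).mono (run.past_le _)
      le_rfl).aestronglyMeasurable 1 (ae_of_all _ fun ω => ?_)
    rw [Real.norm_eq_abs, abs_le]
    have := run.reward_mem t ht ω
    exact ⟨by linarith [this.1], this.2⟩
  have h1 := condExp_sub (integrable_const (1 : ℝ)) hint (run.preReward t) (μ := P)
  have h2 : P[run.reward t | run.preReward t] =ᵐ[P] fun ω => run.mean t (run.arm t ω) ω := by
    have := run.reward_mean t ht
    unfold preReward
    rw [if_pos ht]
    exact this
  rw [condExp_const (run.preReward_le t)] at h1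
  filter_upwards [h1, h2] with ω h3 h4
  rw [show (fun ω => 1 - run.reward t ω) = (fun _ => (1 : ℝ)) - run.reward t from rfl, h3,
    Pi.sub_apply, h4]
  rfl

lemma measureReal_reward_loss_le {s e : ℕ} (hse : s ≤ e) (he : e ≤ T) (x : ℝ) :
    P.real {ω | x ≤ ∑ t ∈ Finset.Ico s e, ((1 - run.reward t ω) - 2 * run.loss t ω)}
      ≤ Real.exp (-x) := by
  have := measureReal_exp_sum_le (P := P) (G := run.preReward) (N := T) (θ := 1) (κ := 2) (B := 2)
    (X := fun t ω => 1 - run.reward t ω) (d := fun t ω => 2 * run.loss t ω)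
    run.preReward_le run.preReward_mono
    (fun t ht ω => by
      have := run.reward_mem t ht ω; exact ⟨by linarith [this.2], by linarith [this.1]⟩)
    (fun t ht => measurable_const.sub
      ((run.reward_meas t ht).mono (run.past_succ_le_preReward t) le_rfl))
    (fun t ht ω => by
      have := run.loss_mem ht ω
      rw [abs_le]; exact ⟨by linarith [this.1], by linarith [this.2]⟩)
    (fun t ht => (run.measurable_loss ht).const_mul 2)
    (fun x hx => exp_le_one_add_two_mul hx)
    (fun t ht => by
      filter_upwards [run.condExp_one_sub_reward ht] with ω h
      rw [h]) hse he x
  simpa using this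

lemma measureReal_loss_reward_le {s e : ℕ} (hse : s ≤ e) (he : e ≤ T) (x : ℝ) :
    P.real {ω | x ≤ ∑ t ∈ Finset.Ico s e, (run.loss t ω / 2 - (1 - run.reward t ω))}
      ≤ Real.exp (-x) := by
  have := measureReal_exp_sum_le (P := P) (G := run.preReward) (N := T) (θ := -1) (κ := -1 / 2)
    (B := 1)
    (X := fun t ω => 1 - run.reward t ω) (d := fun t ω => -1 / 2 * run.loss t ω)
    run.preReward_le run.preReward_mono
    (fun t ht ω => by
      have := run.reward_mem t ht ω; exact ⟨by linarith [this.2], by linarith [this.1]⟩)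
    (fun t ht => measurable_const.sub
      ((run.reward_meas t ht).mono (run.past_succ_le_preReward t) le_rfl))
    (fun t ht ω => by
      have := run.loss_mem ht ω
      rw [abs_le]; exact ⟨by linarith [this.2], by linarith [this.1]⟩)
    (fun t ht => (run.measurable_loss ht).const_mul _)
    (fun x hx => exp_neg_le_one_sub_half hx)
    (fun t ht => by
      filter_upwards [run.condExp_one_sub_reward ht] with ω h
      rw [h]) hse he x
  convert this using 5 with ω
  refine Finset.sum_congr rfl fun t _ => ?_
  ring

end BlackboxRun

/-! ### Conditioning on an event -/

section Conditioning

variable {Ω : Type u} {m mΩ : MeasurableSpace Ω} {P : Measure Ω} [IsProbabilityMeasure P]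

/-- Conditioning on an event that `m` already knows only rescales both sides of the defining
integral identity. -/
lemma condExp_cond_ae_eq (hm : m ≤ mΩ) {A : Set Ω} (hA : MeasurableSet[m] A) {f : Ω → ℝ}
    (hf : Integrable f P) : (P[|A])[f | m] =ᵐ[P[|A]] P[f | m] := by
  by_cases h0 : P A = 0
  · rw [cond_eq_zero_of_meas_eq_zero h0]; simp [Filter.EventuallyEq]
  have := cond_isProbabilityMeasure h0
  have hc : (P A)⁻¹ ≠ ⊤ := by simpa using h0
  have hint : ∀ g : Ω → ℝ, Integrable g P → Integrable g (P[|A]) := fun g hg =>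
    (hg.restrict (s := A)).smul_measure hc
  refine (ae_eq_condExp_of_forall_setIntegral_eq hm (hint f hf)
    (fun s _ _ => (hint _ integrable_condExp).integrableOn) (fun s hs _ => ?_)
    stronglyMeasurable_condExp.aestronglyMeasurable).symm
  unfold ProbabilityTheory.cond
  rw [Measure.restrict_smul, integral_smul_measure, integral_smul_measure,
    Measure.restrict_restrict (hm _ hs), setIntegral_condExp hm hf (hs.inter hA)]

lemma cond_apply_of_indep {m' : MeasurableSpace Ω} (hm : m ≤ mΩ) (h : Indep m' m P) {A : Set Ω}
    (hA : MeasurableSet[m] A) (h0 : P A ≠ 0) {B : Set Ω} (hB : MeasurableSet[m'] B) :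
    P[|A] B = P B := by
  rw [cond_apply (hm _ hA), inter_comm, (Indep_iff _ _ _).1 h B A hB hA, mul_comm (P B),
    ← mul_assoc, ENNReal.inv_mul_cancel h0 (measure_ne_top _ _), one_mul]

lemma indep_cond {m' : MeasurableSpace Ω} (hm : m ≤ mΩ) (h : Indep m' m P) {A : Set Ω}
    (hA : MeasurableSet[m] A) : Indep m' m (P[|A]) := by
  by_cases h0 : P A = 0
  · rw [cond_eq_zero_of_meas_eq_zero h0]
    exact (Indep_iff _ _ _).2 fun _ _ _ _ => by simp
  refine (Indep_iff _ _ _).2 fun S I hS hI => ?_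
  rw [cond_apply_of_indep hm h hA h0 hS, cond_apply (hm _ hA), cond_apply (hm _ hA),
    inter_left_comm, (Indep_iff _ _ _).1 h S (A ∩ I) hS (hA.inter hI)]
  ring

end Conditioning

/-- The base guarantee bounds the probability of this set from below; measurability turns this into
a bound on its complement. -/
lemma FiniteBanditRun.measurableSet_regret_le {Ω : Type u} [mΩ : MeasurableSpace Ω]
    {P : Measure Ω} {base : BaseAlgorithm} {n K r : ℕ} (run : FiniteBanditRun P base n K r)
    (hK : 0 < K) (hpick : ∀ s < r, Measurable (run.pick s)) (c : ℝ) :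
    MeasurableSet {ω | ∀ k < K,
      ∑ s ∈ Finset.range r, (run.mean s k ω - run.mean s (run.pick s ω) ω) ≤ c} := by
  have hmean : ∀ s < r, ∀ k < K, Measurable (run.mean s k) := fun s hs k hk =>
    (run.mean_meas s hs k hk).mono (run.info_le s) le_rfl
  have hmp : ∀ s < r, Measurable fun ω => run.mean s (run.pick s ω) ω := by
    intro s hs
    have h := Measurable.comp_countable (F := fun k => if k < K then run.mean s k else 0)
      (g := run.pick s) (fun k => by
        split_ifs with h
        · exact hmean s hs k h
        · exact measurable_const) (hpick s hs)
    convert h using 2 with ω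
    rw [if_pos]
    rw [run.pick_eq s hs ω]
    exact base.act_lt _ _ _ _ _ hK
  simp only [ofPred_forall]
  refine MeasurableSet.iInter fun k => MeasurableSet.iInter fun hk => ?_
  apply measurableSet_le _ measurable_const
  apply Finset.measurable_fun_sum
  intro s hs
  rw [Finset.mem_range] at hs
  exact (hmean s hs k hk).sub (hmp s hs)

/-! ### The base algorithm inside a block -/

namespace BlackboxRun

variable {Ω : Type u} [mΩ : MeasurableSpace Ω] {P : Measure Ω} {ν : Measure ℝ}
  {base : BaseAlgorithm} {β C₁ : ℝ} {T : ℕ} (run : BlackboxRun P ν base β C₁ T)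
  (b : BlockState) (ref : ℕ → ℝ) (α : ℝ)

/-- Up to the `s`-th round of the block `b`, this block is running and the means of its arms have
stayed close to the reference profile. -/
def alive (s : ℕ) : Set Ω :=
  {ω | ∀ s' ≤ s, run.state (b.first + s') ω = b ∧
    ∀ k < numArms β b.index, |run.mean (b.first + s') (b.offset + k) ω - ref k| ≤ α}

lemma alive_anti {s s' : ℕ} (h : s' ≤ s) : run.alive b ref α s ⊆ run.alive b ref α s' :=
  fun _ hω i hi => hω i (hi.trans h)

open Classical in
/-- The history of the base algorithm in the environment that is frozen at the reference profile
as soon as the block ends or the means leave the neighbourhood of the profile. -/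
noncomputable def frozenHistory : ℕ → Ω → ℕ → ℕ × ℝ
  | 0 => fun _ _ => (0, 0)
  | s + 1 => fun ω => Function.update (frozenHistory s ω) s
      (base.act (2 ^ b.index) (numArms β b.index) s (fun i => frozenHistory s ω i)
          (run.seed (b.first + s) ω),
        if ω ∈ run.alive b ref α s then run.reward (b.first + s) ω else
          ref (base.act (2 ^ b.index) (numArms β b.index) s (fun i => frozenHistory s ω i)
          (run.seed (b.first + s) ω)))

/-- The choices of the base algorithm in the frozen environment. -/
noncomputable def frozenPick (s : ℕ) (ω : Ω) : ℕ :=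
  base.act (2 ^ b.index) (numArms β b.index) s (fun i => run.frozenHistory b ref α s ω i)
    (run.seed (b.first + s) ω)

open Classical in
/-- The rewards in the frozen environment. -/
noncomputable def frozenReward (s : ℕ) (ω : Ω) : ℝ :=
  if ω ∈ run.alive b ref α s then run.reward (b.first + s) ω else
    ref (run.frozenPick b ref α s ω)

open Classical in
/-- The means in the frozen environment. -/
noncomputable def frozenMean (s k : ℕ) (ω : Ω) : ℝ :=
  if ω ∈ run.alive b ref α s then run.mean (b.first + s) (b.offset + k) ω else ref k

lemma frozenHistory_succ (s : ℕ) (ω : Ω) :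
    run.frozenHistory b ref α (s + 1) ω = Function.update (run.frozenHistory b ref α s ω) s
      (run.frozenPick b ref α s ω, run.frozenReward b ref α s ω) := rfl

lemma frozenHistory_apply {s i : ℕ} (h : i < s) (ω : Ω) :
    run.frozenHistory b ref α s ω i
      = (run.frozenPick b ref α i ω, run.frozenReward b ref α i ω) := by
  induction s with
  | zero => omega
  | succ s ih =>
    rw [frozenHistory_succ]
    rcases Nat.lt_succ_iff_lt_or_eq.1 h with h' | rfl
    · rw [Function.update_of_ne h'.ne, ih h']
    · rw [Function.update_self]

lemma frozenPick_eq (s : ℕ) (ω : Ω) :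
    run.frozenPick b ref α s ω = base.act (2 ^ b.index) (numArms β b.index) s
      (fun i => (run.frozenPick b ref α i ω, run.frozenReward b ref α i ω))
      (run.seed (b.first + s) ω) := by
  conv_lhs => unfold frozenPick
  congr 1
  funext i
  exact run.frozenHistory_apply b ref α i.2 ω

lemma frozenPick_lt (s : ℕ) (ω : Ω) : run.frozenPick b ref α s ω < numArms β b.index :=
  base.act_lt _ _ _ _ _ (numArms_pos _ _)

variable {b ref α}

/-- Before the freezing both processes feed the same seeds and rewards into the same algorithm. -/
lemma frozenPick_of_alive {s : ℕ} {ω : Ω} (h : ω ∈ run.alive b ref α s) (hs : b.first + s < T) :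
    run.frozenPick b ref α s ω = run.pick (b.first + s) ω := by
  induction s using Nat.strong_induction_on with
  | _ s ih =>
  have hst : run.state (b.first + s) ω = b := (h s le_rfl).1
  rw [run.pick_eq _ hs ω, frozenPick_eq]
  have hst' : blockAt β C₁ T (fun s => run.reward s ω) (b.first + s) = b := hst
  rw [hst']
  -- The round number also indexes the type of the history, so `b.first + s - b.first = s` cannot be
  -- rewritten in place.
  have aux : ∀ s', s' = s → base.act (2 ^ b.index) (numArms β b.index) s'
      (fun i => (run.pick (b.first + i) ω, run.reward (b.first + i) ω))
        (run.seed (b.first + s) ω) = base.act (2 ^ b.index) (numArms β b.index) s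
      (fun i => (run.pick (b.first + i) ω, run.reward (b.first + i) ω))
        (run.seed (b.first + s) ω) := by rintro _ rfl; rfl
  rw [aux _ (Nat.add_sub_cancel_left _ _)]
  congr 1
  funext i
  have hi := run.alive_anti b ref α i.2.le h
  rw [ih i i.2 hi (by have := i.2; omega), frozenReward, if_pos hi]

lemma measurableSet_alive {s : ℕ} (hs : b.first + s < T) :
    MeasurableSet[run.info (b.first + s)] (run.alive b ref α s) := by
  have h : run.alive b ref α s = ⋂ s' ∈ Finset.range (s + 1),
      ({ω | run.state (b.first + s') ω = b} ∩ ⋂ k ∈ Finset.range (numArms β b.index),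
        {ω | |({ω | b.offset + k < (run.state (b.first + s') ω).offset
        + numArms β (run.state (b.first + s') ω).index}.indicator
          (run.mean (b.first + s') (b.offset + k)) ω) - ref k| ≤ α}) := by
    ext ω
    simp only [alive, mem_ofPred_eq, mem_iInter, mem_inter_iff, Finset.mem_range, Nat.lt_succ_iff]
    refine forall₂_congr fun s' hs' => and_congr_right fun h1 => forall₂_congr fun k hk => ?_
    rw [indicator_of_mem]
    simp only [mem_ofPred_eq, h1]
    omega
  rw [h]
  refine Finset.measurableSet_biInter _ fun s' hs' => ?_
  rw [Finset.mem_range] at hs'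
  have hle : run.info (b.first + s') ≤ run.info (b.first + s) := run.info_mono (by omega)
  apply hle
  refine MeasurableSet.inter ?_ (Finset.measurableSet_biInter _ fun k hk => ?_)
  · exact run.past_le_info _ _ (run.measurableSet_state (by omega) b)
  · have h1 := run.mean_meas (b.first + s') (by omega) (b.offset + k)
    exact measurableSet_le (continuous_abs.measurable.comp (h1.sub measurable_const))
      measurable_const

lemma measurable_frozen {s : ℕ} (hs : b.first + s < T) :
    Measurable[run.preReward (b.first + s)] (run.frozenPick b ref α s) ∧
    Measurable[run.past (b.first + s + 1)] (run.frozenReward b ref α s) := by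
  induction s using Nat.strong_induction_on with
  | _ s ih =>
  have h1 : Measurable[run.preReward (b.first + s)] (run.frozenPick b ref α s) := by
    have : run.frozenPick b ref α s = fun ω => base.act (2 ^ b.index) (numArms β b.index) s
      (fun i => (run.frozenPick b ref α i ω, run.frozenReward b ref α i ω))
      (run.seed (b.first + s) ω) := funext (run.frozenPick_eq b ref α s)
    rw [this]
    refine (base.measurable_act (2 ^ b.index) (numArms β b.index) s).comp
      (Measurable.prodMk ?_ (run.measurable_seed_preReward hs))
    refine @measurable_pi_lambda Ω (Fin s) (fun _ => ℕ × ℝ) (run.preReward (b.first + s)) _ _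
      fun i => ?_
    have hi := ih i i.2 (by have := i.2; omega)
    have h3 : run.past (b.first + i + 1) ≤ run.preReward (b.first + s) :=
      (run.past_mono (by have := i.2; omega)).trans
        ((run.past_le_info _).trans (run.info_le_preReward _))
    exact (hi.1.mono (run.preReward_mono (by have := i.2; omega)) le_rfl).prodMk
      (hi.2.mono h3 le_rfl)
  refine ⟨h1, ?_⟩
  unfold frozenReward
  refine Measurable.ite ?_ (run.reward_meas _ hs) ?_
  · exact run.info_le_past_succ _ _ (run.measurableSet_alive hs)
  · exact (measurable_of_countable ref).comp
      (h1.mono (run.preReward_le_past_succ _) le_rfl)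

open Classical in
lemma measurable_frozenMean {s k : ℕ} (hs : b.first + s < T) (hk : k < numArms β b.index) :
    Measurable[run.info (b.first + s)] (run.frozenMean b ref α s k) := by
  have h : run.frozenMean b ref α s k = fun ω => if ω ∈ run.alive b ref α s then
      ({ω | b.offset + k < (run.state (b.first + s) ω).offset
        + numArms β (run.state (b.first + s) ω).index}.indicator
          (run.mean (b.first + s) (b.offset + k)) ω) else ref k := by
    funext ω
    unfold frozenMean
    split_ifs with h
    · rw [indicator_of_mem]
      simp only [mem_ofPred_eq, (h s le_rfl).1]
      omega
    · rfl
  rw [h]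
  exact Measurable.ite (run.measurableSet_alive hs) (run.mean_meas _ hs (b.offset + k))
    measurable_const

lemma frozenReward_mem (href : ∀ k < numArms β b.index, ref k ∈ Icc (0 : ℝ) 1) {s : ℕ}
    (hs : b.first + s < T) (ω : Ω) : run.frozenReward b ref α s ω ∈ Icc (0 : ℝ) 1 := by
  unfold frozenReward
  split_ifs
  · exact run.reward_mem _ hs ω
  · exact href _ (run.frozenPick_lt b ref α s ω)

variable [IsProbabilityMeasure P]

-- Whether the block is still alive is known before the reward is drawn. The reward therefore splits
-- into a true reward on a known event and a deterministic function of the known choice off it.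
open Classical in
lemma condExp_frozenReward (href : ∀ k < numArms β b.index, ref k ∈ Icc (0 : ℝ) 1) {s : ℕ}
    (hs : b.first + s < T) :
    P[run.frozenReward b ref α s | run.preReward (b.first + s)] =ᵐ[P]
      fun ω => run.frozenMean b ref α s (run.frozenPick b ref α s ω) ω := by
  have hAl : MeasurableSet[run.preReward (b.first + s)] (run.alive b ref α s) :=
    run.info_le_preReward _ _ (run.measurableSet_alive hs)
  have hbd : ∀ f : Ω → ℝ, (∀ ω, f ω ∈ Icc (0 : ℝ) 1) → Measurable f → Integrable f P := by
    intro f hf hm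
    refine Integrable.of_bound hm.aestronglyMeasurable 1 (ae_of_all _ fun ω => ?_)
    rw [Real.norm_eq_abs, abs_le]
    exact ⟨by linarith [(hf ω).1], (hf ω).2⟩
  have hrew : Integrable (run.reward (b.first + s)) P :=
    hbd _ (run.reward_mem _ hs) ((run.reward_meas _ hs).mono (run.past_le _) le_rfl)
  have hgm : Measurable[run.preReward (b.first + s)]
      (fun ω => ref (run.frozenPick b ref α s ω)) :=
    (measurable_of_countable ref).comp (run.measurable_frozen hs).1
  have hg : Integrable (fun ω => ref (run.frozenPick b ref α s ω)) P :=
    hbd _ (fun ω => href _ (run.frozenPick_lt b ref α s ω)) (hgm.mono (run.preReward_le _) le_rfl)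
  have hdec : run.frozenReward b ref α s = (run.alive b ref α s).indicator
      (run.reward (b.first + s)) + (run.alive b ref α s)ᶜ.indicator
      (fun ω => ref (run.frozenPick b ref α s ω)) := by
    funext ω
    by_cases h : ω ∈ run.alive b ref α s <;> simp [frozenReward, h]
  have h1 := condExp_add (hrew.indicator (run.preReward_le _ _ hAl))
    (hg.indicator (run.preReward_le _ _ hAl).compl) (run.preReward (b.first + s)) (μ := P)
  have h2 := condExp_indicator hrew hAl (μ := P)
  have h3 : P[(run.alive b ref α s)ᶜ.indicator (fun ω => ref (run.frozenPick b ref α s ω)) |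
      run.preReward (b.first + s)] = (run.alive b ref α s)ᶜ.indicator
      (fun ω => ref (run.frozenPick b ref α s ω)) :=
    condExp_of_stronglyMeasurable (run.preReward_le _)
      (hgm.indicator hAl.compl).stronglyMeasurable (hg.indicator (run.preReward_le _ _ hAl).compl)
  have h4 : P[run.reward (b.first + s) | run.preReward (b.first + s)] =ᵐ[P]
      fun ω => run.mean (b.first + s) (run.arm (b.first + s) ω) ω := by
    have := run.reward_mean _ hs
    unfold preReward
    rw [if_pos hs]
    exact this
  rw [hdec]
  filter_upwards [h1, h2, h4] with ω e1 e2 e4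
  rw [e1, Pi.add_apply, e2, h3]
  by_cases h : ω ∈ run.alive b ref α s
  · have hst : blockAt β C₁ T (fun s => run.reward s ω) (b.first + s) = b := (h s le_rfl).1
    simp only [h, indicator_of_mem, mem_compl_iff, not_true_eq_false, not_false_eq_true,
      indicator_of_notMem, add_zero, e4, frozenMean, if_true]
    rw [run.frozenPick_of_alive h hs, arm, hst]
  · simp [h, frozenMean]

/-- The base algorithm in the frozen environment, conditionally on an event that is known at the
beginning of the block. -/
noncomputable def frozenRun {A : Set Ω} (hA : MeasurableSet[run.info b.first] A) (h0 : P A ≠ 0)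
    (href : ∀ k < numArms β b.index, ref k ∈ Icc (0 : ℝ) 1) {r : ℕ} (hr : b.first + r ≤ T) :
    FiniteBanditRun (P[|A]) base (2 ^ b.index) (numArms β b.index) r where
  info s := run.info (b.first + s)
  mean s k := run.frozenMean b ref α s k
  seed s := run.seed (b.first + s)
  pick s := run.frozenPick b ref α s
  reward s := run.frozenReward b ref α s
  info_le s := run.info_le _
  info_mono := fun i j h => run.info_mono (by omega)
  mean_mem s hs k hk ω := by
    unfold frozenMean
    split_ifs
    · exact run.mean_mem _ (by omega) _ ω
    · exact href k hk
  mean_meas s hs k hk := run.measurable_frozenMean (by omega) hk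
  seed_meas s hs := (run.seed_meas _ (by omega)).mono (run.past_le_info _) le_rfl
  seed_law s hs := by
    rw [← run.seed_law (b.first + s) (by omega)]
    have hm : Measurable (run.seed (b.first + s)) :=
      (run.seed_meas _ (by omega)).mono (run.past_le _) le_rfl
    ext B hB
    rw [Measure.map_apply hm hB, Measure.map_apply hm hB]
    exact cond_apply_of_indep (run.info_le _) (run.seed_indep _ (by omega))
      (run.info_mono (Nat.le_add_right _ _) _ hA) h0 ⟨B, hB, rfl⟩
  seed_indep s hs := indep_cond (run.info_le _) (run.seed_indep _ (by omega))
      (run.info_mono (Nat.le_add_right _ _) _ hA)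
  pick_eq s hs ω := run.frozenPick_eq b ref α s ω
  reward_mem s hs := run.frozenReward_mem href (by omega)
  reward_meas s hs := (run.measurable_frozen (by omega)).2.mono (run.past_le_info _) le_rfl
  reward_mean s hs := by
    have hs' : b.first + s < T := by omega
    have h1 := run.condExp_frozenReward (α := α) href hs'
    have hint : Integrable (run.frozenReward b ref α s) P := by
      refine Integrable.of_bound ((run.measurable_frozen hs').2.mono (run.past_le _)
        le_rfl).aestronglyMeasurable 1 (ae_of_all _ fun ω => ?_)
      rw [Real.norm_eq_abs, abs_le]
      have := run.frozenReward_mem (α := α) href hs' ω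
      exact ⟨by linarith [this.1], this.2⟩
    have h2 := condExp_cond_ae_eq (run.preReward_le (b.first + s))
      (run.info_le_preReward _ _ (run.info_mono (Nat.le_add_right _ s) _ hA)) hint
    have h3 := h2.trans (cond_absolutelyContinuous.ae_le h1)
    unfold preReward at h3
    rwa [if_pos hs'] at h3

open Classical in
/-- The guarantee of the base algorithm during a block, conditionally on an event that is known at
the beginning of the block. -/
lemma measure_inter_base_regret_le {C₀ : ℝ} (hbase : base.ToleratesMildCorruption.{u} C₀ T)
    {A : Set Ω} (hA : MeasurableSet[run.info b.first] A)
    (href : ∀ k < numArms β b.index, ref k ∈ Icc (0 : ℝ) 1) (hα : 0 < α) {r : ℕ}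
    (hr : b.first + (r + 1) ≤ T) (hrn : r + 1 ≤ 2 ^ b.index) (hn : 2 ^ b.index ≤ 2 * T) :
    P (A ∩ {ω | ω ∈ run.alive b ref α r ∧ ∃ k < numArms β b.index,
      baseBound C₀ T (numArms β b.index) (r + 1) ref α < ∑ s ∈ Finset.range (r + 1),
        (run.mean (b.first + s) (b.offset + k) ω
          - run.mean (b.first + s) (run.arm (b.first + s) ω) ω)})
      ≤ ENNReal.ofReal (1 / (T : ℝ) ^ 3) * P A := by
  by_cases h0 : P A = 0
  · rw [measure_mono_null inter_subset_left h0, h0, mul_zero]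
  have := cond_isProbabilityMeasure h0
  set K := numArms β b.index with hK
  set R := run.frozenRun (ref := ref) (α := α) hA h0 href hr with hR
  set S := {ω | ∀ k < K, ∑ s ∈ Finset.range (r + 1),
    (R.mean s k ω - R.mean s (R.pick s ω) ω) ≤ baseBound C₀ T K (r + 1) ref α} with hS
  have hcor : R.MildlyCorrupt ref α := by
    refine ae_of_all _ fun ω s hs k hk => ?_
    change |run.frozenMean b ref α s k ω - ref k| ≤ α
    unfold frozenMean
    split_ifs with h
    · exact (h s le_rfl).2 k hk
    · simpa using hα.le
  have hSm : MeasurableSet S := R.measurableSet_regret_le (numArms_pos _ _)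
    (fun s hs => (run.measurable_frozen (by omega)).1.mono (run.preReward_le _) le_rfl) _
  have h1 := hbase Ω (P[|A]) (2 ^ b.index) K (r + 1) hn (numArms_pos _ _)
    (numArms_le_two_pow _ _) hrn (by omega) R ref α href hα hcor
  have h2 : (P[|A]).real Sᶜ ≤ 1 / (T : ℝ) ^ 3 := by
    rw [probReal_compl_eq_one_sub hSm]; linarith
  have h3 : P[|A] Sᶜ ≤ ENNReal.ofReal (1 / (T : ℝ) ^ 3) := by
    rw [← ofReal_measureReal]
    exact ENNReal.ofReal_le_ofReal h2
  rw [cond_apply (run.info_le _ _ hA), ← ENNReal.div_eq_inv_mul,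
    ENNReal.div_le_iff h0 (measure_ne_top _ _)] at h3
  refine (measure_mono ?_).trans h3
  rintro ω ⟨hωA, hal, k, hk, hlt⟩
  refine ⟨hωA, fun hω => ?_⟩
  have h4 := hω k hk
  refine absurd h4 (not_le.2 (hlt.trans_eq (Finset.sum_congr rfl fun s hs => ?_)))
  rw [Finset.mem_range] at hs
  have hal' : ω ∈ run.alive b ref α s := run.alive_anti b ref α (by omega) hal
  have hst : blockAt β C₁ T (fun s => run.reward s ω) (b.first + s) = b := (hal' s le_rfl).1
  change _ = run.frozenMean b ref α s k ω
    - run.frozenMean b ref α s (run.frozenPick b ref α s ω) ω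
  rw [frozenMean, frozenMean, if_pos hal', if_pos hal', run.frozenPick_of_alive hal' (by omega),
    arm, hst]

end BlackboxRun

/-! ### The base guarantee with a random reference profile. -/

lemma baseBound_congr {C₀ : ℝ} {T K r : ℕ} {ref ref' : ℕ → ℝ} {α : ℝ}
    (h : ∀ k < K, ref k = ref' k) : baseBound C₀ T K r ref α = baseBound C₀ T K r ref' α := by
  have h1 : ∀ k < K, refGap K ref k = refGap K ref' k := by
    intro k hk
    unfold refGap
    rw [h k hk]
    congr 2
    funext j
    exact h j j.2
  unfold baseBound
  congr 2
  refine Finset.sum_congr rfl fun k hk => ?_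
  rw [h1 k (Finset.mem_range.1 hk)]

lemma measure_le_mul_measure_iUnion {Ω ι : Type*} [MeasurableSpace Ω] {P : Measure Ω}
    [Countable ι] {A : ι → Set Ω} (hA : ∀ i, MeasurableSet (A i))
    (hd : Pairwise (Function.onFun Disjoint A)) {E : Set Ω} {c : ENNReal}
    (h : ∀ i, P (A i ∩ E) ≤ c * P (A i)) (hE : E ⊆ ⋃ i, A i) : P E ≤ c * P (⋃ i, A i) := by
  calc P E ≤ P (⋃ i, A i ∩ E) := measure_mono fun ω hω => by
        obtain ⟨i, hi⟩ := mem_iUnion.1 (hE hω)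
        exact mem_iUnion.2 ⟨i, hi, hω⟩
    _ ≤ ∑' i, P (A i ∩ E) := measure_iUnion_le _
    _ ≤ ∑' i, c * P (A i) := ENNReal.tsum_le_tsum h
    _ = c * P (⋃ i, A i) := by rw [ENNReal.tsum_mul_left, measure_iUnion hd hA]

namespace BlackboxRun

variable {Ω : Type u} [mΩ : MeasurableSpace Ω] {P : Measure Ω} {ν : Measure ℝ}
  {base : BaseAlgorithm} {β C₁ : ℝ} {T : ℕ} (run : BlackboxRun P ν base β C₁ T)

/-- The means of the arms of the current block in round `t`, rounded to multiples of `α`. -/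
noncomputable def roundedMean (α : ℕ → ℝ) (t : ℕ) (ω : Ω) (k : ℕ) : ℝ :=
  α (run.state t ω).index *
    ⌊run.mean t ((run.state t ω).offset + k) ω / α (run.state t ω).index⌋

/-- In the block that starts in round `t`, the guarantee of the base algorithm fails after `r + 1`
rounds although the means have not moved much. -/
def baseFailure (C₀ : ℝ) (α : ℕ → ℝ) (t r : ℕ) : Set Ω :=
  {ω | (run.state t ω).first = t ∧ r + 1 ≤ 2 ^ (run.state t ω).index ∧
    2 ^ (run.state t ω).index ≤ 2 * T ∧
    (∀ s ≤ r, run.state (t + s) ω = run.state t ω) ∧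
    (∀ s ≤ r, ∀ k < numArms β (run.state t ω).index,
      |run.mean (t + s) ((run.state t ω).offset + k) ω
        - run.mean t ((run.state t ω).offset + k) ω| ≤ α (run.state t ω).index) ∧
    ∃ k < numArms β (run.state t ω).index,
      baseBound C₀ T (numArms β (run.state t ω).index) (r + 1) (run.roundedMean α t ω)
        (2 * α (run.state t ω).index) < ∑ s ∈ Finset.range (r + 1),
        (run.mean (t + s) ((run.state t ω).offset + k) ω
          - run.mean (t + s) (run.arm (t + s) ω) ω)}

lemma mul_floor_div_mem {x ε : ℝ} (hε : 0 < ε) (hx : x ∈ Icc (0 : ℝ) 1) :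
    ε * (⌊x / ε⌋ : ℝ) ∈ Icc (0 : ℝ) 1 ∧ |x - ε * (⌊x / ε⌋ : ℝ)| ≤ ε := by
  have h1 : (⌊x / ε⌋ : ℝ) ≤ x / ε := Int.floor_le _
  have h2 : x / ε < ⌊x / ε⌋ + 1 := Int.lt_floor_add_one _
  have h3 : (0 : ℝ) ≤ ⌊x / ε⌋ := by
    exact_mod_cast Int.floor_nonneg.2 (div_nonneg hx.1 hε.le)
  rw [le_div_iff₀ hε] at h1
  rw [div_lt_iff₀ hε] at h2
  refine ⟨⟨by positivity, by linarith [hx.2]⟩, ?_⟩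
  rw [abs_le]
  constructor <;> linarith

variable [IsProbabilityMeasure P]

/-- The reference profile must be deterministic, while the means at the start of a block are random.
Rounding leaves countably many cells; in each one the block and the rounded profile are fixed, and
the conditional bounds add up without loss over disjoint cells. -/
lemma measure_baseFailure_le {C₀ : ℝ} (hbase : base.ToleratesMildCorruption.{u} C₀ T)
    {α : ℕ → ℝ} (hα : ∀ m, 0 < α m) {t r : ℕ} (hr : t + (r + 1) ≤ T) :
    P (run.baseFailure C₀ α t r) ≤ ENNReal.ofReal (1 / (T : ℝ) ^ 3) := by
  have ht : t < T := by omega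
  let cell : (Σ b : BlockState, (Fin (numArms β b.index) → ℤ)) → Set Ω := fun i =>
    {ω | i.1.first = t ∧ run.state t ω = i.1 ∧
      ∀ k : Fin (numArms β i.1.index), ⌊run.mean t (i.1.offset + k) ω / α i.1.index⌋ = i.2 k}
  have hcell : ∀ i, MeasurableSet[run.info t] (cell i) := by
    rintro ⟨b, c⟩
    by_cases hb : b.first = t
    · have : cell ⟨b, c⟩ = {ω | run.state t ω = b} ∩ ⋂ k : Fin (numArms β b.index),
          (fun ω => ⌊({ω | b.offset + k < (run.state t ω).offset
        + numArms β (run.state t ω).index}.indicator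
          (run.mean t (b.offset + k)) ω) / α b.index⌋) ⁻¹' {c k} := by
        ext ω
        simp only [cell, mem_ofPred_eq, hb, true_and, mem_inter_iff, mem_iInter, mem_preimage,
          mem_singleton_iff]
        refine and_congr_right fun h => forall_congr' fun k => ?_
        rw [indicator_of_mem]
        simp only [mem_ofPred_eq, h]
        have := k.2
        omega
      rw [this]
      refine MeasurableSet.inter (run.past_le_info _ _ (run.measurableSet_state ht.le b))
        (MeasurableSet.iInter fun k => ?_)
      have h1 := run.mean_meas t ht (b.offset + k)
      have h2 : Measurable fun x : ℝ => ⌊x / α b.index⌋ :=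
        Int.measurable_floor.comp (measurable_id.div_const _)
      exact (h2.comp h1) (measurableSet_singleton _)
    · have : cell ⟨b, c⟩ = ∅ := by
        ext ω; simp [cell, hb]
      rw [this]; exact @MeasurableSet.empty _ (run.info t)
  refine (measure_le_mul_measure_iUnion (fun i => run.info_le t _ (hcell i)) ?_ (fun i => ?_) ?_
    (A := cell)).trans (mul_le_of_le_one_right' prob_le_one)
  · rintro ⟨b, c⟩ ⟨b', c'⟩ hne
    refine disjoint_left.2 fun ω h h' => hne ?_
    obtain rfl : b = b' := h.2.1.symm.trans h'.2.1
    have : c = c' := funext fun k => (h.2.2 k).symm.trans (h'.2.2 k)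
    rw [this]
  · obtain ⟨b, c⟩ := i
    -- A point of the cell certifies that the profile lies in `[0, 1]` and that the length
    -- restrictions hold; they are facts about `b` and `c` alone.
    rcases (cell ⟨b, c⟩ ∩ run.baseFailure C₀ α t r).eq_empty_or_nonempty with he | ⟨ω₀, hω₀, hf₀⟩
    · rw [he]; simp
    obtain rfl : b.first = t := hω₀.1
    set ref : ℕ → ℝ := fun k => if h : k < numArms β b.index then α b.index * c ⟨k, h⟩ else 0
      with href
    have hstate₀ : run.state b.first ω₀ = b := hω₀.2.1
    have hmem : ∀ k < numArms β b.index, ref k ∈ Icc (0 : ℝ) 1 := by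
      intro k hk
      simp only [href, hk, dif_pos]
      have e : ⌊run.mean b.first (b.offset + k) ω₀ / α b.index⌋ = c ⟨k, hk⟩ := hω₀.2.2 ⟨k, hk⟩
      rw [← e]
      exact (mul_floor_div_mem (hα _) (run.mean_mem _ ht _ _)).1
    have hrn := hf₀.2.1
    have hn := hf₀.2.2.1
    rw [hstate₀] at hrn hn
    -- The corruption level is `2 α`: one `α` for the drift within the block, one for the rounding.
    refine (measure_mono ?_).trans (run.measure_inter_base_regret_le hbase (hcell ⟨b, c⟩) hmem
      (α := 2 * α b.index) (by have := hα b.index; positivity) hr hrn hn)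
    rintro ω ⟨hω, hf⟩
    refine ⟨hω, ?_⟩
    obtain ⟨-, -, -, h4, h5, k, hk, h6⟩ := hf
    have hst : run.state b.first ω = b := hω.2.1
    rw [hst] at h4 h5 h6 hk
    have hrefω : ∀ k < numArms β b.index, run.roundedMean α b.first ω k = ref k := by
      intro k hk
      simp only [href, hk, dif_pos]
      have e : ⌊run.mean b.first (b.offset + k) ω / α b.index⌋ = c ⟨k, hk⟩ := hω.2.2 ⟨k, hk⟩
      rw [← e, roundedMean, hst]
    refine ⟨fun s hs => ⟨h4 s hs, fun k hk => ?_⟩, k, hk, ?_⟩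
    · have e1 := (mul_floor_div_mem (hα b.index) (run.mean_mem _ ht (b.offset + k) ω)).2
      have e2 := h5 s hs k hk
      have e3 := hrefω k hk
      rw [roundedMean, hst] at e3
      rw [e3] at e1
      calc _ ≤ _ := abs_sub_le _ (run.mean b.first (b.offset + k) ω) _
        _ ≤ α b.index + α b.index := add_le_add e2 e1
        _ = _ := by ring
    · rw [← baseBound_congr hrefω]
      exact h6
  · intro ω hω
    exact mem_iUnion.2 ⟨⟨run.state t ω, fun k =>
      ⌊run.mean t ((run.state t ω).offset + k) ω / α (run.state t ω).index⌋⟩, hω.1, rfl,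
      fun k => rfl⟩

end BlackboxRun

/-! ### Samples from the reservoir -/

/-- Dyadic layers: the level `2 ^ j` is the increment from `2 ^ j` to `2 ^ (j + 1)`. It turns the
mean of an inverse gap into a sum of reservoir tails. -/
lemma min_two_pow_le (u : ℝ) (J : ℕ) :
    min u (2 ^ J) ≤ 1 + ∑ j ∈ Finset.range J, if (2 : ℝ) ^ j < u then (2 : ℝ) ^ j else 0 := by
  induction J with
  | zero => simp
  | succ J ih =>
    rw [Finset.sum_range_succ]
    have h0 : (0 : ℝ) < 2 ^ J := by positivity
    split_ifs with h
    · rw [min_eq_right h.le] at ih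
      have := min_le_right u (2 ^ (J + 1))
      rw [pow_succ] at this ⊢
      linarith
    · rw [min_eq_left (not_lt.1 h)] at ih
      have := min_le_left u (2 ^ (J + 1))
      linarith

/-- The arms of a block whose inverse gaps are truncated at the resolution of the block. -/
noncomputable def inverseGap (β : ℝ) (m : ℕ) (x : ℝ) : ℝ := (max (blockResolution β m) (1 - x))⁻¹

lemma inverseGap_pos (β : ℝ) (m : ℕ) (x : ℝ) : 0 < inverseGap β m x := by
  unfold inverseGap
  have := blockResolution_pos β m
  positivity

lemma inverseGap_le (β : ℝ) (m : ℕ) (x : ℝ) : inverseGap β m x ≤ (blockResolution β m)⁻¹ :=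
  inv_anti₀ (blockResolution_pos β m) (le_max_left _ _)

lemma measurable_inverseGap (β : ℝ) (m : ℕ) : Measurable (inverseGap β m) := by
  unfold inverseGap
  fun_prop

lemma integrable_inverseGap (ν : Measure ℝ) [IsProbabilityMeasure ν] (β : ℝ) (m : ℕ) :
    Integrable (inverseGap β m) ν := by
  refine Integrable.of_bound (measurable_inverseGap β m).aestronglyMeasurable
    (blockResolution β m)⁻¹ (ae_of_all _ fun x => ?_)
  rw [Real.norm_eq_abs, abs_of_pos (inverseGap_pos β m x)]
  exact inverseGap_le β m x

/-- The left side is the contribution of one dyadic level, of order `|𝒜_m| 2 ^ (j (1 - β))`. For `β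
≥ 1` the power is at most one; for `β < 1` it is largest at the resolution, where the product is of
order `δ⁻¹ ≤ h`. -/
lemma numArms_mul_rpow_le {β : ℝ} (hβ : 0 < β) (m j : ℕ)
    (hj : (2 : ℝ) ^ j < (blockResolution β m)⁻¹) :
    numArms β m * ((2 : ℝ) ^ j * ((2 : ℝ) ^ j)⁻¹ ^ β) ≤ 2 * blockScale β m := by
  have h1 : (2 : ℝ) ^ j * ((2 : ℝ) ^ j)⁻¹ ^ β = ((2 : ℝ) ^ j) ^ (1 - β) := by
    rw [Real.inv_rpow (by positivity), ← Real.rpow_neg (by positivity), sub_eq_add_neg,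
      Real.rpow_add (by positivity), Real.rpow_one]
  rw [h1]
  by_cases hb : 1 ≤ β
  · have h2 : ((2 : ℝ) ^ j) ^ (1 - β) ≤ 1 :=
      Real.rpow_le_one_of_one_le_of_nonpos (one_le_pow₀ (by norm_num)) (by linarith)
    have h3 : (0 : ℝ) ≤ numArms β m := by positivity
    have h4 := numArms_le_blockScale hβ m
    nlinarith
  · push Not at hb
    have h2 : ((2 : ℝ) ^ j) ^ (1 - β) ≤ ((blockResolution β m)⁻¹) ^ (1 - β) := by
      gcongr
    have h3 := numArms_le hβ m
    rw [subsamplingExponent_eq] at h3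
    have h4 : (blockResolution β m)⁻¹ = (2 : ℝ) ^ ((m : ℝ) * decayExponent β) := by
      unfold blockResolution
      rw [← Real.rpow_neg (by norm_num), neg_neg]
    calc numArms β m * ((2 : ℝ) ^ j) ^ (1 - β)
        ≤ (2 * (2 : ℝ) ^ ((m : ℝ) * (decayExponent β * β)))
          * ((2 : ℝ) ^ ((m : ℝ) * decayExponent β)) ^ (1 - β) := by rw [h4] at h2; gcongr
      _ = 2 * (blockResolution β m)⁻¹ := by
          rw [h4, ← Real.rpow_mul (by norm_num), mul_assoc, ← Real.rpow_add (by norm_num)]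
          congr 2; ring
      _ ≤ _ := by gcongr; exact inv_blockResolution_le β m

/-- Only levels `2 ^ j < δ⁻¹` occur, at most `m` of them, each contributing at most `2 κ₂ h`. -/
lemma numArms_mul_integral_inverseGap_le {ν : Measure ℝ} {β κ₁ κ₂ : ℝ} (hβ : 0 < β)
    (hκ₂ : 0 ≤ κ₂) (hν : IsRegularReservoir ν β κ₁ κ₂) (m : ℕ) :
    numArms β m * ∫ x, inverseGap β m x ∂ν ≤ 2 * blockScale β m * (1 + κ₂ * m) := by
  have := hν.isProb
  have hres := blockResolution_pos β m
  set I : Finset ℕ := (Finset.range m).filter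
    fun j => (2 : ℝ) ^ j < (blockResolution β m)⁻¹ with hI
  have hpt : ∀ x, inverseGap β m x ≤
      1 + ∑ j ∈ I, (2 : ℝ) ^ j * (Ioi (1 - ((2 : ℝ) ^ j)⁻¹)).indicator 1 x := by
    intro x
    have h1 := min_two_pow_le (inverseGap β m x) m
    have h2 : inverseGap β m x ≤ 2 ^ m := by
      refine (inverseGap_le β m x).trans ?_
      rw [inv_le_comm₀ hres (by positivity), ← Real.rpow_natCast, ← Real.rpow_neg (by norm_num)]
      unfold blockResolution
      apply Real.rpow_le_rpow_of_exponent_le (by norm_num)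
      have := decayExponent_le_half β
      have : (m : ℝ) * decayExponent β ≤ m * 1 := by gcongr; linarith
      linarith
    rw [min_eq_left h2] at h1
    refine h1.trans ?_
    rw [hI, Finset.sum_filter]
    gcongr with j hj
    by_cases h3 : (2 : ℝ) ^ j < inverseGap β m x
    · rw [if_pos h3, if_pos (h3.trans_le (inverseGap_le β m x)), indicator_of_mem]
      · simp
      · have h4 : max (blockResolution β m) (1 - x) < ((2 : ℝ) ^ j)⁻¹ := by
          rw [lt_inv_comm₀ (by positivity) (by positivity)]
          exact h3
        have := (le_max_right _ _).trans_lt h4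
        simp only [mem_Ioi]
        linarith
    · rw [if_neg h3]
      split_ifs
      · apply mul_nonneg (by positivity)
        exact indicator_nonneg (fun _ _ => zero_le_one) _
      · exact le_rfl
  have hint : ∀ j : ℕ, Integrable
      (fun x => (2 : ℝ) ^ j * (Ioi (1 - ((2 : ℝ) ^ j)⁻¹)).indicator (1 : ℝ → ℝ) x) ν :=
    fun j => ((integrable_const (1 : ℝ)).indicator measurableSet_Ioi).const_mul _
  have h1 : ∫ x, inverseGap β m x ∂ν ≤
      1 + ∑ j ∈ I, (2 : ℝ) ^ j * (κ₂ * ((2 : ℝ) ^ j)⁻¹ ^ β) := by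
    calc _ ≤ ∫ x, (1 + ∑ j ∈ I, (2 : ℝ) ^ j * (Ioi (1 - ((2 : ℝ) ^ j)⁻¹)).indicator 1 x) ∂ν :=
          integral_mono (integrable_inverseGap ν β m)
            ((integrable_const _).add (integrable_finsetSum _ fun j _ => hint j)) hpt
      _ = 1 + ∑ j ∈ I, (2 : ℝ) ^ j * ν.real (Ioi (1 - ((2 : ℝ) ^ j)⁻¹)) := by
          rw [integral_add (integrable_const _) (integrable_finsetSum _ fun j _ => hint j),
            integral_finsetSum _ fun j _ => hint j]
          congr 1
          · simp
          · refine Finset.sum_congr rfl fun j _ => ?_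
            rw [integral_const_mul, integral_indicator_one measurableSet_Ioi]
      _ ≤ _ := by
          gcongr with j hj
          exact hν.upper _ ⟨by positivity, inv_le_one_of_one_le₀ (one_le_pow₀ (by norm_num))⟩
  have hK : (0 : ℝ) ≤ numArms β m := by positivity
  have hB := blockScale_pos β m
  calc _ ≤ numArms β m * (1 + ∑ j ∈ I, (2 : ℝ) ^ j * (κ₂ * ((2 : ℝ) ^ j)⁻¹ ^ β)) := by gcongr
    _ = numArms β m + ∑ j ∈ I, κ₂ * (numArms β m * ((2 : ℝ) ^ j * ((2 : ℝ) ^ j)⁻¹ ^ β)) := by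
        rw [mul_add, mul_one, Finset.mul_sum]
        congr 1
        refine Finset.sum_congr rfl fun j _ => by ring
    _ ≤ 2 * blockScale β m + ∑ j ∈ I, κ₂ * (2 * blockScale β m) := by
        refine add_le_add (numArms_le_blockScale hβ m) (Finset.sum_le_sum fun j hj => ?_)
        refine mul_le_mul_of_nonneg_left ?_ hκ₂
        exact numArms_mul_rpow_le hβ m j (Finset.mem_filter.1 hj).2
    _ ≤ 2 * blockScale β m + m * (κ₂ * (2 * blockScale β m)) := by
        rw [Finset.sum_const, nsmul_eq_mul]
        gcongr
        calc I.card ≤ (Finset.range m).card := Finset.card_filter_le _ _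
          _ = m := Finset.card_range m
    _ = _ := by ring

lemma measure_pi_forall_le {ν : Measure ℝ} {β κ₁ κ₂ : ℝ} (hν : IsRegularReservoir ν β κ₁ κ₂)
    {K : ℕ} (hK : 0 < K) {α : ℝ} (hα : 0 ≤ α) :
    (Measure.pi fun _ : Fin K => ν).real {x | ∀ i, x i ≤ 1 - α}
      ≤ Real.exp (-(K * (κ₁ * α ^ β))) := by
  have := hν.isProb
  have h1 : {x : Fin K → ℝ | ∀ i, x i ≤ 1 - α} = Set.univ.pi fun _ => Iic (1 - α) := by
    ext x; simp [Pi.le_def]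
  have h2 : (Measure.pi fun _ : Fin K => ν).real {x | ∀ i, x i ≤ 1 - α}
      = ν.real (Iic (1 - α)) ^ K := by
    rw [h1, measureReal_def, Measure.pi_pi]
    simp [measureReal_def]
  rw [h2]
  by_cases h : α ≤ 1
  · have h3 : ν.real (Iic (1 - α)) ≤ Real.exp (-(κ₁ * α ^ β)) := by
      have e1 := hν.lower α ⟨hα, h⟩
      have e2 : ν.real (Iic (1 - α)) = 1 - ν.real (Ioi (1 - α)) := by
        rw [← probReal_compl_eq_one_sub measurableSet_Ioi, compl_Ioi]
      have e3 := Real.add_one_le_exp (-(κ₁ * α ^ β))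
      linarith
    calc _ ≤ Real.exp (-(κ₁ * α ^ β)) ^ K := by gcongr
      _ = _ := by rw [← Real.exp_nat_mul]; congr 1; ring
  -- The tolerance carries a factor `log³ T` and may exceed one; regularity is then unavailable, but
  -- no mean is negative.
  · have h3 : ν.real (Iic (1 - α)) = 0 := by
      have e1 : ν (Icc 0 1)ᶜ = 0 := by
        rw [prob_compl_eq_zero_iff measurableSet_Icc]; exact hν.support
      rw [measureReal_def, measure_mono_null _ e1, ENNReal.toReal_zero]
      intro x hx hx'
      rw [mem_Iic] at hx
      linarith [hx'.1]
    rw [h3, zero_pow hK.ne']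
    positivity

/-- Chernoff bound for the rescaled variables `δ * inverseGap`, which lie in `[0, 1]`; the
truncation at `δ` is what makes them bounded. -/
lemma measure_pi_sum_inverseGap_le {ν : Measure ℝ} [IsProbabilityMeasure ν] {β : ℝ} {m K : ℕ}
    {z : ℝ} :
    (Measure.pi fun _ : Fin K => ν).real {x | 2 * (K * ∫ x, inverseGap β m x ∂ν)
      + z * (blockResolution β m)⁻¹ ≤ ∑ i, inverseGap β m (x i)} ≤ Real.exp (-z) := by
  have hres := blockResolution_pos β m
  set δ := blockResolution β m with hδ
  have hmem : ∀ x, δ * inverseGap β m x ∈ Icc (0 : ℝ) 1 := fun x =>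
    ⟨by have := inverseGap_pos β m x; positivity, by
      have := inverseGap_le β m x
      calc _ ≤ δ * δ⁻¹ := by gcongr
        _ = 1 := mul_inv_cancel₀ hres.ne'⟩
  set I := ∫ x, inverseGap β m x ∂ν with hI
  have hint := integrable_inverseGap ν β m
  have hE : ∫ x, Real.exp (δ * inverseGap β m x) ∂ν ≤ Real.exp (2 * (δ * I)) := by
    calc _ ≤ ∫ x, (1 + 2 * (δ * inverseGap β m x)) ∂ν := by
          apply integral_mono_of_nonneg (ae_of_all _ fun x => (Real.exp_pos _).le)
            ((integrable_const _).add ((hint.const_mul _).const_mul _))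
          refine ae_of_all _ fun x => ?_
          have := exp_le_one_add_two_mul (hmem x)
          rwa [one_mul] at this
      _ = 1 + 2 * (δ * I) := by
          rw [integral_add (integrable_const _) ((hint.const_mul _).const_mul _),
            integral_const_mul, integral_const_mul]
          simp [hI]
      _ ≤ _ := by have := Real.add_one_le_exp (2 * (δ * I)); linarith
  have hm : Measurable fun x : Fin K → ℝ => ∏ i, Real.exp (δ * inverseGap β m (x i)) := by
    refine Finset.measurable_fun_prod _ fun i _ => ?_
    exact Real.measurable_exp.comp (((measurable_inverseGap β m).comp
      (measurable_pi_apply i)).const_mul δ)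
  have hprod : Integrable (fun x : Fin K → ℝ => ∏ i, Real.exp (δ * inverseGap β m (x i)))
      (Measure.pi fun _ : Fin K => ν) := by
    refine Integrable.of_bound hm.aestronglyMeasurable (Real.exp 1 ^ K) (ae_of_all _ fun x => ?_)
    rw [Real.norm_eq_abs, Finset.abs_prod]
    calc _ ≤ ∏ i : Fin K, Real.exp 1 := by
          gcongr with i
          rw [Real.abs_exp]
          exact Real.exp_le_exp.2 (hmem _).2
      _ = _ := by simp
  have hmark := mul_meas_ge_le_integral_of_nonneg
    (ae_of_all _ fun x => Finset.prod_nonneg fun i _ => (Real.exp_pos _).le) hprod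
    (Real.exp (2 * (K * (δ * I)) + z))
  have hI' : ∫ x : Fin K → ℝ, ∏ i, Real.exp (δ * inverseGap β m (x i))
      ∂(Measure.pi fun _ : Fin K => ν) ≤ Real.exp (2 * (K * (δ * I))) := by
    rw [integral_fintype_prod_eq_prod (μ := fun _ : Fin K => ν)
      (fun (_ : Fin K) (x : ℝ) => Real.exp (δ * inverseGap β m x))]
    rw [Finset.prod_const, Finset.card_univ, Fintype.card_fin]
    calc _ ≤ Real.exp (2 * (δ * I)) ^ K := by
          gcongr
      _ = _ := by rw [← Real.exp_nat_mul]; congr 1; ring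
  have hset : {x : Fin K → ℝ | 2 * (K * I) + z * δ⁻¹ ≤ ∑ i, inverseGap β m (x i)} ⊆
      {x | Real.exp (2 * (K * (δ * I)) + z) ≤ ∏ i, Real.exp (δ * inverseGap β m (x i))} := by
    intro x hx
    simp only [mem_ofPred_eq] at hx ⊢
    rw [← Real.exp_sum, Real.exp_le_exp, ← Finset.mul_sum]
    calc _ = δ * (2 * (K * I) + z * δ⁻¹) := by field_simp
      _ ≤ _ := by gcongr
  refine (measureReal_mono hset).trans ?_
  have := hmark.trans hI'
  nth_rewrite 1 [Real.exp_add] at this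
  rw [mul_assoc] at this
  have h3 := le_of_mul_le_mul_left (this.trans_eq (mul_one _).symm) (Real.exp_pos _)
  rwa [Real.exp_neg, ← one_div, le_div_iff₀ (Real.exp_pos _), mul_comm]

/-- Samples without an arm that is `α`-close to optimal or with too large inverse gaps. -/
def badVectors (β : ℝ) (m : ℕ) (α U : ℝ) : Set (Fin (numArms β m) → ℝ) :=
  {x | (∀ i, x i ≤ 1 - α) ∨ U ≤ ∑ i, inverseGap β m (x i)}

lemma measurableSet_badVectors (β : ℝ) (m : ℕ) (α U : ℝ) :
    MeasurableSet (badVectors β m α U) := by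
  have h : MeasurableSet {x : Fin (numArms β m) → ℝ | U ≤ ∑ i, inverseGap β m (x i)} :=
    measurableSet_le measurable_const (Finset.measurable_fun_sum _ fun i _ =>
      (measurable_inverseGap β m).comp (measurable_pi_apply i))
  have h' : MeasurableSet {x : Fin (numArms β m) → ℝ | ∀ i, x i ≤ 1 - α} := by
    simp only [ofPred_forall]
    exact MeasurableSet.iInter fun i => measurableSet_le (measurable_pi_apply i) measurable_const
  exact h'.union h

lemma condExp_indicator_le {Ω : Type*} {m mΩ : MeasurableSpace Ω} {P : Measure Ω}
    [IsProbabilityMeasure P] (hm : m ≤ mΩ) {Z S : Set Ω} (hZ : MeasurableSet Z)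
    (hS : MeasurableSet[m] S) {q : ℝ}
    (h : ∀ A, MeasurableSet[m] A → P.real (A ∩ Z) ≤ q * P.real (A ∩ S)) :
    ∀ᵐ ω ∂P, (P[Z.indicator 1 | m]) ω ≤ q * S.indicator (1 : Ω → ℝ) ω := by
  have hZi : Integrable (Z.indicator (1 : Ω → ℝ)) P := (integrable_const (1 : ℝ)).indicator hZ
  have hSi : Integrable (fun ω => q * S.indicator (1 : Ω → ℝ) ω) P :=
    ((integrable_const (1 : ℝ)).indicator (hm _ hS)).const_mul q
  have hSm : StronglyMeasurable[m] (fun ω => q * S.indicator (1 : Ω → ℝ) ω) :=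
    (stronglyMeasurable_one.indicator hS).const_mul q
  have hCm : StronglyMeasurable[m] (P[Z.indicator (1 : Ω → ℝ) | m]) := stronglyMeasurable_condExp
  refine ae_of_ae_trim hm (ae_le_of_forall_setIntegral_le
    (integrable_condExp.trim hm hCm) (hSi.trim hm hSm) fun A hA _ => ?_)
  rw [← setIntegral_trim hm hCm hA, ← setIntegral_trim hm hSm hA, setIntegral_condExp hm hZi hA,
    integral_const_mul, setIntegral_indicator hZ, setIntegral_indicator (hm _ hS)]
  simpa using h A hA

/-! ### The samples drawn at the starts of blocks. -/

namespace BlackboxRun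

variable {Ω : Type u} [mΩ : MeasurableSpace Ω] {P : Measure Ω} {ν : Measure ℝ}
  {base : BaseAlgorithm} {β C₁ : ℝ} {T : ℕ} (run : BlackboxRun P ν base β C₁ T)

/-- Arms that were never played are untouched by the adversary. The induction also carries the arms
beyond the current block, which become the fresh arms of the next one. -/
lemma mean_eq_initial {t : ℕ} (ht : t < T) {ω : Ω} (h : (run.state t ω).first = t) {i : ℕ}
    (hi : (run.state t ω).offset ≤ i) : run.mean t i ω = run.mean 0 i ω := by
  have key := blockAt_induction β C₁ T (fun s => run.reward s ω) (motive := fun t b =>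
    (∀ i, b.offset + numArms β b.index ≤ i → run.mean t i ω = run.mean 0 i ω) ∧
    (b.first = t → ∀ i, b.offset ≤ i → run.mean t i ω = run.mean 0 i ω)) ?_ t ?_ ?_ ?_ t le_rfl
  · exact key.2 h i hi
  · exact ⟨fun _ _ => rfl, fun _ _ _ => rfl⟩
  all_goals
    intro s hs
    have hnext : ∀ i, (run.state s ω).offset + numArms β (run.state s ω).index ≤ i →
        run.mean s i ω = run.mean 0 i ω → run.mean (s + 1) i ω = run.mean 0 i ω := by
      intro i hi hi'
      rw [run.mean_succ_eq s (by omega) i ω, hi']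
      have := run.pick_lt (show s < T by omega) ω
      intro h
      rw [h] at hi
      exact absurd (Nat.add_lt_add_left this _) (not_lt.2 hi)
  · intro _ ih
    exact ⟨fun i hi => hnext i ((Nat.le_add_right _ _).trans hi) (ih.1 i ((Nat.le_add_right _ _).trans hi)),
      fun _ i hi => hnext i hi (ih.1 i hi)⟩
  · intro _ _ ih
    exact ⟨fun i hi => hnext i ((Nat.le_add_right _ _).trans hi) (ih.1 i ((Nat.le_add_right _ _).trans hi)),
      fun _ i hi => hnext i hi (ih.1 i hi)⟩
  · intro _ _ ih
    refine ⟨fun i hi => hnext i hi (ih.1 i hi), fun hf => ?_⟩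
    have := first_le β C₁ T (fun s => run.reward s ω) s
    omega

/-- The initial means of the arms of the block `b`, as a measurable function. -/
noncomputable def sampleMeans (b : BlockState) (ω : Ω) : Fin (numArms β b.index) → ℝ := fun i =>
  {ω | b.offset + i < (run.state b.first ω).offset
    + numArms β (run.state b.first ω).index}.indicator (run.mean b.first (b.offset + i)) ω

lemma measurable_sampleMeans {b : BlockState} (hb : b.first < T) :
    Measurable[run.info b.first] (run.sampleMeans b) :=
  @measurable_pi_lambda Ω (Fin (numArms β b.index)) (fun _ => ℝ) (run.info b.first) _ _
    fun i => run.mean_meas b.first hb (b.offset + i)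

lemma sampleMeans_eq {b : BlockState} (hb : b.first < T) {ω : Ω}
    (hω : run.state b.first ω = b) :
    run.sampleMeans b ω = fun i : Fin (numArms β b.index) => run.mean 0 (b.offset + i) ω := by
  funext i
  unfold sampleMeans
  rw [indicator_of_mem]
  · exact run.mean_eq_initial hb (by rw [hω]) (by rw [hω]; omega)
  · simp only [mem_ofPred_eq, hω]
    have := i.2
    omega

/-- The block that starts in round `t` has a bad sample. -/
def badStart (α U : ℕ → ℝ) (t : ℕ) : Set Ω :=
  {ω | (run.state t ω).first = t ∧
    (fun i : Fin (numArms β (run.state t ω).index) =>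
      run.mean 0 ((run.state t ω).offset + i) ω)
      ∈ badVectors β (run.state t ω).index (α (run.state t ω).index) (U (run.state t ω).index)}

lemma measurableSet_badStart {α U : ℕ → ℝ} {t : ℕ} (ht : t < T) :
    MeasurableSet[run.info t] (run.badStart α U t) := by
  have h : run.badStart α U t = ⋃ b : {b : BlockState // b.first = t},
      ({ω | run.state t ω = b} ∩
        run.sampleMeans b ⁻¹' badVectors β b.1.index (α b.1.index) (U b.1.index)) := by
    ext ω
    simp only [mem_iUnion, mem_inter_iff, mem_ofPred_eq, mem_preimage]
    constructor
    · rintro ⟨h1, h2⟩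
      refine ⟨⟨run.state t ω, h1⟩, rfl, ?_⟩
      rw [run.sampleMeans_eq (by rw [h1]; exact ht) (by rw [h1])]
      exact h2
    · rintro ⟨⟨b, rfl⟩, h2, h3⟩
      dsimp only at h2 h3
      rw [run.sampleMeans_eq ht h2] at h3
      refine ⟨by rw [h2], ?_⟩
      rw [h2]
      exact h3
  rw [h]
  refine MeasurableSet.iUnion fun b => ?_
  obtain ⟨b, rfl⟩ := b
  exact (run.past_le_info _ _ (run.measurableSet_state ht.le b)).inter
    (run.measurable_sampleMeans ht (measurableSet_badVectors _ _ _ _))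

variable [IsProbabilityMeasure P] [IsProbabilityMeasure ν]

/-- Given the past, the initial means of the arms of a new block are i.i.d. -/
lemma measure_inter_sampleMeans {b : BlockState} (hb : b.first < T) {A : Set Ω}
    (hA : MeasurableSet[run.past b.first] A) (hAb : ∀ ω ∈ A, run.state b.first ω = b)
    {S : Set (Fin (numArms β b.index) → ℝ)} (hS : MeasurableSet S) :
    P (A ∩ run.sampleMeans b ⁻¹' S) = P A * (Measure.pi fun _ => ν) S := by
  by_cases h0 : P A = 0
  · rw [measure_mono_null inter_subset_left h0, h0, zero_mul]
  have hAm : MeasurableSet A := run.past_le _ _ hA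
  have hm : Measurable (run.sampleMeans b) :=
    (run.measurable_sampleMeans hb).mono (run.info_le _) le_rfl
  have hlaw : (Measure.pi fun _ : Fin (numArms β b.index) => ν)
      = (P[|A]).map (run.sampleMeans b) := by
    refine Measure.pi_eq fun B hB => ?_
    rw [Measure.map_apply hm (MeasurableSet.univ_pi hB), cond_apply hAm]
    have h1 := run.sampling b.first hb b rfl A hA hAb
      (fun i => if h : i < numArms β b.index then B ⟨i, h⟩ else univ) (fun i => by
        split_ifs
        · exact hB _
        · exact MeasurableSet.univ)
    have h2 : A ∩ run.sampleMeans b ⁻¹' univ.pi B = A ∩ {ω | ∀ i < numArms β b.index,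
        run.mean 0 (b.offset + i) ω ∈
          if h : i < numArms β b.index then B ⟨i, h⟩ else univ} := by
      ext ω
      simp only [mem_inter_iff, mem_preimage, mem_univ_pi, mem_ofPred_eq]
      refine and_congr_right fun hω => ?_
      rw [run.sampleMeans_eq hb (hAb ω hω)]
      constructor
      · intro h i hi
        rw [dif_pos hi]
        exact h ⟨i, hi⟩
      · intro h i
        have := h i i.2
        rwa [dif_pos i.2] at this
    rw [h2, h1, ← mul_assoc, ENNReal.inv_mul_cancel h0 (measure_ne_top _ _), one_mul,
      Finset.prod_range]
    refine Finset.prod_congr rfl fun i _ => ?_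
    rw [dif_pos i.2]
  rw [hlaw, Measure.map_apply hm hS, cond_apply hAm, ← mul_assoc,
    ENNReal.mul_inv_cancel h0 (measure_ne_top _ _), one_mul]

/-- Once the past is split by the block that starts in round `t`, the sample is i.i.d. and `q`
bounds its failure. Keeping the event that a block starts makes the later count proportional to the
number of blocks, not of rounds. -/
lemma measureReal_inter_badStart_le {α U : ℕ → ℝ} {q : ℝ}
    (hq : ∀ m, (Measure.pi fun _ => ν).real (badVectors β m (α m) (U m)) ≤ q) {t : ℕ} (ht : t < T)
    {A : Set Ω} (hA : MeasurableSet[run.past t] A) :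
    P.real (A ∩ run.badStart α U t) ≤ q * P.real (A ∩ {ω | (run.state t ω).first = t}) := by
  have hq0 : 0 ≤ q := measureReal_nonneg.trans (hq 0)
  let B : {b : BlockState // b.first = t} → Set Ω := fun b => A ∩ {ω | run.state t ω = b}
  have hB : ∀ b, MeasurableSet[run.past t] (B b) := fun b =>
    hA.inter (run.measurableSet_state ht.le b)
  have hU : ⋃ b, B b = A ∩ {ω | (run.state t ω).first = t} := by
    ext ω
    simp only [B, mem_iUnion, mem_inter_iff, mem_ofPred_eq]
    constructor
    · rintro ⟨b, h1, h2⟩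
      exact ⟨h1, by rw [h2]; exact b.2⟩
    · rintro ⟨h1, h2⟩
      exact ⟨⟨run.state t ω, h2⟩, h1, rfl⟩
  have key : P (A ∩ run.badStart α U t) ≤ ENNReal.ofReal q * P (⋃ b, B b) := by
    refine measure_le_mul_measure_iUnion (fun b => run.past_le t _ (hB b)) ?_ (fun b => ?_) ?_
    · intro b b' hne
      refine disjoint_left.2 fun ω h h' => hne (Subtype.ext ?_)
      exact h.2.symm.trans h'.2
    · obtain ⟨b, rfl⟩ := b
      have h1 := run.measure_inter_sampleMeans (P := P) ht (hB ⟨b, rfl⟩) (fun ω hω => hω.2)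
        (measurableSet_badVectors β b.index (α b.index) (U b.index))
      rw [mul_comm]
      refine (measure_mono ?_).trans (h1.le.trans ?_)
      · rintro ω ⟨hω, -, -, hω'⟩
        refine ⟨hω, ?_⟩
        have hst : run.state b.first ω = b := hω.2
        rw [mem_preimage, run.sampleMeans_eq ht hst]
        rwa [hst] at hω'
      · gcongr
        rw [← ofReal_measureReal]
        exact ENNReal.ofReal_le_ofReal (hq b.index)
    · rw [hU]
      rintro ω ⟨h1, h2, -⟩
      exact ⟨h1, h2⟩
  rw [hU] at key
  have := ENNReal.toReal_mono (by finiteness) key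
  rwa [ENNReal.toReal_mul, ENNReal.toReal_ofReal hq0] at this

lemma measureReal_exists_badStart_le {α U : ℕ → ℝ} {q : ℝ}
    (hq : ∀ m, (Measure.pi fun _ => ν).real (badVectors β m (α m) (U m)) ≤ q) :
    P.real {ω | ∃ t < T, ω ∈ run.badStart α U t} ≤ T * q := by
  have hq0 : 0 ≤ q := measureReal_nonneg.trans (hq 0)
  have h1 : {ω | ∃ t < T, ω ∈ run.badStart α U t} = ⋃ t ∈ Finset.range T, run.badStart α U t := by
    ext ω; simp
  rw [h1]
  calc _ ≤ ∑ t ∈ Finset.range T, P.real (run.badStart α U t) := measureReal_biUnion_finset_le _ _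
    _ ≤ ∑ t ∈ Finset.range T, q := by
        refine Finset.sum_le_sum fun t ht => ?_
        have := run.measureReal_inter_badStart_le hq (Finset.mem_range.1 ht)
          (A := univ) MeasurableSet.univ
        rw [univ_inter, univ_inter] at this
        exact this.trans (mul_le_of_le_one_right hq0 measureReal_le_one)
    _ = _ := by simp

-- The exponential supermartingale is run along `past`: a bad start in round `t` is known at `past
-- (t + 1)`, and given `past t` its probability is at most `q` if a block starts and zero otherwise.
open Classical in
lemma measureReal_card_badStart_le {α U : ℕ → ℝ} {q : ℝ}
    (hq : ∀ m, (Measure.pi fun _ => ν).real (badVectors β m (α m) (U m)) ≤ q) (x : ℝ) :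
    P.real {ω | 2 * q * (((Finset.range T).filter
        (Starts β C₁ T (fun s => run.reward s ω))).card : ℝ) + x
      ≤ (((Finset.range T).filter fun t => Starts β C₁ T (fun s => run.reward s ω) t
        ∧ ω ∈ run.badStart α U t).card : ℝ)} ≤ Real.exp (-x) := by
  have hq0 : 0 ≤ q := measureReal_nonneg.trans (hq 0)
  have hStm : ∀ t < T, MeasurableSet[run.past t] {ω | (run.state t ω).first = t} := fun t ht =>
    ((measurable_of_countable fun b : BlockState => b.first).comp (run.measurable_state ht.le))
      (measurableSet_singleton t)
  have hBm : ∀ t < T, MeasurableSet[run.past (t + 1)] (run.badStart α U t) := fun t ht =>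
    run.info_le_past_succ t _ (run.measurableSet_badStart ht)
  have hind : ∀ (S : Set Ω) ω, S.indicator (1 : Ω → ℝ) ω ∈ Icc (0 : ℝ) 1 := fun S ω => by
    by_cases h : ω ∈ S <;> simp [h]
  have := measureReal_exp_sum_le (P := P) (G := run.past) (N := T) (θ := 1) (κ := 2)
    (B := 2 * q)
    (X := fun t => (run.badStart α U t).indicator 1)
    (d := fun t ω => 2 * q * {ω | (run.state t ω).first = t}.indicator (1 : Ω → ℝ) ω)
    run.past_le run.past_mono (fun t _ ω => hind _ ω)
    (fun t ht => Measurable.indicator (measurable_const (a := (1 : ℝ))) (hBm t ht))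
    (fun t ht ω => by
      have := hind {ω | (run.state t ω).first = t} ω
      rw [abs_le]
      constructor <;> nlinarith [this.1, this.2])
    (fun t ht => (Measurable.indicator (measurable_const (a := (1 : ℝ))) (hStm t ht)).const_mul _)
    (fun x hx => exp_le_one_add_two_mul hx)
    (fun t ht => by
      filter_upwards [condExp_indicator_le (P := P) (run.past_le t) (run.past_le _ _ (hBm t ht))
        (hStm t ht) fun A hA => run.measureReal_inter_badStart_le hq ht hA] with ω h
      linarith) (Nat.zero_le T) le_rfl x
  refine (measureReal_mono ?_).trans this
  intro ω hω
  simp only [mem_ofPred_eq] at hω ⊢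
  rw [Nat.Ico_zero_eq_range, Finset.sum_sub_distrib, ← Finset.mul_sum, ← Finset.mul_sum, one_mul]
  have e1 : ∑ t ∈ Finset.range T, (run.badStart α U t).indicator (1 : Ω → ℝ) ω
      = (((Finset.range T).filter fun t => Starts β C₁ T (fun s => run.reward s ω) t
        ∧ ω ∈ run.badStart α U t).card : ℝ) := by
    rw [Finset.card_filter]
    push_cast
    refine Finset.sum_congr rfl fun t _ => ?_
    by_cases h : ω ∈ run.badStart α U t
    · have : Starts β C₁ T (fun s => run.reward s ω) t := h.1
      simp [h, this]
    · simp [h]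
  have e2 : ∑ t ∈ Finset.range T, {ω | (run.state t ω).first = t}.indicator (1 : Ω → ℝ) ω
      = (((Finset.range T).filter (Starts β C₁ T (fun s => run.reward s ω))).card : ℝ) := by
    rw [Finset.card_filter]
    push_cast
    refine Finset.sum_congr rfl fun t _ => ?_
    by_cases h : Starts β C₁ T (fun s => run.reward s ω) t
    · have h' : (run.state t ω).first = t := h
      simp [h, h']
    · have h' : ¬ (run.state t ω).first = t := h
      simp [h, h']
  rw [e1, e2]
  linarith

end BlackboxRun

/-! ### Consequences of a good event -/

/-- The base algorithm is measured by gaps within the profile, the sample by distances to one. A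
nearly optimal arm makes them comparable: a counted gap `g` is at least `8 α`, so `1 - μ k ≤ g + 3 α
≤ 2 g`. -/
lemma baseBound_le {C₀ : ℝ} (hC₀ : 0 ≤ C₀) {T : ℕ} (hT : 2 ≤ T) {β : ℝ} {m K r : ℕ}
    {ref μ : ℕ → ℝ} {α U : ℝ} (hα : blockResolution β m ≤ α)
    (hclose : ∀ k < K, |μ k - ref k| ≤ α) (hbest : ∃ k < K, 1 - α < μ k)
    (hU : ∑ k ∈ Finset.range K, inverseGap β m (μ k) ≤ U) :
    baseBound C₀ T K r ref (2 * α) ≤ C₀ * (2 * Real.logb 2 T * U + r * (2 * α)) := by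
  have hl := one_le_logb_two hT
  have hα0 : 0 < α := (blockResolution_pos β m).trans_le hα
  unfold baseBound
  gcongr
  calc _ ≤ ∑ k ∈ Finset.range K, 2 * Real.logb 2 T * inverseGap β m (μ k) := by
        refine Finset.sum_le_sum fun k hk => ?_
        have hig := inverseGap_pos β m (μ k)
        split_ifs with h
        · obtain ⟨i, hi, hμi⟩ := hbest
          have h1 : ref i ≤ ⨆ j : Fin K, ref j :=
            le_ciSup (f := fun j : Fin K => ref j) (Set.finite_range _).bddAbove ⟨i, hi⟩
          have h2 := abs_le.1 (hclose i hi)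
          have h3 := abs_le.1 (hclose k (Finset.mem_range.1 hk))
          set g := refGap K ref k with hg
          have hgdef : g = (⨆ j : Fin K, ref j) - ref k := rfl
          have hgpos : 0 < g := by linarith
          have h4 : max (blockResolution β m) (1 - μ k) ≤ 2 * g :=
            max_le (by linarith) (by linarith [h2.1, h2.2, h3.1, h3.2])
          have h5 : (2 * g)⁻¹ ≤ inverseGap β m (μ k) :=
            inv_anti₀ ((blockResolution_pos β m).trans_le (le_max_left _ _)) h4
          calc Real.logb 2 T / g = 2 * Real.logb 2 T * (2 * g)⁻¹ := by field_simp
            _ ≤ _ := by gcongr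
        · positivity
    _ ≤ _ := by rw [← Finset.mul_sum]; gcongr

/-- The tolerance for corruption in a block. -/
noncomputable def tolerance (β : ℝ) (T m : ℕ) : ℝ := blockResolution β m * Real.logb 2 T ^ 3

/-- The admissible sum of inverse gaps in a block. -/
noncomputable def gapBudget (β κ₂ : ℝ) (T m : ℕ) : ℝ :=
  2 * (2 * blockScale β m * (1 + κ₂ * m)) + 4 * Real.logb 2 T * (blockResolution β m)⁻¹

lemma blockResolution_le_tolerance {β : ℝ} {T : ℕ} (hT : 2 ≤ T) (m : ℕ) :
    blockResolution β m ≤ tolerance β T m :=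
  le_mul_of_one_le_right (blockResolution_pos β m).le (one_le_pow₀ (one_le_logb_two hT))

lemma tolerance_pos {β : ℝ} {T : ℕ} (hT : 2 ≤ T) (m : ℕ) : 0 < tolerance β T m :=
  (blockResolution_pos β m).trans_le (blockResolution_le_tolerance hT m)

lemma index_le_two_mul_logb {T m : ℕ} (hT : 2 ≤ T) (hm : 2 ^ m ≤ 2 * T) :
    (m : ℝ) ≤ 2 * Real.logb 2 T := by
  have h2 : (2 : ℝ) ^ m ≤ (T : ℝ) ^ 2 := by
    have h : (2 : ℝ) ^ m ≤ 2 * T := by exact_mod_cast hm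
    have : (2 : ℝ) ≤ T := by exact_mod_cast hT
    nlinarith
  have h3 := Real.logb_le_logb_of_le (b := 2) (by norm_num) (by positivity) h2
  rw [Real.logb_pow, Real.logb_pow] at h3
  simpa using h3

lemma gapBudget_le {β κ₂ : ℝ} (hκ₂ : 0 ≤ κ₂) {T m : ℕ} (hT : 2 ≤ T)
    (hm : 2 ^ m ≤ 2 * T) (hl : 8 * κ₂ + 8 ≤ Real.logb 2 T) :
    gapBudget β κ₂ T m ≤ blockScale β m * Real.logb 2 T ^ 2 := by
  have h1 := inv_blockResolution_le β m
  have h2 := index_le_two_mul_logb hT hm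
  have h3 := one_le_logb_two hT
  have h4 := blockScale_pos β m
  unfold gapBudget
  set l := Real.logb 2 T
  calc _ ≤ 2 * (2 * blockScale β m * (1 + κ₂ * (2 * l))) + 4 * l * blockScale β m := by gcongr
    _ = blockScale β m * (4 + 8 * κ₂ * l + 4 * l) := by ring
    _ ≤ _ := by
      gcongr
      nlinarith

namespace BlackboxRun

variable {Ω : Type u} [mΩ : MeasurableSpace Ω] {P : Measure Ω} {ν : Measure ℝ}
  {base : BaseAlgorithm} {β C₁ : ℝ} {T : ℕ} (run : BlackboxRun P ν base β C₁ T)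

/-- The change of the mean of the arm played in round `t`. -/
noncomputable def jump (t : ℕ) (ω : Ω) : ℝ :=
  |run.mean (t + 1) (run.arm t ω) ω - run.mean t (run.arm t ω) ω|

lemma jump_nonneg (t : ℕ) (ω : Ω) : 0 ≤ run.jump t ω := abs_nonneg _

/-- Only the played arm moves, so the variation along the played arms controls every arm at once.
This is what turns small variation into mild corruption. -/
lemma abs_mean_sub_le {s t : ℕ} (hst : s ≤ t) (ht : t < T) (i : ℕ) (ω : Ω) :
    |run.mean t i ω - run.mean s i ω| ≤ ∑ j ∈ Finset.Ico s t, run.jump j ω := by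
  induction t, hst using Nat.le_induction with
  | base => simp
  | succ t hst ih =>
    rw [Finset.sum_Ico_succ_top hst]
    have h1 : |run.mean (t + 1) i ω - run.mean t i ω| ≤ run.jump t ω := by
      by_cases h : i = run.arm t ω
      · rw [h]; rfl
      · rw [run.mean_succ_eq t ht i ω h, sub_self, abs_zero]
        exact run.jump_nonneg t ω
    calc _ ≤ _ := abs_sub_le _ (run.mean t i ω) _
      _ ≤ run.jump t ω + ∑ j ∈ Finset.Ico s t, run.jump j ω := add_le_add h1 (ih (by omega))
      _ = _ := add_comm _ _

/-- The rewards are close to the means, and the guarantee of the base algorithm holds in all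
blocks. -/
structure Good (C₀ : ℝ) (ω : Ω) : Prop where
  reward_le : ∀ t < T, ∀ s ≤ t,
    ∑ j ∈ Finset.Ico s (t + 1), ((1 - run.reward j ω) - 2 * run.loss j ω) < 4 * Real.logb 2 T
  loss_le : ∀ t < T, ∀ s ≤ t,
    ∑ j ∈ Finset.Ico s (t + 1), (run.loss j ω / 2 - (1 - run.reward j ω)) < 4 * Real.logb 2 T
  base_le : ∀ t < T, ∀ s ≤ t, ω ∉ run.baseFailure C₀ (tolerance β T) s (t - s)

variable {C₀ κ₂ : ℝ} {ω : Ω}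

lemma two_pow_index_le_two_mul {t : ℕ} (ht : t < T) (ω : Ω) :
    2 ^ (run.state t ω).index ≤ 2 * T := by
  have h1 := two_pow_index_le β C₁ T (fun s => run.reward s ω) t
  have h2 := first_le β C₁ T (fun s => run.reward s ω) t
  have h3 : 0 < T := by omega
  unfold state
  omega

/-- If the test fires in a block with a good sample, then the means have moved. -/
lemma tolerance_lt_sum_jump (hβ : 0 < β) (hC₀ : 0 < C₀) (hC₁ : 8 * (1 + C₀) ≤ C₁) (hκ₂ : 0 ≤ κ₂)
    (hT : 2 ≤ T) (hl : 8 * κ₂ + 8 ≤ Real.logb 2 T) (hgood : run.Good C₀ ω) {t : ℕ} (ht : t < T)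
    (hfire : Fires β C₁ T (fun s => run.reward s ω) t)
    (hsample : ω ∉ run.badStart (tolerance β T) (gapBudget β κ₂ T) (run.state t ω).first) :
    tolerance β T (run.state t ω).index
      < ∑ s ∈ Finset.Ico (run.state t ω).first t, run.jump s ω := by
  by_contra! hvar
  have hconst : ∀ s, (run.state t ω).first ≤ s → s ≤ t → run.state s ω = run.state t ω :=
    fun s h1 h2 => blockAt_eq_of_mem β C₁ T (fun s => run.reward s ω) h1 h2
  have hbd := blockAt_bounds β C₁ T (fun s => run.reward s ω) t
  have hn := run.two_pow_index_le_two_mul ht ω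
  unfold Fires at hfire
  change 1 ≤ (run.state t ω).index ∧ (run.state t ω).first ≤ t ∧
    t < (run.state t ω).first + 2 ^ (run.state t ω).index ∧ _ at hbd
  change testThreshold β C₁ T (run.state t ω).index
    ≤ ∑ s ∈ Finset.Icc (run.state t ω).first t, (1 - run.reward s ω) at hfire
  generalize run.state t ω = b at *
  obtain ⟨r, rfl⟩ : ∃ r, t = b.first + r := ⟨t - b.first, by omega⟩
  have hst : run.state b.first ω = b := hconst _ le_rfl hbd.2.1
  set α := tolerance β T b.index with hα
  have hα0 : 0 < α := tolerance_pos hT _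
  have hclose : ∀ s ≤ r, ∀ i, |run.mean (b.first + s) i ω - run.mean b.first i ω| ≤ α := by
    intro s hs i
    refine (run.abs_mean_sub_le (Nat.le_add_right _ _) (by omega) i ω).trans (le_trans ?_ hvar)
    apply Finset.sum_le_sum_of_subset_of_nonneg
    · apply Finset.Ico_subset_Ico le_rfl; omega
    · intro j _ _; exact run.jump_nonneg j ω
  have hinit : ∀ k, run.mean b.first (b.offset + k) ω = run.mean 0 (b.offset + k) ω := fun k =>
    run.mean_eq_initial (by omega) (by rw [hst]) (by rw [hst]; omega)
  have hs2 : (∃ k < numArms β b.index, 1 - α < run.mean b.first (b.offset + k) ω) ∧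
      ∑ k ∈ Finset.range (numArms β b.index),
        inverseGap β b.index (run.mean b.first (b.offset + k) ω) ≤ gapBudget β κ₂ T b.index := by
    have : ¬ ((fun i : Fin (numArms β b.index) => run.mean 0 (b.offset + i) ω)
      ∈ badVectors β b.index α (gapBudget β κ₂ T b.index)) := by
      intro h
      apply hsample
      refine ⟨by rw [hst], ?_⟩
      rw [hst]
      exact h
    simp only [badVectors, mem_ofPred_eq, not_or, not_forall, not_le] at this
    obtain ⟨⟨i, hi⟩, h2⟩ := this
    refine ⟨⟨i, i.2, by rw [hinit]; exact hi⟩, ?_⟩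
    simp only [hinit]
    rw [Finset.sum_range]
    exact h2.le
  have hbase : baseBound C₀ T (numArms β b.index) (r + 1)
      (run.roundedMean (tolerance β T) b.first ω) (2 * α)
      ≤ C₀ * (2 * Real.logb 2 T * gapBudget β κ₂ T b.index + (r + 1 : ℕ) * (2 * α)) := by
    refine baseBound_le hC₀.le hT (blockResolution_le_tolerance hT _)
      (μ := fun k => run.mean b.first (b.offset + k) ω) (fun k _ => ?_) hs2.1 hs2.2
    rw [roundedMean, hst]
    exact (mul_floor_div_mem hα0 (run.mean_mem _ (by omega) _ _)).2
  obtain ⟨k, hk, hbest⟩ := hs2.1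
  have hfail := hgood.base_le (b.first + r) ht b.first (Nat.le_add_right _ _)
  rw [Nat.add_sub_cancel_left] at hfail
  have hreg : ∑ s ∈ Finset.range (r + 1),
      (run.mean (b.first + s) (b.offset + k) ω - run.mean (b.first + s) (run.arm (b.first + s) ω) ω)
      ≤ baseBound C₀ T (numArms β b.index) (r + 1)
        (run.roundedMean (tolerance β T) b.first ω) (2 * α) := by
    by_contra! hcon
    apply hfail
    unfold baseFailure
    simp only [mem_ofPred_eq, hst, true_and]
    refine ⟨by omega, hn, fun s hs => hconst _ (by omega) (by omega),
      fun s hs k _ => hclose s hs _, k, hk, hcon⟩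
  have hloss : ∑ s ∈ Finset.Ico b.first (b.first + r + 1), run.loss s ω
      ≤ (r + 1 : ℕ) * (2 * α)
        + C₀ * (2 * Real.logb 2 T * gapBudget β κ₂ T b.index + (r + 1 : ℕ) * (2 * α)) := by
    rw [add_assoc, Finset.sum_Ico_eq_sum_range, Nat.add_sub_cancel_left]
    calc _ ≤ ∑ s ∈ Finset.range (r + 1), (2 * α + (run.mean (b.first + s) (b.offset + k) ω
          - run.mean (b.first + s) (run.arm (b.first + s) ω) ω)) := by
          refine Finset.sum_le_sum fun s hs => ?_
          have := abs_le.1 (hclose s (by have := Finset.mem_range.1 hs; omega) (b.offset + k))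
          unfold loss
          linarith [this.1]
      _ ≤ _ := by
          rw [Finset.sum_add_distrib, Finset.sum_const, Finset.card_range, nsmul_eq_mul]
          exact add_le_add le_rfl (hreg.trans hbase)
  have hrew := hgood.reward_le (b.first + r) ht b.first (Nat.le_add_right _ _)
  rw [Finset.sum_sub_distrib, ← Finset.mul_sum] at hrew
  rw [← Finset.Ico_succ_right_eq_Icc, Nat.succ_eq_succ, Nat.succ_eq_add_one] at hfire
  have hthr := le_testThreshold hβ (by linarith : 0 ≤ C₁) hT b.index
  have hl1 := one_le_logb_two hT
  have hbudget := gapBudget_le (β := β) hκ₂ hT hn hl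
  have hh := one_le_blockScale β b.index
  have hrα : (r + 1 : ℕ) * α ≤ blockScale β b.index * Real.logb 2 T ^ 3 := by
    rw [hα, tolerance, ← two_pow_mul_blockResolution, mul_assoc]
    have h1 : ((r + 1 : ℕ) : ℝ) ≤ 2 ^ b.index := by
      have : r + 1 ≤ 2 ^ b.index := by omega
      exact_mod_cast this
    have := blockResolution_pos β b.index
    gcongr
  set l := Real.logb 2 T
  set h := blockScale β b.index
  set U := gapBudget β κ₂ T b.index
  have hlU : C₀ * (l * U) ≤ C₀ * (h * l ^ 3) := by
    have : l * U ≤ l * (h * l ^ 2) := by gcongr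
    have e : l * (h * l ^ 2) = h * l ^ 3 := by ring
    rw [← e]
    exact mul_le_mul_of_nonneg_left this hC₀.le
  have hC₀rα := mul_le_mul_of_nonneg_left hrα hC₀.le
  have hl3 : l ≤ h * l ^ 3 := by
    calc l = 1 * l ^ 1 := by ring
      _ ≤ h * l ^ 3 := by
        gcongr
        norm_num
  -- In units of `h l ^ 3` the loss is at most `2 + 4 C₀`; passing to rewards doubles it and adds
  -- `4`, which gives exactly `8 (1 + C₀)`. The strict deviation bound yields the contradiction.
  have hC₁' : 8 * (1 + C₀) * (h * l ^ 3) ≤ C₁ * (h * l ^ 3) := by gcongr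
  nlinarith

/-- The loss in a block is at most of the order of the test threshold. -/
lemma sum_loss_le (hβ : 0 < β) (hC₁ : 0 < C₁) (hT : 2 ≤ T) (hgood : run.Good C₀ ω) {t : ℕ}
    (ht : t < T) :
    ∑ s ∈ Finset.Icc (run.state t ω).first t, run.loss s ω
      ≤ (4 * C₁ + 10) * Real.logb 2 T ^ 3 * blockScale β (run.state t ω).index := by
  have hl1 := one_le_logb_two hT
  have hpos : ∀ m, 0 < testThreshold β C₁ T m := by
    intro m
    refine lt_of_lt_of_le ?_ (le_testThreshold hβ hC₁.le hT m)
    have := blockScale_pos β m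
    positivity
  have h1 : ∑ s ∈ Finset.Ico (run.state t ω).first t, (1 - run.reward s ω)
      < testThreshold β C₁ T (run.state t ω).index :=
    sum_lt_testThreshold β C₁ T (fun s => run.reward s ω) hpos t
  have hle : (run.state t ω).first ≤ t := first_le β C₁ T (fun s => run.reward s ω) t
  have h2 := hgood.loss_le t ht _ hle
  have h3 := testThreshold_le (C₁ := C₁) hβ hC₁.le hT (run.state t ω).index
  -- The test was silent up to round `t - 1` and round `t` adds at most one, so in the same units
  -- the loss is at most `2 (2 C₁ + 1 + 4)`.
  have h4 := (run.reward_mem t ht ω).1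
  have hh := one_le_blockScale β (run.state t ω).index
  rw [Finset.sum_sub_distrib, ← Finset.sum_div,
    Finset.sum_Ico_succ_top hle (fun s => 1 - run.reward s ω)] at h2
  rw [← Finset.Ico_succ_right_eq_Icc, Nat.succ_eq_succ, Nat.succ_eq_add_one]
  set l := Real.logb 2 T
  set h := blockScale β (run.state t ω).index
  have hl3 : l ≤ l ^ 3 * h := by
    calc l = l ^ 1 * 1 := by ring
      _ ≤ _ := by
        gcongr
        norm_num
  nlinarith

open Classical in
/-- The regret bound on the good event, in terms of a bound on the number of bad samples. -/
lemma regret_le_min (hβ : 0 < β) (hC₀ : 0 < C₀) (hC₁ : 8 * (1 + C₀) ≤ C₁) (hκ₂ : 0 ≤ κ₂)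
    (hT : 2 ≤ T) (hl : 8 * κ₂ + 8 ≤ Real.logb 2 T) (hgood : run.Good C₀ ω) {w : ℝ} (hw : 1 ≤ w)
    (hbad : ∀ Z : ℝ, 0 ≤ Z → (fireCount β C₁ T (fun s => run.reward s ω) T : ℝ) ≤
      (((Finset.range T).filter fun t => Starts β C₁ T (fun s => run.reward s ω) t
        ∧ ω ∈ run.badStart (tolerance β T) (gapBudget β κ₂ T) t).card : ℝ) + Z →
      (fireCount β C₁ T (fun s => run.reward s ω) T : ℝ) + 1 ≤ w * (1 + Z)) :
    run.regret ω ≤ 12 * (10 * ((4 * C₁ + 10) * Real.logb 2 T ^ 3)) * w *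
      min (((run.numChanges ω : ℝ) + 1) ^ decayExponent β * (T : ℝ) ^ (1 - decayExponent β))
        (run.totalVariation ω ^ (decayExponent β / (1 + decayExponent β))
          * (T : ℝ) ^ (1 / (1 + decayExponent β)) + (T : ℝ) ^ (1 - decayExponent β)) := by
  have hC₁0 : 0 < C₁ := by linarith
  have hl1 := one_le_logb_two hT
  have hT0 : (0 : ℝ) < T := by exact_mod_cast (by omega : 0 < T)
  have hR : ∀ r : ℝ, 0 < r → run.regret ω ≤ (10 * ((4 * C₁ + 10) * Real.logb 2 T ^ 3)) *
      (r ^ (-decayExponent β) * (2 * T) + r ^ (1 - decayExponent β)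
        * (fireCount β C₁ T (fun s => run.reward s ω) T + 1)) := by
    intro r hr
    rw [regret_eq]
    exact sum_le_of_block_regret hβ (by positivity) hr
      fun t ht => run.sum_loss_le hβ hC₁0 hT hgood ht
  have hmove := fun t (ht : t < T) hf hs =>
    run.tolerance_lt_sum_jump hβ hC₀ hC₁ hκ₂ hT hl hgood ht hf hs
  have hmin : ∀ {A x y z : ℝ}, 0 ≤ A → x ≤ A * y → x ≤ A * z → x ≤ A * min y z := by
    intro A x y z _ h1 h2
    rcases le_total y z with h | h
    · rwa [min_eq_left h]
    · rwa [min_eq_right h]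
  refine hmin (by positivity) ?_ ?_
  · refine regret_le_of_numChanges (by positivity) hw hT0 (Nat.cast_nonneg _) hR
      (hbad _ (Nat.cast_nonneg _) ?_)
    -- Each firing without a bad sample needs at least one change, so no charge on lengths is
    -- required.
    have h := fireCount_le (β := β) (C₁ := C₁) (T := T) (y := fun s => run.reward s ω)
      (fun t => ω ∈ run.badStart (tolerance β T) (gapBudget β κ₂ T) t)
      (w := fun t => if run.mean (t + 1) (run.arm t ω) ω ≠ run.mean t (run.arm t ω) ω then 1 else 0)
      (fun s => by split_ifs <;> simp) (η := 0) le_rfl (N := T) (fun t ht hf hs => by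
        rw [zero_mul, add_zero]
        have h1 := (tolerance_pos (β := β) hT _).trans (hmove t ht hf hs)
        obtain ⟨s, hs, hs'⟩ := Finset.exists_ne_zero_of_sum_ne_zero h1.ne'
        have h2 : run.mean (s + 1) (run.arm s ω) ω ≠ run.mean s (run.arm s ω) ω := by
          intro h; apply hs'; unfold jump; rw [h, sub_self, abs_zero]
        refine le_trans ?_ (Finset.single_le_sum (fun i _ => ?_) hs)
        · rw [if_pos h2]
        · split_ifs <;> simp)
    have hn : (run.numChanges ω : ℝ) = ∑ t ∈ Finset.range (T - 1),
        if run.mean (t + 1) (run.arm t ω) ω ≠ run.mean t (run.arm t ω) ω then (1 : ℝ) else 0 := by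
      rw [numChanges, Finset.card_filter]
      push_cast
      rfl
    refine h.trans (le_of_eq ?_)
    rw [hn]
    ring
  · have hV : 0 ≤ run.totalVariation ω := Finset.sum_nonneg fun _ _ => abs_nonneg _
    have ha := decayExponent_pos hβ
    have ha' := decayExponent_le_half β
    refine regret_le_of_totalVariation ha (by linarith) (by positivity) hw hT0 hV hR ?_
    intro r hr
    have hra : 0 < r ^ decayExponent β := by positivity
    rw [add_assoc]
    refine hbad _ (by positivity) ?_
    have h := fireCount_le (β := β) (C₁ := C₁) (T := T) (y := fun s => run.reward s ω)
      (fun t => ω ∈ run.badStart (tolerance β T) (gapBudget β κ₂ T) t)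
      (w := fun t => r ^ decayExponent β * run.jump t ω)
      (fun s => mul_nonneg hra.le (run.jump_nonneg s ω)) (η := r⁻¹) (by positivity) (N := T)
      (fun t ht hf hs => by
        have h1 := (blockResolution_le_tolerance (β := β) hT _).trans (hmove t ht hf hs).le
        rw [blockResolution_eq] at h1
        rw [← Finset.mul_sum]
        refine (one_le_rpow_add (x := 2 ^ (run.state t ω).index) (a := decayExponent β)
          (by positivity) hr ha.le).trans ?_
        gcongr)
    rw [← Finset.mul_sum] at h
    refine h.trans (le_of_eq ?_)
    unfold totalVariation jump
    ring

end BlackboxRun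

/-! ### Probability of the good event and the final bound. -/

lemma exp_neg_mul_logb_le {T : ℕ} (hT : 2 ≤ T) (n : ℕ) :
    Real.exp (-(n * Real.logb 2 T)) ≤ 1 / (T : ℝ) ^ n := by
  have hT0 : (0 : ℝ) < T := by exact_mod_cast (by omega : 0 < T)
  have hlog : 0 ≤ Real.log T := Real.log_natCast_nonneg T
  have h1 : Real.log T ≤ Real.logb 2 T := by
    rw [Real.logb, le_div_iff₀ (Real.log_pos (by norm_num))]
    have := Real.log_two_lt_d9
    nlinarith
  calc _ ≤ Real.exp (-(n * Real.log T)) := by gcongr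
    _ = _ := by rw [Real.exp_neg, Real.exp_nat_mul, Real.exp_log hT0, one_div]

lemma one_sub_le_measureReal {Ω : Type*} [MeasurableSpace Ω] {P : Measure Ω}
    [IsProbabilityMeasure P] {S E : Set Ω} {c : ℝ} (h : ∀ ω, ω ∉ E → ω ∈ S) (hE : P.real E ≤ c) :
    1 - c ≤ P.real S := by
  have h1 : (univ : Set Ω) ⊆ S ∪ E := fun ω _ => by
    by_cases hω : ω ∈ E
    · exact Or.inr hω
    · exact Or.inl (h ω hω)
  have h2 : 1 ≤ P.real (S ∪ E) := by
    rw [← probReal_univ (μ := P)]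
    exact measureReal_mono h1
  have h3 := measureReal_union_le (μ := P) S E
  linarith

lemma le_numArms_mul_tolerance_rpow {β : ℝ} (hβ : 0 < β) {T : ℕ} (hT : 2 ≤ T) (m : ℕ) :
    Real.logb 2 T ^ (3 * β) ≤ numArms β m * tolerance β T m ^ β := by
  have hl := one_le_logb_two hT
  have h1 := two_rpow_le_numArms hβ m
  have h2 : tolerance β T m ^ β
      = (2 : ℝ) ^ (-((m : ℝ) * subsamplingExponent β)) * Real.logb 2 T ^ (3 * β) := by
    unfold tolerance
    rw [Real.mul_rpow (blockResolution_pos β m).le (by positivity), blockResolution,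
      ← Real.rpow_mul (by norm_num), ← Real.rpow_natCast (Real.logb 2 T),
      ← Real.rpow_mul (by linarith), subsamplingExponent_eq]
    congr 2
    ring
  rw [h2, ← mul_assoc]
  refine le_mul_of_one_le_left (by positivity) ?_
  calc (1 : ℝ) = 2 ^ ((m : ℝ) * subsamplingExponent β)
        * 2 ^ (-((m : ℝ) * subsamplingExponent β)) := by
        rw [← Real.rpow_add (by norm_num)]; simp
    _ ≤ _ := by gcongr

lemma measure_pi_badVectors_le {ν : Measure ℝ} {β κ₁ κ₂ : ℝ} (hβ : 0 < β) (hκ₁ : 0 < κ₁)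
    (hκ₂ : 0 < κ₂) (hν : IsRegularReservoir ν β κ₁ κ₂) {T : ℕ} (hT : 2 ≤ T) (m : ℕ) :
    (Measure.pi fun _ => ν).real (badVectors β m (tolerance β T m) (gapBudget β κ₂ T m))
      ≤ Real.exp (-(κ₁ * Real.logb 2 T ^ (3 * β))) + 1 / (T : ℝ) ^ 4 := by
  have := hν.isProb
  refine (measureReal_union_le _ _).trans (add_le_add ?_ ?_)
  · refine (measure_pi_forall_le hν (numArms_pos β m) (tolerance_pos hT m).le).trans ?_
    have := le_numArms_mul_tolerance_rpow hβ hT m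
    rw [Real.exp_le_exp, neg_le_neg_iff]
    calc _ ≤ κ₁ * (numArms β m * tolerance β T m ^ β) := by gcongr
      _ = _ := by ring
  · refine le_trans (measureReal_mono ?_) ((measure_pi_sum_inverseGap_le (β := β) (m := m)
      (z := 4 * Real.logb 2 T)).trans (by exact_mod_cast exp_neg_mul_logb_le hT 4))
    intro x (hx : gapBudget β κ₂ T m ≤ _)
    refine le_trans ?_ hx
    unfold gapBudget
    have := numArms_mul_integral_inverseGap_le hβ hκ₂.le hν m
    linarith

/-- The case `1 / 3 < β` is where `log^(3β) T` outgrows `log T`, so bad samples have polynomially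
small probability. In general it only beats `log log T`, which still makes `8 l q` small. -/
lemma eventually_large {β κ₁ : ℝ} (hβ : 0 < β) (hκ₁ : 0 < κ₁) (κ₂ : ℝ) :
    ∃ l₀ : ℝ, 1 ≤ l₀ ∧ ∀ l ≥ l₀, 8 * κ₂ + 8 ≤ l ∧ 16 ≤ l ∧
      (1 / 3 < β → 4 * l ≤ κ₁ * l ^ (3 * β)) ∧
      8 * l * Real.exp (-(κ₁ * l ^ (3 * β))) ≤ 1 / 2 := by
  have h1 : ∀ᶠ l : ℝ in Filter.atTop, 1 / 3 < β → 4 * l ≤ κ₁ * l ^ (3 * β) := by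
    by_cases h : 1 / 3 < β
    · have ht := tendsto_rpow_atTop (show 0 < 3 * β - 1 by linarith)
      filter_upwards [ht.eventually_ge_atTop (4 / κ₁), Filter.eventually_gt_atTop 0] with l hl hl0 _
      have e : l ^ (3 * β) = l ^ (3 * β - 1) * l := by
        rw [Real.rpow_sub_one hl0.ne', div_mul_cancel₀ _ hl0.ne']
      rw [div_le_iff₀ hκ₁] at hl
      rw [e]
      nlinarith
    · exact Filter.Eventually.of_forall fun l h' => absurd h' h
  have h2 : ∀ᶠ l : ℝ in Filter.atTop, 8 * l * Real.exp (-(κ₁ * l ^ (3 * β))) ≤ 1 / 2 := by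
    have ht := (tendsto_rpow_mul_exp_neg_mul_atTop_nhds_zero (1 / (3 * β)) κ₁ hκ₁).comp
      (tendsto_rpow_atTop (show 0 < 3 * β by linarith))
    filter_upwards [ht.eventually_le_const (show (0 : ℝ) < 1 / 16 by norm_num),
      Filter.eventually_gt_atTop 0] with l hl hl0
    simp only [Function.comp_apply] at hl
    rw [← Real.rpow_mul hl0.le, mul_one_div_cancel (by positivity), Real.rpow_one, neg_mul] at hl
    linarith
  obtain ⟨l₀, hl₀⟩ := Filter.eventually_atTop.1 (h1.and (h2.and
    ((Filter.eventually_ge_atTop (8 * κ₂ + 8)).and (Filter.eventually_ge_atTop 16))))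
  refine ⟨max 1 l₀, le_max_left _ _, fun l hl => ?_⟩
  obtain ⟨a1, a2, a3, a4⟩ := hl₀ l ((le_max_right _ _).trans hl)
  exact ⟨a3, a4, a1, a2⟩

namespace BlackboxRun

variable {Ω : Type u} [mΩ : MeasurableSpace Ω] {P : Measure Ω} {ν : Measure ℝ}
  {base : BaseAlgorithm} {β C₁ : ℝ} {T : ℕ} (run : BlackboxRun P ν base β C₁ T)

/-- The benchmark for the regret, in terms of the number and of the size of the changes. -/
noncomputable def benchmark (ω : Ω) : ℝ :=
  min (((run.numChanges ω : ℝ) + 1) ^ decayExponent β * (T : ℝ) ^ (1 - decayExponent β))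
    (run.totalVariation ω ^ (decayExponent β / (1 + decayExponent β))
      * (T : ℝ) ^ (1 / (1 + decayExponent β)) + (T : ℝ) ^ (1 - decayExponent β))

lemma one_le_benchmark (hβ : 0 < β) (hT : 2 ≤ T) (ω : Ω) : 1 ≤ run.benchmark ω := by
  have hT1 : (1 : ℝ) ≤ T := by exact_mod_cast (by omega : 1 ≤ T)
  have ha := decayExponent_pos hβ
  have ha' := decayExponent_le_half β
  have h1 : 1 ≤ (T : ℝ) ^ (1 - decayExponent β) := Real.one_le_rpow hT1 (by linarith)
  have hV : 0 ≤ run.totalVariation ω := Finset.sum_nonneg fun _ _ => abs_nonneg _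
  refine le_min ?_ ?_
  · have h2 : 1 ≤ ((run.numChanges ω : ℝ) + 1) ^ decayExponent β :=
      Real.one_le_rpow (by have : (0 : ℝ) ≤ run.numChanges ω := Nat.cast_nonneg _
                           linarith) ha.le
    nlinarith
  · have : 0 ≤ run.totalVariation ω ^ (decayExponent β / (1 + decayExponent β))
      * (T : ℝ) ^ (1 / (1 + decayExponent β)) := by positivity
    linarith

open Classical in
lemma regret_le_benchmark_of_no_badStart {C₀ κ₂ : ℝ} {ω : Ω} (hβ : 0 < β) (hC₀ : 0 < C₀)
    (hC₁ : 8 * (1 + C₀) ≤ C₁) (hκ₂ : 0 ≤ κ₂) (hT : 2 ≤ T) (hl : 8 * κ₂ + 8 ≤ Real.logb 2 T)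
    (hgood : run.Good C₀ ω)
    (hbad : ∀ t < T, ω ∉ run.badStart (tolerance β T) (gapBudget β κ₂ T) t) :
    run.regret ω ≤ 12 * (10 * ((4 * C₁ + 10) * Real.logb 2 T ^ 3)) * 1 * run.benchmark ω := by
  refine run.regret_le_min hβ hC₀ hC₁ hκ₂ hT hl hgood le_rfl fun Z _ h => ?_
  rw [Finset.filter_false_of_mem fun t ht h' => hbad t (Finset.mem_range.1 ht) h'.2] at h
  simp only [Finset.card_empty, Nat.cast_zero] at h
  linarith

open Classical in
lemma regret_le_benchmark_of_card_badStart {C₀ κ₂ q : ℝ} {ω : Ω} (hβ : 0 < β) (hC₀ : 0 < C₀)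
    (hC₁ : 8 * (1 + C₀) ≤ C₁) (hκ₂ : 0 ≤ κ₂) (hT : 2 ≤ T) (hl : 8 * κ₂ + 8 ≤ Real.logb 2 T)
    (hgood : run.Good C₀ ω) (hq0 : 0 ≤ q) (hq : 8 * Real.logb 2 T * q ≤ 1)
    (hbad : (((Finset.range T).filter fun t => Starts β C₁ T (fun s => run.reward s ω) t
        ∧ ω ∈ run.badStart (tolerance β T) (gapBudget β κ₂ T) t).card : ℝ)
      < 2 * q * (((Finset.range T).filter
        (Starts β C₁ T (fun s => run.reward s ω))).card : ℝ) + 4 * Real.logb 2 T) :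
    run.regret ω ≤ 12 * (10 * ((4 * C₁ + 10) * Real.logb 2 T ^ 3)) * (10 * Real.logb 2 T)
      * run.benchmark ω := by
  have hl1 := one_le_logb_two hT
  refine run.regret_le_min hβ hC₀ hC₁ hκ₂ hT hl hgood (by linarith) fun Z hZ h => ?_
  have hstarts := card_starts_le (β := β) (C₁ := C₁) (T := T) (y := fun s => run.reward s ω)
    (M := Nat.log 2 (2 * T)) (N := T)
    (fun t ht => Nat.le_log_of_pow_le (by norm_num) (run.two_pow_index_le_two_mul ht ω)) (by omega)
  have hM : (Nat.log 2 (2 * T) : ℝ) ≤ 2 * Real.logb 2 T :=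
    index_le_two_mul_logb hT (Nat.pow_log_le_self 2 (by omega))
  have hstarts' : (((Finset.range T).filter
      (Starts β C₁ T (fun s => run.reward s ω))).card : ℝ)
      ≤ (fireCount β C₁ T (fun s => run.reward s ω) T + 1) * (2 * Real.logb 2 T) := by
    calc _ ≤ ((fireCount β C₁ T (fun s => run.reward s ω) T : ℝ) + 1) * Nat.log 2 (2 * T) := by
          exact_mod_cast hstarts
      _ ≤ _ := by gcongr
  set F : ℝ := (fireCount β C₁ T (fun s => run.reward s ω) T : ℝ)
  have hF : 0 ≤ F := Nat.cast_nonneg _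
  -- At most half of `F + 1` is due to the typical share of bad samples; moving it to the left gives
  -- `F + 1 ≤ 2 + 8 log T + 2 Z`, hence the factor `10 log T`.
  have h1 : 2 * q * (((Finset.range T).filter
      (Starts β C₁ T (fun s => run.reward s ω))).card : ℝ) ≤ (F + 1) / 2 := by
    calc _ ≤ 2 * q * ((F + 1) * (2 * Real.logb 2 T)) := by gcongr
      _ = (8 * Real.logb 2 T * q) * ((F + 1) / 2) := by ring
      _ ≤ 1 * ((F + 1) / 2) := by gcongr
      _ = _ := one_mul _
  have h2 : 2 * Z ≤ 10 * Real.logb 2 T * Z := by gcongr; linarith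
  linarith

variable [IsProbabilityMeasure P]

/-- Block boundaries are random, so a union over all deterministic windows is taken: `T ^ 2` pairs
with three failures of probability `T⁻³` each. -/
lemma measureReal_not_good_le {C₀ : ℝ} (hbase : base.ToleratesMildCorruption.{u} C₀ T)
    (hT : 2 ≤ T) : P.real {ω | ¬ run.Good C₀ ω} ≤ 3 / T := by
  have hT0 : (0 : ℝ) < T := by exact_mod_cast (by omega : 0 < T)
  have hT1 : (1 : ℝ) ≤ T := by exact_mod_cast (by omega : 1 ≤ T)
  let E : ℕ × ℕ → Set Ω := fun p => {ω | p.2 ≤ p.1 ∧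
    (4 * Real.logb 2 T ≤ ∑ j ∈ Finset.Ico p.2 (p.1 + 1), ((1 - run.reward j ω) - 2 * run.loss j ω) ∨
    4 * Real.logb 2 T ≤ ∑ j ∈ Finset.Ico p.2 (p.1 + 1), (run.loss j ω / 2 - (1 - run.reward j ω)) ∨
    ω ∈ run.baseFailure C₀ (tolerance β T) p.2 (p.1 - p.2))}
  have hexp : Real.exp (-(4 * Real.logb 2 T)) ≤ 1 / (T : ℝ) ^ 3 := by
    refine le_trans (by exact_mod_cast exp_neg_mul_logb_le hT 4) ?_
    push_cast
    gcongr
    norm_num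
  have hE : ∀ p ∈ Finset.range T ×ˢ Finset.range T, P.real (E p) ≤ 3 * (1 / (T : ℝ) ^ 3) := by
    rintro ⟨t, s⟩ hp
    simp only [Finset.mem_product, Finset.mem_range] at hp
    by_cases hst : s ≤ t
    · have h1 := run.measureReal_reward_loss_le (P := P) (show s ≤ t + 1 by omega)
        (by omega : t + 1 ≤ T) (4 * Real.logb 2 T)
      have h2 := run.measureReal_loss_reward_le (P := P) (show s ≤ t + 1 by omega)
        (by omega : t + 1 ≤ T) (4 * Real.logb 2 T)
      have h3 : P.real (run.baseFailure C₀ (tolerance β T) s (t - s)) ≤ 1 / (T : ℝ) ^ 3 :=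
        ENNReal.toReal_le_of_le_ofReal (by positivity)
          (run.measure_baseFailure_le hbase (tolerance_pos hT) (by omega))
      have hsub : E (t, s) ⊆ {ω | 4 * Real.logb 2 T ≤ ∑ j ∈ Finset.Ico s (t + 1),
            ((1 - run.reward j ω) - 2 * run.loss j ω)} ∪
          ({ω | 4 * Real.logb 2 T ≤ ∑ j ∈ Finset.Ico s (t + 1),
            (run.loss j ω / 2 - (1 - run.reward j ω))} ∪
          run.baseFailure C₀ (tolerance β T) s (t - s)) := fun ω hω => hω.2
      have h4 := (measureReal_mono hsub).trans (measureReal_union_le (μ := P) _ _)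
      have h5 := measureReal_union_le (μ := P) {ω | 4 * Real.logb 2 T ≤
          ∑ j ∈ Finset.Ico s (t + 1), (run.loss j ω / 2 - (1 - run.reward j ω))}
          (run.baseFailure C₀ (tolerance β T) s (t - s))
      linarith
    · have : E (t, s) = ∅ := by ext ω; simp [E, hst]
      rw [this, measureReal_empty]
      positivity
  have hsub : {ω | ¬ run.Good C₀ ω} ⊆ ⋃ p ∈ Finset.range T ×ˢ Finset.range T, E p := by
    intro ω hω
    by_contra hcon
    apply hω
    simp only [mem_iUnion, not_exists, Finset.mem_product, Finset.mem_range] at hcon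
    refine ⟨fun t ht s hs => ?_, fun t ht s hs => ?_, fun t ht s hs => ?_⟩
    all_goals
      have h := hcon (t, s) ⟨ht, by omega⟩
      simp only [E, mem_ofPred_eq, hs, true_and, not_or, not_le] at h
    · exact h.1
    · exact h.2.1
    · exact h.2.2
  calc _ ≤ P.real (⋃ p ∈ Finset.range T ×ˢ Finset.range T, E p) :=
        measureReal_mono hsub (measure_ne_top _ _)
    _ ≤ ∑ p ∈ Finset.range T ×ˢ Finset.range T, P.real (E p) := measureReal_biUnion_finset_le _ _
    _ ≤ ∑ p ∈ Finset.range T ×ˢ Finset.range T, 3 * (1 / (T : ℝ) ^ 3) := Finset.sum_le_sum hE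
    _ = _ := by
        rw [Finset.sum_const, Finset.card_product, Finset.card_range, nsmul_eq_mul]
        push_cast
        field_simp

end BlackboxRun

/-- The regret bound for all exponents of the reservoir at once. -/
theorem exists_regret_le_benchmark {β C₀ C₁ κ₁ κ₂ : ℝ} (hβ : 0 < β) (hC₀ : 0 < C₀)
    (hC₁ : 8 * (1 + C₀) ≤ C₁) (hκ₁ : 0 < κ₁) (hκ₂ : 0 < κ₂) :
    ∃ C : ℝ, 0 < C ∧ ∀ (T : ℕ), 2 ≤ T → ∀ (ν : Measure ℝ), IsRegularReservoir ν β κ₁ κ₂ →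
    ∀ (base : BaseAlgorithm), base.ToleratesMildCorruption.{u} C₀ T →
    ∀ (Ω : Type u) [MeasurableSpace Ω] (P : Measure Ω) [IsProbabilityMeasure P]
      (run : BlackboxRun P ν base β C₁ T),
      (1 / 3 < β →
        1 - 4 / (T : ℝ) ≤ P.real {ω | run.regret ω ≤ C * Real.logb 2 T ^ 3 * run.benchmark ω}) ∧
      (1 - 4 / (T : ℝ) ≤ P.real {ω | run.regret ω ≤ C * Real.logb 2 T ^ 4 * run.benchmark ω}) := by
  obtain ⟨l₀, hl₀1, hl₀⟩ := eventually_large hβ hκ₁ κ₂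
  have hC₁0 : 0 < C₁ := by linarith
  -- The first summand covers small `T`, where `T < 2 ^ l₀` bounds the regret trivially and the
  -- benchmark is at least one; the second is `12 * 10 * 10 * (4 C₁ + 10)`.
  refine ⟨2 ^ l₀ + 1200 * (4 * C₁ + 10), by positivity, ?_⟩
  intro T hT ν hν base hbase Ω _ P _ run
  have hνp := hν.isProb
  have hT0 : (0 : ℝ) < T := by exact_mod_cast (by omega : 0 < T)
  have hT2 : (2 : ℝ) ≤ T := by exact_mod_cast hT
  have hl1 := one_le_logb_two hT
  set l := Real.logb 2 T with hl
  have hTl : (T : ℝ) = 2 ^ l := (Real.rpow_logb (by norm_num) (by norm_num) hT0).symm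
  have hbench := run.one_le_benchmark hβ hT
  rcases lt_or_ge l l₀ with hsmall | hlarge
  · have hall : ∀ ω, ∀ n : ℕ,
        run.regret ω ≤ (2 ^ l₀ + 1200 * (4 * C₁ + 10)) * l ^ n * run.benchmark ω := by
      intro ω n
      have h1 : run.regret ω ≤ T := by
        rw [run.regret_eq]
        calc _ ≤ ∑ t ∈ Finset.range T, (1 : ℝ) :=
              Finset.sum_le_sum fun t ht => (run.loss_mem (Finset.mem_range.1 ht) ω).2
          _ = _ := by simp
      have h2 : (T : ℝ) ≤ 2 ^ l₀ := by
        rw [hTl]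
        exact Real.rpow_le_rpow_of_exponent_le (by norm_num) hsmall.le
      have h3 : (1 : ℝ) ≤ l ^ n := one_le_pow₀ hl1
      have h4 : (1 : ℝ) ≤ l ^ n * run.benchmark ω := one_le_mul_of_one_le_of_one_le h3 (hbench ω)
      rw [mul_assoc]
      calc run.regret ω ≤ 2 ^ l₀ + 1200 * (4 * C₁ + 10) := by linarith
        _ ≤ _ := le_mul_of_one_le_right (by positivity) h4
    have h4T : 0 ≤ 4 / (T : ℝ) := by positivity
    constructor
    · intro _
      exact one_sub_le_measureReal (E := ∅) (fun ω _ => hall ω 3) (by simpa using h4T)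
    · exact one_sub_le_measureReal (E := ∅) (fun ω _ => hall ω 4) (by simpa using h4T)
  · obtain ⟨e1, e2, e3, e4⟩ := hl₀ l hlarge
    have hgood := run.measureReal_not_good_le (P := P) hbase hT
    have hq := measure_pi_badVectors_le hβ hκ₁ hκ₂ hν hT
    rw [← hl] at hq
    set q := Real.exp (-(κ₁ * l ^ (3 * β))) + 1 / (T : ℝ) ^ 4 with hqdef
    have hq0 : 0 ≤ q := by positivity
    -- The share `3 / T` is for rewards and base algorithm, `1 / T` for the samples.
    have h4 : (4 : ℝ) / T = 3 / T + 1 / T := by ring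
    constructor
    · intro hβ3
      refine one_sub_le_measureReal (E := {ω | ¬ run.Good C₀ ω} ∪
        {ω | ∃ t < T, ω ∈ run.badStart (tolerance β T) (gapBudget β κ₂ T) t}) (fun ω hω => ?_) ?_
      · simp only [mem_union, mem_ofPred_eq, not_or, not_not, not_exists, not_and] at hω
        refine (run.regret_le_benchmark_of_no_badStart hβ hC₀ hC₁ hκ₂.le hT e1 hω.1 hω.2).trans ?_
        have := zero_le_one.trans (hbench ω)
        have : 0 ≤ l ^ 3 * run.benchmark ω := by positivity
        have h2 : (0 : ℝ) < 2 ^ l₀ := by positivity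
        rw [← hl]
        nlinarith
      · refine (measureReal_union_le _ _).trans ?_
        rw [h4]
        refine add_le_add hgood ((run.measureReal_exists_badStart_le (P := P) hq).trans ?_)
        have h5 : Real.exp (-(κ₁ * l ^ (3 * β))) ≤ 1 / (T : ℝ) ^ 4 := by
          refine le_trans ?_ (exp_neg_mul_logb_le hT 4)
          rw [Real.exp_le_exp, ← hl]
          push_cast
          linarith [e3 hβ3]
        calc T * q ≤ T * (1 / (T : ℝ) ^ 4 + 1 / (T : ℝ) ^ 4) := by rw [hqdef]; gcongr
          _ = 2 / (T : ℝ) ^ 2 * (1 / T) := by field_simp; ring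
          _ ≤ 1 * (1 / T) := by
              gcongr
              rw [div_le_one (by positivity)]
              nlinarith
          _ = 1 / T := one_mul _
    · classical
      refine one_sub_le_measureReal (E := {ω | ¬ run.Good C₀ ω} ∪
        {ω | 2 * q * (((Finset.range T).filter
          (Starts β C₁ T (fun s => run.reward s ω))).card : ℝ) + 4 * l
          ≤ (((Finset.range T).filter fun t => Starts β C₁ T (fun s => run.reward s ω) t
          ∧ ω ∈ run.badStart (tolerance β T) (gapBudget β κ₂ T) t).card : ℝ)}) (fun ω hω => ?_) ?_
      · simp only [mem_union, mem_ofPred_eq, not_or, not_not, not_le] at hω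
        have hq8 : 8 * l * q ≤ 1 := by
          have h5 : l ≤ T := by
            rw [hTl]
            have := one_add_mul_self_le_rpow_one_add (s := 1) (by norm_num) hl1
            norm_num at this
            linarith
          have h6 : 8 * l * (1 / (T : ℝ) ^ 4) ≤ 1 / 2 := by
            have h7 : (16 : ℝ) ≤ T := by linarith
            rw [mul_one_div, div_le_div_iff₀ (by positivity) (by norm_num)]
            have h8 : (16 : ℝ) * T ≤ T * T := by gcongr
            have h9 : (1 : ℝ) ≤ (T : ℝ) ^ 2 := one_le_pow₀ (by linarith)
            nlinarith
          rw [hqdef, mul_add]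
          linarith
        refine (run.regret_le_benchmark_of_card_badStart hβ hC₀ hC₁ hκ₂.le hT e1 hω.1 hq0 hq8
          (by convert hω.2)).trans ?_
        have := zero_le_one.trans (hbench ω)
        have : 0 ≤ l ^ 4 * run.benchmark ω := by positivity
        have h2 : (0 : ℝ) < 2 ^ l₀ := by positivity
        rw [← hl]
        nlinarith
      · refine (measureReal_union_le _ _).trans ?_
        rw [h4]
        refine add_le_add hgood ?_
        have h5 := run.measureReal_card_badStart_le (P := P) hq (4 * l)
        have h6 : Real.exp (-(4 * l)) ≤ 1 / (T : ℝ) := by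
          refine le_trans (by exact_mod_cast exp_neg_mul_logb_le hT 4) ?_
          push_cast
          gcongr
          exact le_self_pow₀ (by linarith) (by norm_num)
        refine le_trans (le_of_eq ?_) (h5.trans h6)
        congr!

/-! ### The benchmark with explicit exponents. -/

theorem mainTheorem1 (β : ℝ) (hβ : 0 < β) (C₀ : ℝ) (hC₀ : 0 < C₀) :
    ∃ C₁min : ℝ, 0 < C₁min ∧ ∀ C₁ : ℝ, C₁min ≤ C₁ →
    ∀ κ₁ κ₂ : ℝ, 0 < κ₁ → 0 < κ₂ →
    ∃ C : ℝ, 0 < C ∧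
    ∀ (T : ℕ), 2 ≤ T →
    ∀ (ν : Measure ℝ), IsRegularReservoir ν β κ₁ κ₂ →
    ∀ (base : BaseAlgorithm), base.ToleratesMildCorruption.{u} C₀ T →
    ∀ (Ω : Type u) [MeasurableSpace Ω] (P : Measure Ω) [IsProbabilityMeasure P]
      (run : BlackboxRun P ν base β C₁ T),
      (1 ≤ β →
        1 - 4 / (T : ℝ) ≤ P.real {ω | run.regret ω ≤ C * Real.logb 2 T ^ 3 *
          min (((run.numChanges ω : ℝ) + 1) ^ (1 / (β + 1)) * (T : ℝ) ^ (β / (β + 1)))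
            (run.totalVariation ω ^ (1 / (β + 2)) * (T : ℝ) ^ ((β + 1) / (β + 2))
              + (T : ℝ) ^ (β / (β + 1)))}) ∧
      (1 / 3 < β → β < 1 →
        1 - 4 / (T : ℝ) ≤ P.real {ω | run.regret ω ≤ C * Real.logb 2 T ^ 3 *
          min (Real.sqrt (((run.numChanges ω : ℝ) + 1) * T))
            (run.totalVariation ω ^ (1 / 3 : ℝ) * (T : ℝ) ^ (2 / 3 : ℝ) + Real.sqrt T)}) ∧
      (β ≤ 1 / 3 →
        1 - 4 / (T : ℝ) ≤ P.real {ω | run.regret ω ≤ C * Real.logb 2 T ^ 4 *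
          min (Real.sqrt (((run.numChanges ω : ℝ) + 1) * T))
            (run.totalVariation ω ^ (1 / 3 : ℝ) * (T : ℝ) ^ (2 / 3 : ℝ) + Real.sqrt T)}) := by
  refine ⟨8 * (1 + C₀), by positivity, fun C₁ hC₁ κ₁ κ₂ hκ₁ hκ₂ => ?_⟩
  obtain ⟨C, hC, h⟩ := exists_regret_le_benchmark.{u} hβ hC₀ hC₁ hκ₁ hκ₂
  refine ⟨C, hC, fun T hT ν hν base hbase Ω _ P _ run => ?_⟩
  obtain ⟨h1, h2⟩ := h T hT ν hν base hbase Ω P run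
  have hlt : β < 1 → ∀ ω, run.benchmark ω
      = min (Real.sqrt (((run.numChanges ω : ℝ) + 1) * T))
        (run.totalVariation ω ^ (1 / 3 : ℝ) * (T : ℝ) ^ (2 / 3 : ℝ) + Real.sqrt T) := by
    intro hβ1 ω
    have ha : decayExponent β = 1 / 2 := by rw [decayExponent, if_neg (not_le.2 hβ1)]
    rw [BlackboxRun.benchmark, ha, Real.sqrt_eq_rpow, Real.sqrt_eq_rpow,
      Real.mul_rpow (by positivity) (by positivity)]
    norm_num
  refine ⟨fun hβ1 => ?_, fun hβ3 hβ1 => ?_, fun hβ3 => ?_⟩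
  · have hge : ∀ ω, run.benchmark ω
        = min (((run.numChanges ω : ℝ) + 1) ^ (1 / (β + 1)) * (T : ℝ) ^ (β / (β + 1)))
            (run.totalVariation ω ^ (1 / (β + 2)) * (T : ℝ) ^ ((β + 1) / (β + 2))
              + (T : ℝ) ^ (β / (β + 1))) := by
      intro ω
      have ha : decayExponent β = 1 / (β + 1) := by rw [decayExponent, if_pos hβ1]
      have e0 : 1 + 1 / (β + 1) = (β + 2) / (β + 1) := by field_simp; ring
      have e1 : 1 - 1 / (β + 1) = β / (β + 1) := by field_simp; ring
      have e2 : 1 / (β + 1) / (1 + 1 / (β + 1)) = 1 / (β + 2) := by rw [e0]; field_simp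
      have e3 : 1 / (1 + 1 / (β + 1)) = (β + 1) / (β + 2) := by rw [e0, one_div_div]
      rw [BlackboxRun.benchmark, ha, e1, e2, e3]
    simp only [← hge]
    exact h1 (by linarith)
  · simp only [← hlt hβ1]
    exact h1 hβ3
  · simp only [← hlt (by linarith)]
    exact h2
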